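/- Let $K$ be a field of characteristic $0$, $d\in\mathbb N$, and let finitely many kernels $G_i$ (with regularities in $\mathbb R$) and finitely many noises $\Xi_j$ (with parameters $\alpha_j\in\mathbb R$, the regularities of the underlying paths) be given. **Trees.** $\mathfrak T$ is the $K$-vector space spanned by planar rooted trees with vertices decorated by $\mathbb N^d$ and edges decorated by $(\{G_i\}\sqcup\{\Xi_j\})\times\mathbb N^d$, such that each vertex has at most one outgoing noise edge and the upper vertex of a noise edge (a noise vertex) is a leaf. The regularity $|\tau|$ is the sum over all vertices of the size of the decoration, plus the sum over all edges of $|G_i|-|a|$ for an edge $(G_i,a)$ and $\alpha_j-1-|a|$ for an edge $(\Xi_j,a)$. A planted tree $I^i_a(\tau)$ is $\tau$ attached by an edge $(G_i,a)$ to a root with decoration $0$. $\mathfrak T^+\subseteq\mathfrak T$ is the span of the trees $X^m\tau_1\cdots\tau_k$ ($k\ge 0$) with root decoration $m\in\mathbb N^d$ and branches $\tau_1,\dots,\tau_k$ from left to right, each $\tau_r=I^i_a(\tau)$ a planted tree of positive regularity (with $\tau\in\mathfrak T$ any tree). Let $1=X^0$ be the one-vertex tree with decoration $0$, and let $\varepsilon$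 be the coefficient of $1$. **Operations.** $\mathfrak T^+$ carries the product in which planted trees are concatenated at the root, $X^mX^n=X^{m+n}$, and $I_a(\tau)X^n=\sum_\ell\binom n\ell X^{n-\ell}I_{a-\ell}(\tau)$ (terms with a negative component are $0$), and the deshuffle coproduct $\Delta_{\sqcup\!\sqcup}(X^m\omega)=\sum_{m_1+m_2=m}\binom m{m_1}X^{m_1}\omega_{(1)}\otimes X^{m_2}\omega_{(2)}$, where $(\omega_{(1)},\omega_{(2)})$ runs over all splittings of the word $\omega$ of planted trees into a subword and its complement. For a tree $t$ let $\uparrow^i t$ be the sum, over the vertices of $t$ that are neither the root nor noise vertices, of $t$ with the decoration of that vertex raised by the $i$-th unit vector, and let $$I^i_a(\tau)\,\widehat\curvearrowright\, t=\sum_v\sum_\ell\binom{n_v}{\ell}\,\bigl(\tau \text{ grafted as new leftmost branch on } v \text{ by an edge } (G_i,a-\ell), \text{ with } n_v \text{ replaced by } n_v-\ell\bigr),$$ $v$ running over the same vertices. Let $\tilde V\subseteq\mathfrak T^+$ be the space of Lie polynomials in planted trees, and $V=\tilde V\oplus\langle X^1,\dots,X^d\rangle$ (here $X^i$ is $X^m$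 with $m$ the $i$-th unit vector). **Proposition.** 1. $\mathfrak T^+$ with the above product is a unital associative algebra, $V$ is a Lie subalgebra for its commutator $[\cdot,\cdot]_0$, with $[X^i,X^j]_0=0$ and $[I_a(\tau),X^i]_0=I_{a-e_i}(\tau)$ ($e_i$ the $i$-th unit vector; $0$ if $a_i=0$), and $\mathfrak T^+$ is the universal enveloping algebra of $V$. $\Delta_{\sqcup\!\sqcup}$ is multiplicative, and the elements of $V$ are primitive. 2. There is a unique bilinear map $\triangleright$ on $\mathfrak T^+$ which restricts to a post-Lie product on $(V,[\cdot,\cdot]_0)$ given by $I^i_a(\tau_1)\triangleright I^j_b(\tau_2)=I^i_a(\tau_1)\widehat\curvearrowright I^j_b(\tau_2)$ on planted trees of $\mathfrak T^+$, $X^i\triangleright y=\uparrow^i y$ for $y\in\tilde V$ and $v\triangleright X^i=0$ for $v\in V$, and which satisfies the Guin--Oudom relations $1\triangleright x=x$, $x\triangleright 1=\varepsilon(x)1$, $(vx)\triangleright u=v\triangleright(x\triangleright u)-(v\triangleright x)\triangleright u$ for $u,v\in V$, and $x\triangleright(yz)=(x_{(1)}\triangleright y)(x_{(2)}\triangleright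 z)$. 3. With $x\ast_+y=x_{(1)}\cdot(x_{(2)}\triangleright y)$, $(\mathfrak T^+,\ast_+,\Delta_{\sqcup\!\sqcup})$ is a Hopf algebra with unit $1$ and counit $\varepsilon$. 4. Pair $\mathfrak T^+$ with itself, and $\mathfrak T$ with itself, so that trees are orthonormal. The shuffle product ($X^m\omega_1\mathbin{\sqcup\!\sqcup}X^n\omega_2=\binom{m+n}{m}X^{m+n}(\omega_1\mathbin{\sqcup\!\sqcup}\omega_2)$) is dual to $\Delta_{\sqcup\!\sqcup}$, the product $\ast_+$ has a dual coproduct $\Delta^+:\mathfrak T^+\to\mathfrak T^+\otimes\mathfrak T^+$, and $H^+=(\mathfrak T^+,\mathbin{\sqcup\!\sqcup},\Delta^+)$ is a Hopf algebra. 5. There is a unique extension of $\triangleright$ to a bilinear map $\mathfrak T^+\times\mathfrak T\to\mathfrak T$ with $1\triangleright t=t$, $I^i_a(\tau)\triangleright t=I^i_a(\tau)\widehat\curvearrowright t$, $X^i\triangleright t=\uparrow^it$ and $(vx)\triangleright t=v\triangleright(x\triangleright t)-(v\triangleright x)\triangleright t$ for $v\in V$. Extending $\cdot$ to $\mathfrak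 T^+\times\mathfrak T\to\mathfrak T$ by the same formulas, $x\ast_+t=x_{(1)}\cdot(x_{(2)}\triangleright t)$ is an action of $(\mathfrak T^+,\ast_+)$ on $\mathfrak T$. It has a dual coaction $\Delta^+:\mathfrak T\to\mathfrak T^+\otimes\mathfrak T$. 6. The characters of $H^+$ form a group under convolution $g\star h=(g\otimes h)\Delta^+$, with neutral element $\varepsilon$. With $\Gamma_g=(g\otimes\mathrm{id})\Delta^+:\mathfrak T\to\mathfrak T$, one has $\Gamma_g\Gamma_h=\Gamma_{h\star g}$ for characters $g,h$, and $\mathcal G=\{\Gamma_g: g\text{ a character of }H^+\}$ is a group of invertible linear operators on $\mathfrak T$ (the recentering group). -/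

import Mathlib

open scoped TensorProduct

noncomputable section

namespace PlanarRS

/-- The data of the construction: the dimension `d`, finitely many convolution kernels with their
regularities, and finitely many noises `X^j`, `noiseReg j` being the regularity of the path `X^j`. -/
structure TreeData where
  d : ℕ
  numKernels : ℕ
  numNoises : ℕ
  kernelReg : Fin numKernels → ℝ
  noiseReg : Fin numNoises → ℝ

/-- Multi-indices in `ℕ^d`. -/
abbrev MI (S : TreeData) : Type := Fin S.d → ℕ

/-- The sum of the components of a multi-index. -/
def MI.size {S : TreeData} (m : MI S) : ℕ := ∑ i, m i

/-- The multi-index binomial coefficient. -/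
def MI.choose {S : TreeData} (m l : MI S) : ℕ := ∏ i, (m i).choose (l i)

/-- The unit multi-index. -/
def MI.unit {S : TreeData} (i : Fin S.d) : MI S := Pi.single i 1

/-- Planar rooted trees with vertices decorated by `ℕ^d` and edges decorated by
(kernels ⊔ noises) × `ℕ^d`, such that every vertex has at most one outgoing noise edge, and the
upper vertex of a noise edge (a noise vertex) has no outgoing edge.
The index tells whether the root has an outgoing noise edge.
* `vertex m` is the one-vertex tree with decoration `m`;
* `kernel i a τ σ` is `σ` with a new leftmost edge, decorated `(G_i, a)`, from its root to the root
  of `τ`;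
* `noise j a m σ` is `σ` with a new leftmost edge, decorated `(X^j, a)`, from its root to a leaf
  with decoration `m`. -/
inductive PTree (S : TreeData) : Bool → Type
  | vertex (m : MI S) : PTree S false
  | kernel {b c : Bool} (i : Fin S.numKernels) (a : MI S) (τ : PTree S b) (σ : PTree S c) :
      PTree S c
  | noise (j : Fin S.numNoises) (a m : MI S) (σ : PTree S false) : PTree S true

namespace PTree

variable {S : TreeData}

/-- The regularity of a tree. -/
def reg {b : Bool} : PTree S b → ℝ
  | vertex m => (m.size : ℝ)
  | kernel i a τ σ => S.kernelReg i - (a.size : ℝ) + τ.reg + σ.reg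
  | noise j a m σ => S.noiseReg j - 1 - (a.size : ℝ) + (m.size : ℝ) + σ.reg

/-- The decoration of the root. -/
def rootDec {b : Bool} : PTree S b → MI S
  | vertex m => m
  | kernel _ _ _ σ => σ.rootDec
  | noise _ _ _ σ => σ.rootDec

/-- Change the decoration of the root by `f`. -/
def mapRoot (f : MI S → MI S) {b : Bool} : PTree S b → PTree S b
  | vertex m => vertex (f m)
  | kernel i a τ σ => kernel i a τ (σ.mapRoot f)
  | noise j a m σ => noise j a m (σ.mapRoot f)

variable (K : Type*) [Field K]

/-- The sum, over all vertices `v` of a tree that are neither the root nor a noise vertex, of the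
results of applying the operation `R` to the subtree above `v`. -/
def sumInner (R : ∀ b : Bool, PTree S b → (PTree S b →₀ K)) :
    {b : Bool} → PTree S b → (PTree S b →₀ K)
  | _, vertex _ => 0
  | _, kernel (b := b) i a τ σ =>
      Finsupp.mapDomain (fun τ' => kernel i a τ' σ) (R b τ + sumInner R τ) +
        Finsupp.mapDomain (fun σ' => kernel i a τ σ') (sumInner R σ)
  | _, noise j a m σ => Finsupp.mapDomain (fun σ' => noise j a m σ') (sumInner R σ)

/-- Deformed left grafting of `τ` onto the root, using an edge decorated `(G_i, a)`:
`∑_ℓ (n choose ℓ) τ ↷_{i, a - ℓ} (↑^{-ℓ} σ)` with `n` the root decoration, where terms with a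
negative component in `a - ℓ` or `n - ℓ` are omitted. -/
def rootGraft (i : Fin S.numKernels) (a : MI S) {c : Bool} (τ : PTree S c) (b : Bool)
    (σ : PTree S b) : PTree S b →₀ K :=
  ∑ l ∈ Finset.Iic (σ.rootDec ⊓ a),
    Finsupp.single (kernel i (a - l) τ (σ.mapRoot (fun n => n - l))) ((σ.rootDec.choose l : ℕ) : K)

/-- Raising the root decoration by `m`. -/
def rootRaise (m : MI S) (b : Bool) (σ : PTree S b) : PTree S b →₀ K :=
  Finsupp.single (σ.mapRoot (fun n => n + m)) 1

end PTree

/-- The trees spanning the model space. -/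
abbrev Tree (S : TreeData) : Type := Σ b : Bool, PTree S b

/-- A planted tree of positive regularity whose root edge is a kernel edge: `I^i_a(τ)`. -/
structure Planted (S : TreeData) where
  i : Fin S.numKernels
  a : MI S
  τ : Tree S
  pos : 0 < S.kernelReg i - (a.size : ℝ) + τ.2.reg

/-- `I^i_{a - ℓ}(τ)`, used only for `ℓ ≤ a`. -/
def Planted.lower {S : TreeData} (p : Planted S) (l : MI S) : Planted S where
  i := p.i
  a := p.a - l
  τ := p.τ
  pos := by
    have h : (p.a - l).size ≤ p.a.size := Finset.sum_le_sum fun j _ => Nat.sub_le _ _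
    have h' : (((p.a - l).size : ℕ) : ℝ) ≤ (p.a.size : ℝ) := by exact_mod_cast h
    have := p.pos
    linarith

/-- The trees spanning `𝔗⁺`: `(m, [τ₁, …, τ_k])` is the tree `X^m τ₁ ⋯ τ_k` whose root is decorated
by `m` and whose branches are, from left to right, the planted trees `τ₁, …, τ_k`. -/
abbrev PosTree (S : TreeData) : Type := MI S × List (Planted S)

/-- An element of the basis of `𝔗⁺`, seen as a tree. -/
def PosTree.toTree {S : TreeData} (x : PosTree S) : Tree S :=
  ⟨false, x.2.foldr (fun p σ => PTree.kernel p.i p.a p.τ.2 σ) (PTree.vertex x.1)⟩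

section Spaces

variable (K : Type*) [Field K] (S : TreeData)

/-- The model space `𝔗`. -/
abbrev T := Tree S →₀ K

/-- The space `𝔗⁺`. -/
abbrev TPlus := PosTree S →₀ K

/-- The inclusion `𝔗⁺ ⊆ 𝔗`. -/
def incl : TPlus K S →ₗ[K] T K S := Finsupp.lmapDomain K K PosTree.toTree

variable {S}

/-- Extend an operation on trees linearly to `𝔗`. -/
def linT (R : ∀ b : Bool, PTree S b → (PTree S b →₀ K)) : Module.End K (T K S) :=
  Finsupp.linearCombination K fun t : Tree S => Finsupp.mapDomain (Sigma.mk t.1) (R t.1 t.2)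

/-- Deformed grafting of the planted tree `p` on all non-root non-noise vertices. -/
def graftT (p : Planted S) : Module.End K (T K S) :=
  linT K fun _ t => PTree.sumInner K (PTree.rootGraft K p.i p.a p.τ.2) t

/-- The operator `↑^i` on all non-root non-noise vertices. -/
def raiseT (i : Fin S.d) : Module.End K (T K S) :=
  linT K fun _ t => PTree.sumInner K (PTree.rootRaise K (MI.unit i)) t

variable (S)

/-- The associative product, as an action of `𝔗⁺` on `𝔗`: the branches of the left factor
are put to the left of the branches of the right one, and a planted tree is moved past a power of `X`
by `I_a(τ) X^n = ∑_ℓ (n choose ℓ) X^{n - ℓ} I_{a - ℓ}(τ)`. -/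
def dotT : TPlus K S →ₗ[K] Module.End K (T K S) :=
  Finsupp.linearCombination K fun x : PosTree S =>
    linT K (PTree.rootRaise K x.1) *
      (x.2.map fun p => linT K (PTree.rootGraft K p.i p.a p.τ.2)).prod

/-- The associative product of `𝔗⁺`:
`X^m τ₁ ⋯ τ_k` acts from the left as the composition of `X^m, τ₁, …, τ_k`, where `X^m` raises the
root decoration by `m` and `I_a(τ) · X^n ω = ∑_ℓ (n choose ℓ) X^{n - ℓ} I_{a - ℓ}(τ) ω`. -/
def dot : TPlus K S →ₗ[K] Module.End K (TPlus K S) :=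
  Finsupp.linearCombination K fun x : PosTree S =>
    Finsupp.lmapDomain K K (fun y : PosTree S => (y.1 + x.1, y.2)) *
      (x.2.map fun p => Finsupp.linearCombination K fun y : PosTree S =>
        ∑ l ∈ Finset.Iic (y.1 ⊓ p.a),
          Finsupp.single ((y.1 - l, p.lower l :: y.2) : PosTree S) ((y.1.choose l : ℕ) : K)).prod

variable {S}

/-- The planted tree `p` as an element of `𝔗⁺`. -/
def planted (p : Planted S) : TPlus K S := Finsupp.single (0, [p]) 1

/-- The element `X^i`, for a unit multi-index. -/
def X (i : Fin S.d) : TPlus K S := Finsupp.single (MI.unit i, []) 1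

variable (S)

/-- The unit: a single vertex with decoration `0`. -/
def one : TPlus K S := Finsupp.single (0, []) 1

/-- The coefficient of the unit. -/
def eps : TPlus K S →ₗ[K] K := Finsupp.lapply (0, [])

variable {K S}

/-- The commutator of the associative product. -/
def bracket (x y : TPlus K S) : TPlus K S := dot K S x y - dot K S y x

variable (K S)

/-- The Lie polynomials in planted trees, inside `𝔗⁺`. -/
def Vtilde : Submodule K (TPlus K S) :=
  sInf {W | (∀ p, planted K p ∈ W) ∧ ∀ x ∈ W, ∀ y ∈ W, bracket x y ∈ W}

/-- The space `V`, spanned by Lie polynomials in planted trees and by the `X^i`. -/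
def V : Submodule K (TPlus K S) := Vtilde K S ⊔ Submodule.span K (Set.range (X K))

end Spaces

/-- All ways to split a word into a subword and the complementary subword. -/
def unshuffles {α : Type*} : List α → List (List α × List α)
  | [] => [([], [])]
  | a :: w => (unshuffles w).map (fun q => (a :: q.1, q.2)) ++
      (unshuffles w).map (fun q => (q.1, a :: q.2))

/-- All shuffles of two words, with multiplicity. -/
def shuffles {α : Type*} : List α → List α → List (List α)
  | [], v => [v]
  | a :: u, [] => [a :: u]
  | a :: u, b :: v => (shuffles u (b :: v)).map (a :: ·) ++ (shuffles (a :: u) v).map (b :: ·)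
  termination_by u v => u.length + v.length

section Products

variable (K : Type*) [Field K] (S : TreeData)

/-- The deshuffle coproduct:
`Δ(X^m ω) = ∑_{m₁ + m₂ = m} (m choose m₁) X^{m₁} ω₍₁₎ ⊗ X^{m₂} ω₍₂₎`. -/
def deshuffle : TPlus K S →ₗ[K] TPlus K S ⊗[K] TPlus K S :=
  Finsupp.linearCombination K fun x : PosTree S =>
    ∑ l ∈ Finset.Iic x.1, ((x.1.choose l : ℕ) : K) •
      ((unshuffles x.2).map fun q =>
        (Finsupp.single (l, q.1) (1 : K) : TPlus K S) ⊗ₜ[K]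
          (Finsupp.single (x.1 - l, q.2) (1 : K) : TPlus K S)).sum

/-- The shuffle product. The `X^i` are treated as letters too, so that
`X^m ⧢ X^n = (m + n choose m) X^{m + n}`. -/
def shuffle : TPlus K S →ₗ[K] TPlus K S →ₗ[K] TPlus K S :=
  Finsupp.linearCombination K fun x : PosTree S =>
    Finsupp.linearCombination K fun y : PosTree S =>
      (((x.1 + y.1).choose x.1 : ℕ) : K) •
        ((shuffles x.2 y.2).map fun w =>
          (Finsupp.single (x.1 + y.1, w) (1 : K) : TPlus K S)).sum

variable {K S}

/-- The Grossman--Larson type product `x ∗ y = x₍₁₎ · (x₍₂₎ ▷ y)`, with `x ∈ 𝔗⁺` acting on a module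
through a product `·` and a grafting `▷`; Sweedler notation for the deshuffle coproduct. -/
def grossmanLarson {M : Type*} [AddCommGroup M] [Module K M]
    (mul tri : TPlus K S →ₗ[K] Module.End K M) : TPlus K S →ₗ[K] Module.End K M :=
  TensorProduct.lift ((LinearMap.mul K (Module.End K M)).compl₁₂ mul tri) ∘ₗ deshuffle K S

/-- `tri` restricts to the deformed grafting product of `V`, and is a post-Lie product there,
for the commutator of the associative product as Lie bracket. -/
structure IsDeformedPostLie (tri : TPlus K S →ₗ[K] Module.End K (TPlus K S)) : Prop where
  closed : ∀ x ∈ V K S, ∀ y ∈ V K S, tri x y ∈ V K S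
  planted_planted : ∀ p q : Planted S,
    incl K S (tri (planted K p) (planted K q)) = graftT K p (incl K S (planted K q))
  X_left : ∀ (i : Fin S.d), ∀ y ∈ Vtilde K S,
    incl K S (tri (X K i) y) = raiseT K i (incl K S y)
  X_right : ∀ y ∈ V K S, ∀ i : Fin S.d, tri y (X K i) = 0
  post_lie : ∀ x ∈ V K S, ∀ y ∈ V K S, ∀ z ∈ V K S,
    (tri x (tri y z) - tri (tri x y) z) - (tri y (tri x z) - tri (tri y x) z) =
      tri (bracket x y) z
  derivation : ∀ x ∈ V K S, ∀ y ∈ V K S, ∀ z ∈ V K S,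
    tri x (bracket y z) = bracket (tri x y) z + bracket y (tri x z)

/-- `tri` obeys the Guin--Oudom relations, by which a post-Lie product on `V` is extended to the
enveloping algebra `𝔗⁺`. -/
structure IsGuinOudom (tri : TPlus K S →ₗ[K] Module.End K (TPlus K S)) : Prop where
  one_left : ∀ x, tri (one K S) x = x
  one_right : ∀ x, tri x (one K S) = eps K S x • one K S
  mul_left : ∀ v ∈ V K S, ∀ x, ∀ u ∈ V K S,
    tri (dot K S v x) u = tri v (tri x u) - tri (tri v x) u
  mul_right : ∀ x y z, tri x (dot K S y z) =
    TensorProduct.lift ((dot K S).compl₁₂ (tri.flip y) (tri.flip z)) (deshuffle K S x)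

/-- `triT` extends `tri` to a map `𝔗⁺ ⊗ 𝔗 → 𝔗`, given by deformed grafting on all non-root
non-noise vertices. -/
structure IsExtendedGrafting (tri : TPlus K S →ₗ[K] Module.End K (TPlus K S))
    (triT : TPlus K S →ₗ[K] Module.End K (T K S)) : Prop where
  one_left : triT (one K S) = 1
  planted_left : ∀ p : Planted S, triT (planted K p) = graftT K p
  X_left : ∀ i : Fin S.d, triT (X K i) = raiseT K i
  mul_left : ∀ v ∈ V K S, ∀ x t,
    triT (dot K S v x) t = triT v (triT x t) - triT (tri v x) t
  extends_tri : ∀ x y, incl K S (tri x y) = triT x (incl K S y)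

end Products

section Algebra

attribute [local instance] LieRing.ofAssociativeRing LieAlgebra.ofAssociativeAlgebra

universe u v

variable {K : Type u} [Field K] {A : Type v} [AddCommGroup A] [Module K A]

/-- The given product, unit, coproduct and counit make `A` a Hopf algebra (with some antipode,
which is then unique). -/
def IsHopfAlgebra (mul : A →ₗ[K] A →ₗ[K] A) (one : A) (comul : A →ₗ[K] A ⊗[K] A)
    (counit : A →ₗ[K] K) : Prop :=
  ∃ (H : Type v) (_ : Ring H) (_ : HopfAlgebra K H) (e : A ≃ₗ[K] H),
    (∀ x y, e (mul x y) = e x * e y) ∧ e one = 1 ∧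
    (∀ x, CoalgebraStruct.comul (R := K) (e x) =
      TensorProduct.map e.toLinearMap e.toLinearMap (comul x)) ∧
    (∀ x, CoalgebraStruct.counit (R := K) (e x) = counit x)

/-- With the given product and unit, `A` is an associative algebra, the subspace `L` is a Lie
subalgebra for the commutator, and `A` is the universal enveloping algebra of `L`. -/
def IsEnvelopingAlgebra (mul : A →ₗ[K] A →ₗ[K] A) (one : A) (L : Submodule K A) : Prop :=
  ∃ (B : Type v) (_ : Ring B) (_ : Algebra K B) (e : A ≃ₗ[K] B),
    (∀ x y, e (mul x y) = e x * e y) ∧ e one = 1 ∧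
    ∃ L' : LieSubalgebra K B, L'.toSubmodule = L.map e.toLinearMap ∧
      Function.Bijective (UniversalEnvelopingAlgebra.lift K L'.incl)

/-- The map `δ` is dual to the action `act`, for the pairings in which the basis elements are
orthonormal: the coefficient of `x ⊗ s` in `δ t` is the coefficient of `t` in `act x s`. -/
def IsDualTo {α β : Type*} (δ : (β →₀ K) →ₗ[K] (α →₀ K) ⊗[K] (β →₀ K))
    (act : (α →₀ K) →ₗ[K] Module.End K (β →₀ K)) : Prop :=
  ∀ (x : α) (s t : β), finsuppTensorFinsupp' K α β (δ (Finsupp.single t 1)) (x, s) =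
    act (Finsupp.single x 1) (Finsupp.single s 1) t

/-- A character: a unital multiplicative linear form. -/
structure IsCharacter (mul : A →ₗ[K] A →ₗ[K] A) (one : A) (g : A →ₗ[K] K) : Prop where
  map_one : g one = 1
  map_mul : ∀ x y, g (mul x y) = g x * g y

/-- The convolution `(g ⊗ h) Δ` of linear forms. -/
def conv (comul : A →ₗ[K] A ⊗[K] A) (g h : A →ₗ[K] K) : A →ₗ[K] K :=
  (TensorProduct.lid K K).toLinearMap ∘ₗ TensorProduct.map g h ∘ₗ comul

/-- The operator `Γ_g = (g ⊗ id) δ` for a coaction `δ`. -/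
def Gam {M : Type*} [AddCommGroup M] [Module K M] (δ : M →ₗ[K] A ⊗[K] M) (g : A →ₗ[K] K) :
    M →ₗ[K] M :=
  (TensorProduct.lid K M).toLinearMap ∘ₗ TensorProduct.map g LinearMap.id ∘ₗ δ

end Algebra

end PlanarRS

end

/-! The algebra 𝔗⁺ is presented by commuting X^i, planted trees, and I_a(τ)X^i = X^i I_a(τ) +
I_{a-e_i}(τ), the words X^m τ₁⋯τ_k being the normal forms. This universal property
(`Relations.toLin_dot`, `Relations.toHom`) is used five times: in End(𝔗⁺) it is associativity, in 𝔗⁺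
⊗ 𝔗⁺ and in K it gives the coproduct and the counit, in End(𝔗) the action on 𝔗, and in U(V) an
inverse of U(V) → 𝔗⁺, so that no PBW theorem is needed.

Grafting is defined for all x ∈ 𝔗⁺ at once, by recursion on the tree it acts on. Cut the tree at its
leftmost kernel edge into an upper part τ and a remainder σ. The root of τ is an inner vertex of the
whole tree, while the root of σ is still the root, so x acts on τ by x₍₁₎ ∗ τ and on σ by x₍₂₎ ▷ σ
(`act_kerT`), where x ∗ t = x₍₁₎ · (x₍₂₎ ▷ t). From this follow the distributivity x ▷ (y · t) =
(x₍₁₎ ▷ y) · (x₍₂₎ ▷ t) (`act_mul_dotA`), the compatibility of ▷ and ∗ with the coproduct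
(`comul_tri`, `comul_gl`), and then (x ∗ y) ▷ t = x ▷ (y ▷ t) (`act_gl`), which yields the
associativity of ∗. For primitive v one has v ∗ x = vx + v ▷ x, so `act_gl` becomes the Guin–Oudom
relation, and its antisymmetrisation is the post-Lie identity. Uniqueness is an induction on word
length, which g ▷ does not increase for a generator g.

The pair (regularity, number of edges) is additive under ·, ▷ and ∗, since a deformed grafting
lowers a vertex decoration and an edge decoration by the same ℓ. Three facts rest on this. 𝔗⁺ is
stable under ▷, because its trees have nonnegative regularity. A given tree occurs in x ∗ s for only
finitely many pairs of trees (x, s), because positivity bounds |a| in I_a(τ) (`finite_star`); hence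
the dual maps exist. The coproduct Δ⁺ is triangular for a well-founded rank, so its antipode is
obtained by recursion; for the deshuffle coproduct the word length serves as rank.

All remaining claims on H⁺ and on the coaction are transposes: coassociativity of associativity,
multiplicativity of Δ⁺ of `comul_gl`, and the composition rule for Γ_g of the module law. -/

open scoped TensorProduct

noncomputable section

namespace PlanarRS

section

/-! ### Multi-indices and the Vandermonde identity -/

namespace MI

variable {S : TreeData}

theorem choose_zero_right (m : MI S) : m.choose 0 = 1 := by simp [MI.choose]

theorem choose_self (m : MI S) : m.choose m = 1 := by simp [MI.choose]

/-- The Vandermonde identity for multi-indices. -/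
theorem choose_add (n m L : MI S) :
    (n + m).choose L = ∑ q ∈ (Finset.Iic m ×ˢ Finset.Iic n).filter (fun q => q.2 + q.1 = L),
      m.choose q.1 * n.choose q.2 := by
  have h : (n + m).choose L = ∑ x ∈ Fintype.piFinset fun i => Finset.HasAntidiagonal.antidiagonal (L i),
      ∏ i, (n i).choose (x i).1 * (m i).choose (x i).2 := by
    refine Eq.trans ?_ (Finset.prod_univ_sum
      (fun i : Fin S.d => Finset.HasAntidiagonal.antidiagonal (L i))
      fun i (q : ℕ × ℕ) => (n i).choose q.1 * (m i).choose q.2)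
    exact Finset.prod_congr rfl fun i _ => Nat.add_choose_eq _ _ _
  rw [h]
  symm
  -- The antidiagonals also contain indices that exceed n or m. Their binomials vanish, so it is
  -- enough to match the nonzero terms.
  refine Finset.sum_bij_ne_zero (fun q _ _ i => (q.2 i, q.1 i)) ?_ ?_ ?_ ?_
  · rintro q hq -
    simp only [Finset.mem_filter] at hq
    simp [← hq.2]
  · rintro q - - q' - - h
    ext i
    · exact congrArg Prod.snd (congrFun h i)
    · exact congrArg Prod.fst (congrFun h i)
  · intro x hx hx0
    have hx' : ∀ i, (x i).1 + (x i).2 = L i := by simpa using hx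
    have hne : ∀ i, (n i).choose (x i).1 ≠ 0 ∧ (m i).choose (x i).2 ≠ 0 := fun i =>
      mul_ne_zero_iff.1 (Finset.prod_ne_zero_iff.1 hx0 i (Finset.mem_univ i))
    have hx0' := hx0
    rw [Finset.prod_mul_distrib, mul_comm] at hx0'
    refine ⟨(fun i => (x i).2, fun i => (x i).1), ?_, hx0', rfl⟩
    simp only [Finset.mem_filter, Finset.mem_product, Finset.mem_Iic]
    refine ⟨⟨fun i => ?_, fun i => ?_⟩, funext hx'⟩
    · exact not_lt.1 fun h => (hne i).2 (Nat.choose_eq_zero_of_lt h)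
    · exact not_lt.1 fun h => (hne i).1 (Nat.choose_eq_zero_of_lt h)
  · rintro q - -
    rw [Finset.prod_mul_distrib, mul_comm]
    rfl

theorem sum_choose_add {K M : Type*} [Field K] [AddCommGroup M] [Module K M] (n m : MI S)
    (f : MI S → M) :
    ∑ l ∈ Finset.Iic (n + m), (((n + m).choose l : ℕ) : K) • f l =
      ∑ l ∈ Finset.Iic m, ((m.choose l : ℕ) : K) •
        ∑ k ∈ Finset.Iic n, ((n.choose k : ℕ) : K) • f (k + l) := by
  simp_rw [Finset.smul_sum, smul_smul]
  rw [← Finset.sum_product' (Finset.Iic m) (Finset.Iic n)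
    (fun l k => (((m.choose l : ℕ) : K) * ((n.choose k : ℕ) : K)) • f (k + l))]
  rw [← Finset.sum_fiberwise_of_maps_to (g := fun q : MI S × MI S => q.2 + q.1)
    (t := Finset.Iic (n + m))]
  · refine Finset.sum_congr rfl fun L _ => ?_
    rw [choose_add n m L, Nat.cast_sum, Finset.sum_smul]
    refine Finset.sum_congr rfl fun q hq => ?_
    rw [(Finset.mem_filter.1 hq).2, Nat.cast_mul]
  · intro q hq
    simp only [Finset.mem_product, Finset.mem_Iic] at hq ⊢
    exact add_le_add hq.2 hq.1

/-- The condition k + l ≤ a means l ≤ a and k ≤ a - l, so the cutoff that keeps edge decorations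
nonnegative passes through the Vandermonde convolution. In this form, moving a planted tree past
X^(n+m) splits into two successive moves. -/
theorem sum_choose_add_inf {K M : Type*} [Field K] [AddCommGroup M] [Module K M] (n m a : MI S)
    (f : MI S → M) :
    ∑ l ∈ Finset.Iic ((n + m) ⊓ a), (((n + m).choose l : ℕ) : K) • f l =
      ∑ l ∈ Finset.Iic (m ⊓ a), ((m.choose l : ℕ) : K) •
        ∑ k ∈ Finset.Iic (n ⊓ (a - l)), ((n.choose k : ℕ) : K) • f (k + l) := by
  classical
  have key : ∀ (p q : MI S) (g : MI S → M), ∑ l ∈ Finset.Iic (p ⊓ q), g l =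
      ∑ l ∈ Finset.Iic p, if l ≤ q then g l else 0 := by
    intro p q g
    rw [← Finset.sum_filter]
    refine Finset.sum_congr ?_ fun _ _ => rfl
    ext l
    simp
  have h := sum_choose_add (K := K) n m fun l => if l ≤ a then f l else 0
  simp only [smul_ite, smul_zero] at h
  rw [key, h, key]
  refine Finset.sum_congr rfl fun l _ => ?_
  split_ifs with hl
  · rw [key]
    congr 1
    refine Finset.sum_congr rfl fun k _ => ?_
    have : k + l ≤ a ↔ k ≤ a - l := (le_tsub_iff_right hl).symm
    simp only [this]
  · rw [Finset.sum_eq_zero, smul_zero]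
    intro k _
    rw [if_neg]
    exact fun h => hl (le_trans (le_add_of_nonneg_left (zero_le)) h)

theorem unit_le_iff {m : MI S} {i : Fin S.d} : MI.unit i ≤ m ↔ 0 < m i := by
  constructor
  · intro h
    have := h i
    simp [MI.unit] at this
    omega
  · intro h j
    by_cases hj : j = i
    · subst hj; simp [MI.unit]; omega
    · simp [MI.unit, hj]

theorem Iic_unit (i : Fin S.d) : Finset.Iic (MI.unit i : MI S) = {0, MI.unit i} := by
  ext l
  simp only [Finset.mem_Iic, Finset.mem_insert, Finset.mem_singleton]
  constructor
  · intro h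
    by_cases hl : l i = 0
    · left
      ext j
      have := h j
      by_cases hj : j = i
      · subst hj; simpa using hl
      · simpa [MI.unit, hj] using this
    · exact Or.inr (le_antisymm h (unit_le_iff.2 (Nat.pos_of_ne_zero hl)))
  · rintro (rfl | rfl)
    · exact zero_le
    · exact le_rfl

theorem unit_ne_zero (i : Fin S.d) : (MI.unit i : MI S) ≠ 0 := by
  intro h
  simpa [MI.unit] using congrFun h i

theorem sum_Iic_unit {M : Type*} [AddCommGroup M] (i : Fin S.d) (f : MI S → M) :
    ∑ l ∈ Finset.Iic (MI.unit i), f l = f 0 + f (MI.unit i) := by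
  rw [Iic_unit, Finset.sum_pair (unit_ne_zero i).symm]

theorem sum_Iic_unit_inf {M : Type*} [AddCommGroup M] (i : Fin S.d) (a : MI S) (f : MI S → M) :
    ∑ l ∈ Finset.Iic (MI.unit i ⊓ a), f l = f 0 + if 0 < a i then f (MI.unit i) else 0 := by
  split_ifs with h
  · rw [inf_eq_left.2 (unit_le_iff.2 h), sum_Iic_unit]
  · have : (MI.unit i ⊓ a : MI S) = 0 := by
      ext j
      by_cases hj : j = i
      · subst hj; simp only [Pi.inf_apply, Pi.zero_apply]; simp; omega
      · simp [MI.unit, hj]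
    rw [this]
    have : Finset.Iic (0 : MI S) = {0} := by ext; simp
    rw [this]
    simp

theorem size_add (m n : MI S) : (m + n).size = m.size + n.size := by
  simp [MI.size, Finset.sum_add_distrib]

theorem size_zero : (0 : MI S).size = 0 := by simp [MI.size]

theorem size_unit (i : Fin S.d) : (MI.unit i : MI S).size = 1 := by
  simp [MI.size, MI.unit]

theorem size_eq_zero {m : MI S} : m.size = 0 ↔ m = 0 := by
  simp [MI.size, funext_iff]

theorem size_mono {m n : MI S} (h : m ≤ n) : m.size ≤ n.size := Finset.sum_le_sum fun i _ => h i

theorem size_sub {m n : MI S} (h : n ≤ m) : (m - n).size + n.size = m.size := by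
  rw [← size_add, tsub_add_cancel_of_le h]

theorem finite_size_le (N : ℕ) : {m : MI S | m.size ≤ N}.Finite := by
  refine (Set.finite_Iic (fun _ => N : MI S)).subset fun m hm i => ?_
  exact (Finset.single_le_sum (fun j _ => Nat.zero_le (m j)) (Finset.mem_univ i)).trans hm

theorem eq_zero_or_eq_add_unit (m : MI S) : m = 0 ∨ ∃ n i, m = n + MI.unit i := by
  by_cases h : m = 0
  · exact Or.inl h
  · right
    have : ∃ i, 0 < m i := by
      by_contra h'
      push Not at h'
      exact h (funext fun i => Nat.le_zero.1 (h' i))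
    obtain ⟨i, hi⟩ := this
    exact ⟨m - MI.unit i, i, (tsub_add_cancel_of_le (unit_le_iff.2 hi)).symm⟩

@[elab_as_elim]
theorem induction_on {p : MI S → Prop} (m : MI S) (h0 : p 0)
    (h : ∀ n i, p n → p (n + MI.unit i)) : p m := by
  generalize hN : m.size = N
  induction N generalizing m with
  | zero => rwa [size_eq_zero.1 hN]
  | succ N ih =>
    rcases eq_zero_or_eq_add_unit m with rfl | ⟨n, i, rfl⟩
    · exact h0
    · refine h n i (ih n ?_)
      rw [size_add, size_unit] at hN
      omega

end MI

namespace Planted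

variable {S : TreeData}

@[ext]
theorem ext {p q : Planted S} (hi : p.i = q.i) (ha : p.a = q.a) (hτ : p.τ = q.τ) : p = q := by
  cases p; cases q; simp_all

theorem lower_zero (p : Planted S) : p.lower 0 = p := by ext <;> simp [lower]

theorem lower_lower (p : Planted S) (k l : MI S) : (p.lower l).lower k = p.lower (k + l) := by
  ext <;> simp [lower, tsub_tsub, add_comm]

end Planted

/-! ### Normal forms and the universal property of 𝔗⁺ -/

section Universal

variable {K : Type*} [Field K] {S : TreeData}
variable {B : Type*} [Ring B] [Algebra K B]

/-- Data in an algebra `B` satisfying the relations between powers of `X` and planted trees. -/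
structure Relations (K : Type*) [Field K] (S : TreeData) (B : Type*) [Ring B] [Algebra K B] where
  E : MI S → B
  P : Planted S → B
  E_zero : E 0 = 1
  E_add : ∀ m n, E (m + n) = E m * E n
  P_E : ∀ p i, P p * E (MI.unit i) =
    E (MI.unit i) * P p + if 0 < p.a i then P (p.lower (MI.unit i)) else 0

namespace Relations

variable (r : Relations K S B)

/-- The relation is imposed for a single X^i only; X^m is crossed one X^i at a time, and the
truncated Vandermonde identity collects the terms. -/
theorem P_mul_E (p : Planted S) (m : MI S) :
    r.P p * r.E m = ∑ l ∈ Finset.Iic (m ⊓ p.a), ((m.choose l : ℕ) : K) •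
      (r.E (m - l) * r.P (p.lower l)) := by
  induction m using MI.induction_on with
  | h0 =>
    have : (0 ⊓ p.a : MI S) = 0 := inf_eq_left.2 (zero_le)
    rw [this]
    have : Finset.Iic (0 : MI S) = {0} := by ext; simp
    rw [this]
    simp [r.E_zero, MI.choose_zero_right, Planted.lower_zero]
  | h m i ih =>
    have h1 : ∀ q : Planted S, r.P q * r.E (MI.unit i) =
        ∑ l ∈ Finset.Iic (MI.unit i ⊓ q.a), (((MI.unit i).choose l : ℕ) : K) •
          (r.E (MI.unit i - l) * r.P (q.lower l)) := by
      intro q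
      rw [MI.sum_Iic_unit_inf, r.P_E]
      simp [MI.choose_zero_right, MI.choose_self, r.E_zero, Planted.lower_zero]
    rw [add_comm m, MI.sum_choose_add_inf, add_comm _ m, r.E_add, ← mul_assoc, ih, Finset.sum_mul]
    refine Finset.sum_congr rfl fun l hl => ?_
    rw [smul_mul_assoc, mul_assoc, h1, Finset.mul_sum]
    congr 1
    refine Finset.sum_congr rfl fun k hk => ?_
    simp only [Finset.mem_Iic, le_inf_iff] at hl hk
    rw [mul_smul_comm, ← mul_assoc, ← r.E_add, Planted.lower_lower]
    congr 3
    rw [add_comm k, tsub_add_tsub_comm hl.1 hk.1, add_comm l]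

/-- The linear map sending `X^m τ₁ ⋯ τ_k` to the corresponding product in `B`. -/
def toLin : TPlus K S →ₗ[K] B :=
  Finsupp.linearCombination K fun x : PosTree S => r.E x.1 * (x.2.map r.P).prod

theorem toLin_single (x : PosTree S) (c : K) :
    r.toLin (Finsupp.single x c) = c • (r.E x.1 * (x.2.map r.P).prod) := by
  simp [toLin]

theorem toLin_raise (m : MI S) (y : TPlus K S) :
    r.toLin (Finsupp.lmapDomain K K (fun y : PosTree S => (y.1 + m, y.2)) y) =
      r.E m * r.toLin y := by
  induction y using Finsupp.induction_linear with
  | zero => simp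
  | add x y hx hy => simp only [map_add, mul_add, hx, hy]
  | single x c =>
    rw [Finsupp.lmapDomain_apply, Finsupp.mapDomain_single, toLin_single, toLin_single,
      add_comm x.1, r.E_add, mul_smul_comm, mul_assoc]

/-- Left multiplication by a planted tree. -/
def graft (K : Type*) [Field K] (p : Planted S) : Module.End K (TPlus K S) :=
  Finsupp.linearCombination K fun y : PosTree S =>
    ∑ l ∈ Finset.Iic (y.1 ⊓ p.a),
      Finsupp.single ((y.1 - l, p.lower l :: y.2) : PosTree S) ((y.1.choose l : ℕ) : K)

theorem toLin_graft (p : Planted S) (y : TPlus K S) :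
    r.toLin (graft K p y) = r.P p * r.toLin y := by
  induction y using Finsupp.induction_linear with
  | zero => simp
  | add x y hx hy => simp only [map_add, mul_add, hx, hy]
  | single x c =>
    rw [graft, Finsupp.linearCombination_single, map_smul, map_sum, toLin_single, mul_smul_comm,
      ← mul_assoc, P_mul_E, Finset.sum_mul]
    congr 1
    refine Finset.sum_congr rfl fun l _ => ?_
    rw [toLin_single, smul_mul_assoc, List.map_cons, List.prod_cons, mul_assoc]

theorem dot_single (x : PosTree S) (c : K) :
    dot K S (Finsupp.single x c) =
      c • (Finsupp.lmapDomain K K (fun y : PosTree S => (y.1 + x.1, y.2)) *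
        (x.2.map (graft K)).prod) := by
  simp only [dot, Finsupp.linearCombination_single]
  rfl

/-- Peeling off one letter of x at a time, each elementary left multiplication of 𝔗⁺ becomes left
multiplication by its image in B. Associativity of `dot` is not used and can therefore be deduced
from this. -/
theorem toLin_dot (x y : TPlus K S) : r.toLin (dot K S x y) = r.toLin x * r.toLin y := by
  induction x using Finsupp.induction_linear with
  | zero => simp
  | add x x' hx hy => simp only [map_add, add_mul, LinearMap.add_apply, hx, hy]
  | single x c =>
    obtain ⟨m, w⟩ := x
    rw [dot_single, toLin_single, LinearMap.smul_apply, map_smul, smul_mul_assoc,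
      Module.End.mul_apply, toLin_raise, mul_assoc]
    congr 2
    induction w with
    | nil => simp
    | cons p w ih =>
      simp only [List.map_cons, List.prod_cons, Module.End.mul_apply, toLin_graft, mul_assoc] at ih ⊢
      rw [ih]

theorem toLin_one : r.toLin (one K S) = 1 := by simp [one, toLin_single, r.E_zero]

theorem toLin_planted (p : Planted S) : r.toLin (planted K p) = r.P p := by
  simp [planted, toLin_single, r.E_zero]

theorem toLin_X (i : Fin S.d) : r.toLin (X K i) = r.E (MI.unit i) := by
  simp [X, toLin_single]

end Relations

end Universal

end

section

/-! ### The associative algebra 𝔗⁺ and its deshuffle bialgebra structure -/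

section AlgebraStructure

variable (K : Type*) [Field K] (S : TreeData)

/-- The space `𝔗⁺`, to be equipped with its associative product and the deshuffle coproduct. -/
def Alg : Type _ := PosTree S →₀ K

instance (priority := 10) : AddCommGroup (Alg K S) :=
  inferInstanceAs (AddCommGroup (PosTree S →₀ K))

instance (priority := 10) : Module K (Alg K S) := inferInstanceAs (Module K (PosTree S →₀ K))

/-- The relations satisfied by left multiplications in `𝔗⁺`. -/
def endRelations : Relations K S (Module.End K (TPlus K S)) where
  E m := Finsupp.lmapDomain K K (fun y : PosTree S => (y.1 + m, y.2))
  P p := Relations.graft K p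
  E_zero := by
    simp only [add_zero]
    exact Finsupp.lmapDomain_id K K
  E_add m n := by
    refine Finsupp.lhom_ext fun x c => ?_
    simp [Finsupp.mapDomain_single, add_comm m, add_assoc]
  P_E p i := by
    refine Finsupp.lhom_ext fun x c => ?_
    have h : ∀ q : Planted S, Relations.graft K q (Finsupp.single x c) =
        ∑ l ∈ Finset.Iic (x.1 ⊓ q.a), ((x.1.choose l : ℕ) : K) •
          Finsupp.single (x.1 - l, q.lower l :: x.2) c := by
      intro q
      simp [Relations.graft, Finset.smul_sum, mul_comm]
    simp only [Module.End.mul_apply, LinearMap.add_apply, h]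
    rw [Finsupp.lmapDomain_apply, Finsupp.mapDomain_single]
    have h2 : Relations.graft K p (Finsupp.single (x.1 + MI.unit i, x.2) c) =
        ∑ l ∈ Finset.Iic ((x.1 + MI.unit i) ⊓ p.a), (((x.1 + MI.unit i).choose l : ℕ) : K) •
          (Finsupp.single (x.1 + MI.unit i - l, p.lower l :: x.2) c : TPlus K S) := by
      simp [Relations.graft, Finset.smul_sum, mul_comm]
    -- The outer sum runs over l = 0 and, if a_i > 0, over l = e_i; these are the two terms of the
    -- relation.
    rw [h2, MI.sum_choose_add_inf, MI.sum_Iic_unit_inf]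
    simp only [MI.choose_zero_right, MI.choose_self, Nat.cast_one, one_smul, tsub_zero, add_zero]
    congr 1
    · rw [map_sum]
      refine Finset.sum_congr rfl fun l hl => ?_
      simp only [Finset.mem_Iic, le_inf_iff] at hl
      rw [map_smul, Finsupp.lmapDomain_apply, Finsupp.mapDomain_single]
      congr 2
      simp [tsub_add_eq_add_tsub hl.1]
    · split_ifs with ha
      · rw [h]
        refine Finset.sum_congr rfl fun l hl => ?_
        rw [Planted.lower_lower, add_tsub_add_eq_tsub_right]
      · simp

variable {K S}

/-- For B = End(𝔗⁺) the map `toLin` is `dot` itself, so its multiplicativity is associativity. -/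
theorem dot_dot (x y : TPlus K S) : dot K S (dot K S x y) = dot K S x * dot K S y :=
  (endRelations K S).toLin_dot x y

theorem dot_one_left : dot K S (one K S) = 1 := (endRelations K S).toLin_one

theorem dot_one_right (x : TPlus K S) : dot K S x (one K S) = x := by
  induction x using Finsupp.induction_linear with
  | zero => simp
  | add x y hx hy => simp only [map_add, LinearMap.add_apply, hx, hy]
  | single x c =>
    obtain ⟨m, w⟩ := x
    have h : ∀ w : List (Planted S), (w.map (Relations.graft K)).prod (one K S) =
        Finsupp.single (0, w) 1 := by
      intro w
      induction w with
      | nil => rfl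
      | cons p w ih =>
        have h0 : (0 ⊓ p.a : MI S) = 0 := inf_eq_left.2 zero_le
        have h1 : Finset.Iic (0 : MI S) = {0} := by ext; simp
        rw [List.map_cons, List.prod_cons, Module.End.mul_apply, ih, Relations.graft,
          Finsupp.linearCombination_single, h0, h1]
        simp [MI.choose_zero_right, Planted.lower_zero]
    rw [Relations.dot_single, LinearMap.smul_apply, Module.End.mul_apply, h]
    simp [Finsupp.mapDomain_single]

instance : Ring (Alg K S) where
  __ := (inferInstance : AddCommGroup (Alg K S))
  mul x y := dot K S x y
  one := one K S
  left_distrib x y z := map_add (dot K S x) y z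
  right_distrib x y z := LinearMap.congr_fun (map_add (dot K S) x y) z
  zero_mul x := LinearMap.congr_fun (map_zero (dot K S)) x
  mul_zero x := map_zero (dot K S x)
  mul_assoc x y z := LinearMap.congr_fun (dot_dot x y) z
  one_mul x := LinearMap.congr_fun dot_one_left x
  mul_one x := dot_one_right x

instance : Algebra K (Alg K S) :=
  Algebra.ofModule (fun r x y => LinearMap.congr_fun (map_smul (dot K S) r x) y)
    (fun r x y => map_smul (dot K S x) r y)

theorem one_eq_one : one K S = (1 : Alg K S) := rfl

namespace Alg

variable (K) in
/-- The basis element `X^m` of `𝔗⁺`. -/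
def powX (m : MI S) : Alg K S := Finsupp.single (m, []) 1

variable (K) in
/-- The element `X^i` of `𝔗⁺`. -/
def X (i : Fin S.d) : Alg K S := PlanarRS.X K i

variable (K) in
/-- A planted tree, as an element of `𝔗⁺`. -/
def pl (p : Planted S) : Alg K S := planted K p

variable (K) in
/-- A basis element of `𝔗⁺`. -/
def mono (x : PosTree S) : Alg K S := Finsupp.single x 1

theorem powX_mul (m : MI S) (y : Alg K S) :
    powX K m * y = Finsupp.lmapDomain K K (fun y : PosTree S => (y.1 + m, y.2)) y := by
  change dot K S (Finsupp.single (m, []) 1) y = _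
  rw [Relations.dot_single, one_smul]
  simp

theorem pl_mul (p : Planted S) (y : Alg K S) : pl K p * y = Relations.graft K p y := by
  have h : dot K S (Finsupp.single (0, [p]) 1) = Relations.graft K p := by
    rw [Relations.dot_single, one_smul, List.map_singleton, List.prod_singleton]
    exact (congrArg (· * Relations.graft K p) (endRelations K S).E_zero).trans (one_mul _)
  exact LinearMap.congr_fun h y

theorem powX_mul_mono (m : MI S) (x : PosTree S) :
    powX K m * mono K x = mono K (x.1 + m, x.2) := by
  rw [powX_mul]
  exact Finsupp.mapDomain_single

theorem pl_mul_mono (p : Planted S) (w : List (Planted S)) :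
    pl K p * mono K (0, w) = mono K (0, p :: w) := by
  have h0 : (0 ⊓ p.a : MI S) = 0 := inf_eq_left.2 zero_le
  have h1 : Finset.Iic (0 : MI S) = {0} := by ext; simp
  rw [pl_mul, mono, Relations.graft, Finsupp.linearCombination_single, h0, h1]
  simp [MI.choose_zero_right, Planted.lower_zero, mono]
  rfl

theorem powX_zero : powX K (0 : MI S) = 1 := rfl

theorem mono_zero : mono K ((0, []) : PosTree S) = 1 := rfl

theorem powX_add (m n : MI S) : powX K (m + n) = powX K m * powX K n := by
  rw [powX, add_comm]
  exact (powX_mul_mono m (n, [])).symm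

theorem powX_unit (i : Fin S.d) : powX K (MI.unit i) = X K i := rfl

theorem mono_eq (x : PosTree S) : mono K x = powX K x.1 * mono K (0, x.2) := by
  rw [powX_mul_mono, zero_add]

theorem lhom_ext {M : Type*} [AddCommMonoid M] [Module K M] {f g : Alg K S →ₗ[K] M}
    (h : ∀ x, f (mono K x) = g (mono K x)) : f = g :=
  Finsupp.lhom_ext' fun x => LinearMap.ext_ring (h x)

theorem span_mono : Submodule.span K (Set.range (mono K (S := S))) = ⊤ := by
  have := (Finsupp.basisSingleOne (R := K) (ι := PosTree S)).span_eq
  rw [Finsupp.coe_basisSingleOne] at this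
  exact this

/-- A subspace that contains `1` and is stable under left multiplication by the generators is the
whole algebra. -/
theorem eq_top_of_mul_mem (W : Submodule K (Alg K S)) (h1 : 1 ∈ W)
    (hX : ∀ i, ∀ y ∈ W, X K i * y ∈ W) (hp : ∀ p, ∀ y ∈ W, pl K p * y ∈ W) : W = ⊤ := by
  rw [eq_top_iff, ← span_mono, Submodule.span_le]
  rintro _ ⟨⟨m, w⟩, rfl⟩
  induction m using MI.induction_on with
  | h0 =>
    induction w with
    | nil => exact h1
    | cons p w ih =>
      rw [← pl_mul_mono]
      exact hp _ _ ih
  | h m i ih =>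
    rw [← powX_mul_mono (MI.unit i) (m, w)]
    exact hX i _ ih

theorem algHom_ext {B : Type*} [Semiring B] [Algebra K B] {f g : Alg K S →ₐ[K] B}
    (hX : ∀ i, f (X K i) = g (X K i)) (hp : ∀ p, f (pl K p) = g (pl K p)) : f = g := by
  have h : LinearMap.eqLocus f.toLinearMap g.toLinearMap = ⊤ := by
    refine eq_top_of_mul_mem _ (by simp) ?_ ?_
    · intro i y hy
      simp only [LinearMap.mem_eqLocus, AlgHom.toLinearMap_apply] at hy ⊢
      rw [map_mul, map_mul, hX, hy]
    · intro i y hy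
      simp only [LinearMap.mem_eqLocus, AlgHom.toLinearMap_apply] at hy ⊢
      rw [map_mul, map_mul, hp, hy]
  ext x
  have hx : x ∈ (⊤ : Submodule K (Alg K S)) := trivial
  rw [← h] at hx
  exact hx

theorem X_mul_X (i j : Fin S.d) : X K i * X K j = X K j * X K i := by
  rw [← powX_unit, ← powX_unit, ← powX_add, ← powX_add, add_comm]

theorem pl_mul_X (p : Planted S) (i : Fin S.d) : pl K p * X K i = X K i * pl K p +
    if 0 < p.a i then pl K (p.lower (MI.unit i)) else 0 := by
  have h := LinearMap.congr_fun ((endRelations K S).P_E p i) (one K S)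
  have hX : ∀ y : Alg K S, (endRelations K S).E (MI.unit i) y = X K i * y :=
    fun y => (powX_mul _ y).symm
  have hp : ∀ (q : Planted S) (y : Alg K S), (endRelations K S).P q y = pl K q * y :=
    fun q y => (pl_mul q y).symm
  rw [LinearMap.add_apply, Module.End.mul_apply, Module.End.mul_apply, one_eq_one, hp, hX, hX, hp,
    mul_one, mul_one] at h
  rw [h]
  congr 1
  split_ifs
  · rw [hp, mul_one]
  · rfl

end Alg

namespace Relations

variable {B : Type*} [Ring B] [Algebra K B] (r : Relations K S B)

/-- The algebra morphism from `𝔗⁺` given by elements satisfying the relations. -/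
def toHom : Alg K S →ₐ[K] B := AlgHom.ofLinearMap r.toLin r.toLin_one r.toLin_dot

theorem toHom_X (i : Fin S.d) : r.toHom (Alg.X K i) = r.E (MI.unit i) := r.toLin_X i

theorem toHom_pl (p : Planted S) : r.toHom (Alg.pl K p) = r.P p := r.toLin_planted p

theorem toHom_powX (m : MI S) : r.toHom (Alg.powX K m) = r.E m := by
  change r.toLin (Finsupp.single (m, []) 1) = _
  simp [toLin_single]

theorem toHom_mono (x : PosTree S) : r.toHom (Alg.mono K x) = r.E x.1 * (x.2.map r.P).prod := by
  change r.toLin (Finsupp.single x 1) = _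
  simp [toLin_single]

end Relations

variable (K S) in
/-- The relations satisfied by the coproducts of the generators. -/
def comulRelations : Relations K S (Alg K S ⊗[K] Alg K S) where
  E m := ∑ l ∈ Finset.Iic m, ((m.choose l : ℕ) : K) • Alg.powX K l ⊗ₜ[K] Alg.powX K (m - l)
  P p := Alg.pl K p ⊗ₜ[K] 1 + 1 ⊗ₜ[K] Alg.pl K p
  E_zero := by
    have h1 : Finset.Iic (0 : MI S) = {0} := by ext; simp
    rw [h1]
    simp [MI.choose_zero_right, Alg.powX_zero, Algebra.TensorProduct.one_def]
  E_add m n := by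
    rw [MI.sum_choose_add, Finset.sum_mul_sum, Finset.sum_comm]
    refine Finset.sum_congr rfl fun l hl => ?_
    rw [Finset.smul_sum]
    refine Finset.sum_congr rfl fun k hk => ?_
    rw [Finset.mem_Iic] at hl hk
    rw [smul_mul_smul_comm, Algebra.TensorProduct.tmul_mul_tmul, ← Alg.powX_add, ← Alg.powX_add,
      smul_smul, mul_comm, tsub_add_tsub_comm hk hl]
  P_E p i := by
    rw [MI.sum_Iic_unit]
    simp only [MI.choose_zero_right, MI.choose_self, Nat.cast_one, one_smul, tsub_zero, tsub_self,
      Alg.powX_zero, Alg.powX_unit, mul_add, add_mul, Algebra.TensorProduct.tmul_mul_tmul, one_mul,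
      mul_one, Alg.pl_mul_X, TensorProduct.add_tmul, TensorProduct.tmul_add]
    split_ifs <;> (try simp only [TensorProduct.zero_tmul, TensorProduct.tmul_zero, add_zero]) <;>
      abel

/-- Expanding the product of the elements p ⊗ 1 + 1 ⊗ p, every letter chooses one of the two
factors; the choices are the unshuffles. -/
theorem unshuffle_sum (w : List (Planted S)) :
    (w.map (comulRelations K S).P).prod =
      ((unshuffles w).map fun q => Alg.mono K (0, q.1) ⊗ₜ[K] Alg.mono K (0, q.2)).sum := by
  induction w with
  | nil => simp [unshuffles, Alg.mono_zero, Algebra.TensorProduct.one_def]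
  | cons p w ih =>
    rw [List.map_cons, List.prod_cons, ih, unshuffles, List.map_append, List.sum_append,
      List.map_map, List.map_map, comulRelations, add_mul]
    simp only [← List.sum_map_mul_left, Algebra.TensorProduct.tmul_mul_tmul, Alg.pl_mul_mono,
      one_mul]
    rfl

theorem comulRelations_toLin_mono (x : PosTree S) :
    (comulRelations K S).toHom (Alg.mono K x) =
      ∑ l ∈ Finset.Iic x.1, ((x.1.choose l : ℕ) : K) •
      ((unshuffles x.2).map fun q => Alg.mono K (l, q.1) ⊗ₜ[K] Alg.mono K (x.1 - l, q.2)).sum := by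
  rw [Relations.toHom_mono, unshuffle_sum, comulRelations, Finset.sum_mul]
  refine Finset.sum_congr rfl fun l _ => ?_
  rw [smul_mul_assoc, ← List.sum_map_mul_left]
  simp only [Algebra.TensorProduct.tmul_mul_tmul, Alg.powX_mul_mono, zero_add]

theorem comulRelations_toHom : (comulRelations K S).toHom.toLinearMap = deshuffle K S := by
  refine Alg.lhom_ext fun x => ?_
  rw [AlgHom.toLinearMap_apply, comulRelations_toLin_mono]
  have : deshuffle K S (Finsupp.single x 1) = _ := Finsupp.linearCombination_single _ _ _
  rw [one_smul] at this
  exact this.symm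

variable (K S) in
/-- The relations satisfied by the counits of the generators. -/
def counitRelations : Relations K S K where
  E m := if m = 0 then 1 else 0
  P _ := 0
  E_zero := by simp
  E_add m n := by
    have : m + n = 0 ↔ m = 0 ∧ n = 0 := by
      constructor
      · intro h
        have h' : m.size + n.size = 0 := by rw [← MI.size_add, h, MI.size_zero]
        rw [← MI.size_eq_zero, ← MI.size_eq_zero]
        omega
      · rintro ⟨rfl, rfl⟩; simp
    by_cases hm : m = 0 <;> by_cases hn : n = 0 <;> simp [this, hm, hn]
  P_E p i := by simp

theorem counitRelations_toHom : (counitRelations K S).toHom.toLinearMap = eps K S := by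
  classical
  refine Alg.lhom_ext fun x => ?_
  rw [AlgHom.toLinearMap_apply, Relations.toHom_mono]
  change _ = (Finsupp.single x 1 : PosTree S →₀ K) (0, [])
  rw [Finsupp.single_apply]
  obtain ⟨m, w⟩ := x
  cases w <;> simp [counitRelations]

/-- Each coalgebra axiom is an equality of algebra morphisms, so it only has to be checked on the
X^i and on planted trees. -/
instance : Bialgebra K (Alg K S) :=
  Bialgebra.ofAlgHom (comulRelations K S).toHom (counitRelations K S).toHom
    (by
      refine Alg.algHom_ext ?_ ?_ <;>
      · intro i
        simp [Relations.toHom_X, Relations.toHom_pl, comulRelations, MI.sum_Iic_unit,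
          MI.choose_zero_right, MI.choose_self, Alg.powX_zero, Alg.powX_unit,
          TensorProduct.add_tmul, TensorProduct.tmul_add, Algebra.TensorProduct.one_def]
        abel)
    (by
      refine Alg.algHom_ext ?_ ?_ <;>
      · intro i
        simp [Relations.toHom_X, Relations.toHom_pl, comulRelations, MI.sum_Iic_unit,
          MI.choose_zero_right, MI.choose_self, Alg.powX_zero, Alg.powX_unit, counitRelations,
          MI.unit_ne_zero])
    (by
      refine Alg.algHom_ext ?_ ?_ <;>
      · intro i
        simp [Relations.toHom_X, Relations.toHom_pl, comulRelations, MI.sum_Iic_unit,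
          MI.choose_zero_right, MI.choose_self, Alg.powX_zero, Alg.powX_unit, counitRelations,
          MI.unit_ne_zero])

namespace Alg

open Coalgebra

theorem comul_eq : (comul : Alg K S →ₗ[K] _) = deshuffle K S := comulRelations_toHom

theorem counit_eq : (counit : Alg K S →ₗ[K] K) = eps K S := counitRelations_toHom

theorem comul_X (i : Fin S.d) :
    comul (R := K) (X K i) = X K i ⊗ₜ[K] (1 : Alg K S) + 1 ⊗ₜ[K] X K i := by
  refine ((comulRelations K S).toHom_X i).trans ?_
  simp [comulRelations, MI.sum_Iic_unit, MI.choose_zero_right, MI.choose_self, Alg.powX_zero,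
    Alg.powX_unit, add_comm]

theorem comul_pl (p : Planted S) :
    comul (R := K) (pl K p) = pl K p ⊗ₜ[K] (1 : Alg K S) + 1 ⊗ₜ[K] pl K p :=
  (comulRelations K S).toHom_pl p

theorem comul_mono (x : PosTree S) : comul (R := K) (mono K x) =
    ∑ l ∈ Finset.Iic x.1, ((x.1.choose l : ℕ) : K) •
      ((unshuffles x.2).map fun q => mono K (l, q.1) ⊗ₜ[K] mono K (x.1 - l, q.2)).sum :=
  comulRelations_toLin_mono x

theorem counit_X (i : Fin S.d) : counit (R := K) (X K i) = 0 :=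
  ((counitRelations K S).toHom_X i).trans (by simp [counitRelations, MI.unit_ne_zero])

theorem counit_pl (p : Planted S) : counit (R := K) (pl K p) = 0 :=
  (counitRelations K S).toHom_pl p

instance : IsCocomm K (Alg K S) where
  comm_comp_comul := by
    have h : ((Algebra.TensorProduct.comm K (Alg K S) (Alg K S)).toAlgHom.comp
        (Bialgebra.comulAlgHom K (Alg K S))) = Bialgebra.comulAlgHom K (Alg K S) := by
      refine algHom_ext ?_ ?_ <;> intro i
      · simp [comul_X, add_comm]
      · simp [comul_pl, add_comm]
    exact congrArg AlgHom.toLinearMap h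

end Alg

end AlgebraStructure

end

section

/-! ### The Lie algebra V and its primitivity -/

section LieSubspace

variable {K : Type*} [Field K] {S : TreeData}

/-- The inner derivation of an algebra given by an element. -/
def innerDer {A : Type*} [Ring A] [Algebra K A] (a : A) : A →ₗ[K] A :=
  LinearMap.mulLeft K a - LinearMap.mulRight K a

theorem innerDer_apply {A : Type*} [Ring A] [Algebra K A] (a x : A) :
    innerDer (K := K) a x = a * x - x * a := by
  simp [innerDer]

namespace Alg

open Coalgebra

variable (K S) in
/-- The Lie polynomials in planted trees. -/
def lieP : Submodule K (Alg K S) := Vtilde K S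

variable (K S) in
/-- The Lie polynomials in planted trees, together with the `X^i`. -/
def lieV : Submodule K (Alg K S) := V K S

theorem pl_mem_lieP (p : Planted S) : pl K p ∈ lieP K S := by
  have h : planted K p ∈ Vtilde K S := Submodule.mem_sInf.2 fun _ hW => hW.1 p
  exact h

theorem commutator_mem_lieP {x y : Alg K S} (hx : x ∈ lieP K S) (hy : y ∈ lieP K S) :
    x * y - y * x ∈ lieP K S := by
  have h : ∀ x ∈ Vtilde K S, ∀ y ∈ Vtilde K S, bracket x y ∈ Vtilde K S := fun x hx y hy =>
    Submodule.mem_sInf.2 fun W hW => hW.2 x (Submodule.mem_sInf.1 hx W hW) y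
      (Submodule.mem_sInf.1 hy W hW)
  exact h x hx y hy

theorem lieP_le {W : Submodule K (Alg K S)} (hp : ∀ p, pl K p ∈ W)
    (hb : ∀ x ∈ W, ∀ y ∈ W, x * y - y * x ∈ W) : lieP K S ≤ W :=
  sInf_le ⟨hp, hb⟩

theorem lieV_eq : lieV K S = lieP K S ⊔ Submodule.span K (Set.range (X K)) := rfl

theorem lieP_le_lieV : lieP K S ≤ lieV K S := le_sup_left

theorem X_mem_lieV (i : Fin S.d) : X K i ∈ lieV K S :=
  (le_sup_right : _ ≤ lieV K S) (Submodule.subset_span ⟨i, rfl⟩)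

theorem pl_mem_lieV (p : Planted S) : pl K p ∈ lieV K S := lieP_le_lieV (pl_mem_lieP p)

theorem lieV_le {W : Submodule K (Alg K S)} (h : lieP K S ≤ W) (hX : ∀ i, X K i ∈ W) :
    lieV K S ≤ W := by
  rw [lieV_eq]
  refine sup_le h (Submodule.span_le.2 ?_)
  rintro _ ⟨i, rfl⟩
  exact hX i

theorem commutator_X_mem_lieP {y : Alg K S} (hy : y ∈ lieP K S) (i : Fin S.d) :
    X K i * y - y * X K i ∈ lieP K S := by
  -- Intersecting with `lieP` keeps the two entries of a bracket available in the inductive step,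
  -- where [X^i, ·] acts as a derivation of the bracket.
  have h : lieP K S ≤ lieP K S ⊓ (lieP K S).comap (innerDer (X K i)) := by
    refine lieP_le ?_ ?_
    · intro p
      rw [Submodule.mem_inf, Submodule.mem_comap, innerDer_apply, pl_mul_X, sub_add_cancel_left]
      refine ⟨pl_mem_lieP p, neg_mem ?_⟩
      split_ifs
      · exact pl_mem_lieP _
      · exact zero_mem _
    · intro x hx y hy
      rw [Submodule.mem_inf, Submodule.mem_comap, innerDer_apply] at hx hy ⊢
      refine ⟨commutator_mem_lieP hx.1 hy.1, ?_⟩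
      have := add_mem (commutator_mem_lieP hx.1 hy.2) (commutator_mem_lieP hx.2 hy.1)
      convert this using 1
      noncomm_ring
  have := (h hy).2
  rwa [SetLike.mem_coe, Submodule.mem_comap, innerDer_apply] at this

theorem commutator_mem_lieV {x y : Alg K S} (hx : x ∈ lieV K S) (hy : y ∈ lieV K S) :
    x * y - y * x ∈ lieV K S := by
  have h1 : ∀ x ∈ lieP K S, ∀ y ∈ lieV K S, x * y - y * x ∈ lieV K S := by
    intro x hx
    have : lieV K S ≤ (lieV K S).comap (innerDer x) := by
      refine lieV_le ?_ ?_
      · intro y hy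
        rw [Submodule.mem_comap, innerDer_apply]
        exact lieP_le_lieV (commutator_mem_lieP hx hy)
      · intro i
        rw [Submodule.mem_comap, innerDer_apply, ← neg_sub]
        exact neg_mem (lieP_le_lieV (commutator_X_mem_lieP hx i))
    intro y hy
    rw [← innerDer_apply (K := K)]
    exact this hy
  have h2 : lieV K S ≤ (lieV K S).comap (innerDer y) := by
    refine lieV_le ?_ ?_
    · intro x hx
      rw [Submodule.mem_comap, innerDer_apply, ← neg_sub]
      exact neg_mem (h1 x hx y hy)
    · intro i
      rw [Submodule.mem_comap, innerDer_apply, ← neg_sub]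
      refine neg_mem ?_
      have h3 : lieV K S ≤ (lieV K S).comap (innerDer (X K i)) := by
        refine lieV_le ?_ ?_
        · intro y hy
          rw [Submodule.mem_comap, innerDer_apply]
          exact lieP_le_lieV (commutator_X_mem_lieP hy i)
        · intro j
          rw [Submodule.mem_comap, innerDer_apply, X_mul_X, sub_self]
          exact zero_mem _
      rw [← innerDer_apply (K := K)]
      exact h3 hy
  rw [← neg_sub, ← innerDer_apply (K := K)]
  exact neg_mem (h2 hx)

variable (K S) in
/-- The primitive elements. -/
def primitive : Submodule K (Alg K S) :=
  LinearMap.eqLocus (comul : Alg K S →ₗ[K] _)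
    ((TensorProduct.mk K (Alg K S) (Alg K S)).flip 1 + TensorProduct.mk K (Alg K S) (Alg K S) 1)

theorem mem_primitive {x : Alg K S} :
    x ∈ primitive K S ↔ comul (R := K) x = x ⊗ₜ[K] (1 : Alg K S) + 1 ⊗ₜ[K] x := Iff.rfl

theorem comul_of_mem_lieV {x : Alg K S} (hx : x ∈ lieV K S) :
    comul (R := K) x = x ⊗ₜ[K] (1 : Alg K S) + 1 ⊗ₜ[K] x := by
  have h : lieV K S ≤ primitive K S := by
    refine lieV_le (lieP_le comul_pl ?_) comul_X
    intro x hx y hy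
    rw [mem_primitive] at *
    rw [map_sub, Bialgebra.comul_mul, Bialgebra.comul_mul, hx, hy]
    simp only [add_mul, mul_add, Algebra.TensorProduct.tmul_mul_tmul, one_mul, mul_one,
      TensorProduct.sub_tmul, TensorProduct.tmul_sub]
    abel
  exact h hx

theorem counit_of_mem_lieV {x : Alg K S} (hx : x ∈ lieV K S) : counit (R := K) x = 0 := by
  have h : lieV K S ≤ LinearMap.ker (counit : Alg K S →ₗ[K] K) := by
    refine lieV_le (lieP_le counit_pl ?_) counit_X
    intro x hx y hy
    rw [LinearMap.mem_ker] at *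
    rw [map_sub, Bialgebra.counit_mul, Bialgebra.counit_mul, hx]
    simp
  exact h hx

end Alg

/-! ### 𝔗⁺ as the universal enveloping algebra of V -/

section Enveloping

attribute [local instance] LieRing.ofAssociativeRing LieAlgebra.ofAssociativeAlgebra

variable (K S) in
/-- The Lie algebra `V`. -/
def lieSubalgebraV : LieSubalgebra K (Alg K S) where
  __ := Alg.lieV K S
  lie_mem' hx hy := Alg.commutator_mem_lieV hx hy

variable (K) in
/-- The element `X^i` of `V`, in the enveloping algebra of `V`. -/
def envX (i : Fin S.d) : UniversalEnvelopingAlgebra K (lieSubalgebraV K S) :=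
  UniversalEnvelopingAlgebra.ι K (⟨Alg.X K i, Alg.X_mem_lieV i⟩ : lieSubalgebraV K S)

variable (K) in
/-- A planted tree, in the enveloping algebra of `V`. -/
def envP (p : Planted S) : UniversalEnvelopingAlgebra K (lieSubalgebraV K S) :=
  UniversalEnvelopingAlgebra.ι K (⟨Alg.pl K p, Alg.pl_mem_lieV p⟩ : lieSubalgebraV K S)

theorem env_eq_zero {x : lieSubalgebraV K S} (hx : x = 0) :
    UniversalEnvelopingAlgebra.ι K x = 0 := by
  rw [hx]
  exact LinearMap.map_zero
    (UniversalEnvelopingAlgebra.ι K : lieSubalgebraV K S →ₗ⁅K⁆ _).toLinearMap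

theorem commute_envX (i j : Fin S.d) : Commute (envX K i) (envX K j) := by
  rw [Commute, SemiconjBy, ← sub_eq_zero]
  change ⁅envX K i, envX K j⁆ = 0
  rw [envX, envX, ← LieHom.map_lie]
  exact env_eq_zero (Subtype.ext (sub_eq_zero.2 (Alg.X_mul_X i j)))

theorem envP_mul_envX (p : Planted S) (i : Fin S.d) : envP K p * envX K i =
    envX K i * envP K p + if 0 < p.a i then envP K (p.lower (MI.unit i)) else 0 := by
  rw [← sub_eq_iff_eq_add']
  change ⁅envP K p, envX K i⁆ = _
  rw [envX, envP, ← LieHom.map_lie]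
  have h : Alg.pl K p * Alg.X K i - Alg.X K i * Alg.pl K p = _ :=
    sub_eq_iff_eq_add'.2 (Alg.pl_mul_X p i)
  split_ifs at h ⊢
  · rw [envP]
    congr 1
    exact Subtype.ext h
  · exact env_eq_zero (Subtype.ext h)

/-- Multi-index powers of commuting elements. -/
theorem exists_multiIndexPow {B : Type*} [Monoid B] (x : Fin S.d → B)
    (hx : ∀ i j, Commute (x i) (x j)) : ∃ E : MI S → B, E 0 = 1 ∧
      (∀ m n, E (m + n) = E m * E n) ∧ ∀ i, E (MI.unit i) = x i := by
  let φ := MonoidHom.noncommPiCoprod (fun i => powersHom B (x i))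
    (fun i j _ a b => by
      simp only [powersHom_apply]
      exact (hx i j).pow_pow _ _)
  refine ⟨fun m => φ fun i => Multiplicative.ofAdd (m i), map_one φ, fun m n => map_mul φ _ _,
    fun i => ?_⟩
  have : (fun j => Multiplicative.ofAdd ((MI.unit i : MI S) j)) =
      Pi.mulSingle i (Multiplicative.ofAdd 1) := by
    ext j
    by_cases h : j = i
    · subst h; simp [MI.unit]
    · simp [MI.unit, h]
  simp only [this]
  exact (MonoidHom.noncommPiCoprod_mulSingle _ i _).trans (pow_one _)

theorem exists_envRelations :
    ∃ r : Relations K S (UniversalEnvelopingAlgebra K (lieSubalgebraV K S)),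
      (∀ i, r.E (MI.unit i) = envX K i) ∧ r.P = envP K := by
  obtain ⟨E, h0, ha, hu⟩ := exists_multiIndexPow (envX K (S := S)) commute_envX
  exact ⟨⟨E, envP K, h0, ha, fun p i => by rw [hu, envP_mul_envX]⟩, hu, rfl⟩

/-- The images of the X^i and of planted trees in U(V) satisfy the defining relations of 𝔗⁺, which
gives a map `G` back to U(V). One composite is the identity on generators of 𝔗⁺. The other requires
`G` to agree with ι on all of V, not only on generators. -/
theorem isEnvelopingAlgebra : IsEnvelopingAlgebra (dot K S) (one K S) (V K S) := by
  refine ⟨Alg K S, inferInstance, inferInstance, LinearEquiv.refl K (TPlus K S), fun x y => rfl,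
    rfl, lieSubalgebraV K S, ?_, ?_⟩
  · exact (Submodule.map_id (V K S)).symm
  · set F := UniversalEnvelopingAlgebra.lift K (lieSubalgebraV K S).incl with hF
    obtain ⟨r, hrX, hrP⟩ := exists_envRelations (K := K) (S := S)
    have hF : ∀ y : lieSubalgebraV K S, F (UniversalEnvelopingAlgebra.ι K y) = y := fun y =>
      UniversalEnvelopingAlgebra.lift_ι_apply K _ _
    set G := r.toHom with hG
    have hGX : ∀ i, G (Alg.X K i) = envX K i := fun i => (r.toHom_X i).trans (hrX i)
    have hGP : ∀ p, G (Alg.pl K p) = envP K p := fun p => (r.toHom_pl p).trans (by rw [hrP])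
    have h1 : F.comp G = AlgHom.id K _ := by
      refine Alg.algHom_ext ?_ ?_ <;> intro i <;>
        simp only [AlgHom.comp_apply, hGX, hGP, envX, envP, hF, AlgHom.id_apply]
    have h2 : G.comp F = AlgHom.id K _ := by
      -- The v ∈ V with G v = ι v form a subspace containing the generators and closed under
      -- brackets. It is pushed forward to 𝔗⁺ because Lie polynomials are characterised there by
      -- minimality among subspaces.
      have h : Alg.lieV K S ≤ (LinearMap.eqLocus (G.toLinearMap ∘ₗ (Alg.lieV K S).subtype)
          (UniversalEnvelopingAlgebra.ι K : lieSubalgebraV K S →ₗ⁅K⁆ _).toLinearMap).map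
            (Alg.lieV K S).subtype := by
        refine Alg.lieV_le (Alg.lieP_le ?_ ?_) ?_
        · exact fun p => ⟨⟨_, Alg.pl_mem_lieV p⟩, hGP p, rfl⟩
        · rintro _ ⟨⟨x, hx⟩, hx', rfl⟩ _ ⟨⟨y, hy⟩, hy', rfl⟩
          refine ⟨⟨_, Alg.commutator_mem_lieV hx hy⟩, ?_, rfl⟩
          replace hx' : G x = UniversalEnvelopingAlgebra.ι K (⟨x, hx⟩ : lieSubalgebraV K S) := hx'
          replace hy' : G y = UniversalEnvelopingAlgebra.ι K (⟨y, hy⟩ : lieSubalgebraV K S) := hy'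
          change G (x * y - y * x) = UniversalEnvelopingAlgebra.ι K
            ⁅(⟨x, hx⟩ : lieSubalgebraV K S), ⟨y, hy⟩⁆
          rw [map_sub, map_mul, map_mul, hx', hy', LieHom.map_lie]
          rfl
        · exact fun i => ⟨⟨_, Alg.X_mem_lieV i⟩, hGX i, rfl⟩
      refine UniversalEnvelopingAlgebra.hom_ext K (LieHom.ext fun x => ?_)
      change G (F (UniversalEnvelopingAlgebra.ι K _)) = UniversalEnvelopingAlgebra.ι K _
      rw [hF]
      obtain ⟨y, hy, hyx⟩ := h x.2
      obtain rfl : y = x := Subtype.ext hyx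
      exact hy
    exact Function.bijective_iff_has_inverse.2 ⟨G, AlgHom.congr_fun h2, AlgHom.congr_fun h1⟩

end Enveloping

end LieSubspace

end

section

/-! ### Convolution of linear maps along a coproduct -/

section Convolution

open Coalgebra

variable {K : Type*} [Field K] {C : Type*} [AddCommMonoid C] [Module K C] [Coalgebra K C]
variable {M N Q : Type*} [AddCommMonoid M] [Module K M] [AddCommMonoid N] [Module K N]
  [AddCommMonoid Q] [Module K Q]
variable {B : Type*} [Semiring B] [Algebra K B]

/-- The convolution `x ↦ β (f x₍₁₎) (g x₍₂₎)` for a bilinear map `β`. -/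
def bconv (β : M →ₗ[K] N →ₗ[K] Q) (f : C →ₗ[K] M) (g : C →ₗ[K] N) : C →ₗ[K] Q :=
  TensorProduct.lift (β.compl₁₂ f g) ∘ₗ comul

theorem bconv_apply (β : M →ₗ[K] N →ₗ[K] Q) (f : C →ₗ[K] M) (g : C →ₗ[K] N) {ι : Type*} {x : C}
    (r : Repr K x ι) : bconv β f g x = ∑ i ∈ r.index, β (f (r.left i)) (g (r.right i)) := by
  rw [bconv, LinearMap.comp_apply, ← r.eq, map_sum]
  rfl

theorem bconv_of_comul (β : M →ₗ[K] N →ₗ[K] Q) (f : C →ₗ[K] M) (g : C →ₗ[K] N) {x e : C}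
    (hx : comul (R := K) x = x ⊗ₜ[K] e + e ⊗ₜ[K] x) :
    bconv β f g x = β (f x) (g e) + β (f e) (g x) := by
  rw [bconv, LinearMap.comp_apply, hx, map_add]
  rfl

/-- The convolution of maps to an algebra. -/
abbrev cv (f g : C →ₗ[K] B) : C →ₗ[K] B := bconv (LinearMap.mul K B) f g

theorem cv_eq (f g : C →ₗ[K] B) : cv f g = (WithConv.toConv f * WithConv.toConv g).ofConv := by
  ext x
  rw [cv, bconv_apply _ _ _ (ℛ K x)]
  exact ((ℛ K x).convMul_apply (WithConv.toConv f) (WithConv.toConv g)).symm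

theorem cv_assoc (f g h : C →ₗ[K] B) : cv (cv f g) h = cv f (cv g h) := by
  simp only [cv_eq, WithConv.toConv_ofConv, mul_assoc]

theorem sum_counit_smul {x : C} {ι : Type*} (r : Repr K x ι) :
    ∑ i ∈ r.index, counit (R := K) (r.left i) • r.right i = x := by
  have h := congrArg (TensorProduct.lid K C) (rTensor_counit_comul (R := K) x)
  rw [← r.eq] at h
  simp only [map_sum, LinearMap.rTensor_tmul, TensorProduct.lid_tmul, one_smul] at h
  exact h

theorem sum_smul_counit {x : C} {ι : Type*} (r : Repr K x ι) :
    ∑ i ∈ r.index, counit (R := K) (r.right i) • r.left i = x := by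
  have h := congrArg (TensorProduct.rid K C) (lTensor_counit_comul (R := K) x)
  rw [← r.eq] at h
  simp only [map_sum, LinearMap.lTensor_tmul, TensorProduct.rid_tmul, one_smul] at h
  exact h

theorem bconv_counit_left (β : M →ₗ[K] N →ₗ[K] Q) (m : M) (g : C →ₗ[K] N) :
    bconv β (counit.smulRight m) g = β m ∘ₗ g := by
  ext x
  rw [bconv_apply _ _ _ (ℛ K x)]
  conv_rhs => rw [LinearMap.comp_apply, ← sum_counit_smul (ℛ K x), map_sum, map_sum]
  simp

theorem bconv_counit_right (β : M →ₗ[K] N →ₗ[K] Q) (n : N) (f : C →ₗ[K] M) :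
    bconv β f (counit.smulRight n) = β.flip n ∘ₗ f := by
  ext x
  rw [bconv_apply _ _ _ (ℛ K x)]
  conv_rhs => rw [LinearMap.comp_apply, ← sum_smul_counit (ℛ K x), map_sum, map_sum]
  simp

theorem algHom_comp_cv {B' : Type*} [Semiring B'] [Algebra K B'] (h : B →ₐ[K] B')
    (f g : C →ₗ[K] B) :
    h.toLinearMap ∘ₗ cv f g = cv (h.toLinearMap ∘ₗ f) (h.toLinearMap ∘ₗ g) := by
  ext x
  rw [LinearMap.comp_apply, bconv_apply _ _ _ (ℛ K x), bconv_apply _ _ _ (ℛ K x), map_sum]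
  simp

theorem cv_comm [IsCocomm K C] {f g : C →ₗ[K] B} (h : ∀ x y, Commute (f x) (g y)) :
    cv f g = cv g f := by
  ext x
  have h1 : cv f g x = TensorProduct.lift ((LinearMap.mul K B).compl₁₂ f g)
      (TensorProduct.comm K C C (comul x)) := by
    rw [comm_comul]; rfl
  rw [h1, bconv_apply _ _ _ (ℛ K x), ← (ℛ K x).eq, map_sum, map_sum]
  exact Finset.sum_congr rfl fun i _ => h _ _

end Convolution

/-! ### The space 𝔗 as a module over the associative algebra 𝔗⁺ -/

section TreeModule

variable (K : Type*) [Field K] {S : TreeData}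

/-- A basis element of `𝔗`. -/
def tr {b : Bool} (t : PTree S b) : T K S := Finsupp.single ⟨b, t⟩ 1

/-- Joining two trees by a kernel edge. -/
def kerT (i : Fin S.numKernels) (a : MI S) : T K S →ₗ[K] T K S →ₗ[K] T K S :=
  Finsupp.linearCombination K fun τ : Tree S =>
    Finsupp.lmapDomain K K fun σ : Tree S => ⟨σ.1, PTree.kernel i a τ.2 σ.2⟩

/-- Adding a noise edge on the left, where this is allowed. -/
def noiseTree (j : Fin S.numNoises) (a m : MI S) : Tree S → T K S
  | ⟨false, σ⟩ => tr K (PTree.noise j a m σ)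
  | ⟨true, _⟩ => 0

/-- Adding a noise edge on the left. -/
def noiseT (j : Fin S.numNoises) (a m : MI S) : T K S →ₗ[K] T K S :=
  Finsupp.linearCombination K (noiseTree K j a m)

/-- Changing the decoration of the root. -/
def mapRootT (f : MI S → MI S) : Module.End K (T K S) :=
  Finsupp.lmapDomain K K fun t : Tree S => ⟨t.1, t.2.mapRoot f⟩

variable {K}

theorem tr_eq (t : Tree S) : (Finsupp.single t 1 : T K S) = tr K t.2 := rfl

theorem T_ext {M : Type*} [AddCommMonoid M] [Module K M] {f g : T K S →ₗ[K] M}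
    (h : ∀ (b : Bool) (t : PTree S b), f (tr K t) = g (tr K t)) : f = g :=
  Finsupp.lhom_ext' fun t => LinearMap.ext_ring (h t.1 t.2)

theorem kerT_tr (i : Fin S.numKernels) (a : MI S) {b c : Bool} (τ : PTree S b) (σ : PTree S c) :
    kerT K i a (tr K τ) (tr K σ) = tr K (PTree.kernel i a τ σ) := by
  simp [kerT, tr, Finsupp.mapDomain_single]

theorem noiseT_tr (j : Fin S.numNoises) (a m : MI S) (σ : PTree S false) :
    noiseT K j a m (tr K σ) = tr K (PTree.noise j a m σ) := by
  simp [noiseT, tr, noiseTree]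

theorem noiseT_tr_true (j : Fin S.numNoises) (a m : MI S) (σ : PTree S true) :
    noiseT K j a m (tr K σ) = 0 := by
  simp [noiseT, tr, noiseTree]

theorem mapRootT_tr (f : MI S → MI S) {b : Bool} (t : PTree S b) :
    mapRootT K f (tr K t) = tr K (t.mapRoot f) := by
  simp [mapRootT, tr, Finsupp.mapDomain_single]

theorem mapRootT_kerT (f : MI S → MI S) (i : Fin S.numKernels) (a : MI S) (s t : T K S) :
    mapRootT K f (kerT K i a s t) = kerT K i a s (mapRootT K f t) := by
  have h : (kerT K i a).compr₂ (mapRootT K f) = (kerT K i a).compl₂ (mapRootT K f) := by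
    refine T_ext fun b τ => T_ext fun c σ => ?_
    simp only [LinearMap.compr₂_apply, LinearMap.compl₂_apply, kerT_tr, mapRootT_tr, PTree.mapRoot]
  exact LinearMap.congr_fun (LinearMap.congr_fun h s) t

theorem mapRootT_noiseT (f : MI S → MI S) (j : Fin S.numNoises) (a m : MI S) (t : T K S) :
    mapRootT K f (noiseT K j a m t) = noiseT K j a m (mapRootT K f t) := by
  have h : mapRootT K f ∘ₗ noiseT K j a m = noiseT K j a m ∘ₗ mapRootT K f := by
    refine T_ext fun b σ => ?_
    cases b
    · simp only [LinearMap.comp_apply, noiseT_tr, mapRootT_tr, PTree.mapRoot]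
    · simp only [LinearMap.comp_apply, noiseT_tr_true, mapRootT_tr, map_zero]
  exact LinearMap.congr_fun h t

namespace PTree

theorem rootDec_mapRoot (f : MI S → MI S) {b : Bool} (t : PTree S b) :
    (t.mapRoot f).rootDec = f t.rootDec := by
  induction t with
  | vertex m => rfl
  | kernel i a τ σ _ ih => exact ih
  | noise j a m σ ih => exact ih

theorem mapRoot_mapRoot (f g : MI S → MI S) {b : Bool} (t : PTree S b) :
    (t.mapRoot f).mapRoot g = t.mapRoot (fun n => g (f n)) := by
  induction t with
  | vertex m => rfl
  | kernel i a τ σ _ ih => rw [mapRoot, mapRoot, mapRoot, ih]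
  | noise j a m σ ih => rw [mapRoot, mapRoot, mapRoot, ih]

theorem mapRoot_congr {f g : MI S → MI S} {b : Bool} (t : PTree S b)
    (h : f t.rootDec = g t.rootDec) : t.mapRoot f = t.mapRoot g := by
  induction t with
  | vertex m => rw [mapRoot, mapRoot]; exact congrArg _ h
  | kernel i a τ σ _ ih => rw [mapRoot, mapRoot, ih h]
  | noise j a m σ ih => rw [mapRoot, mapRoot, ih h]

theorem mapRoot_id {b : Bool} (t : PTree S b) : t.mapRoot (fun n => n) = t := by
  induction t with
  | vertex m => rfl
  | kernel i a τ σ _ ih => rw [mapRoot, ih]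
  | noise j a m σ ih => rw [mapRoot, ih]

end PTree

theorem linT_tr (R : ∀ b : Bool, PTree S b → (PTree S b →₀ K)) {b : Bool} (t : PTree S b) :
    linT K R (tr K t) = Finsupp.mapDomain (Sigma.mk b) (R b t) := by
  simp [linT, tr]

theorem linT_rootRaise (m : MI S) : linT K (PTree.rootRaise K m) = mapRootT K (fun n => n + m) := by
  refine T_ext fun b t => ?_
  rw [linT_tr, mapRootT_tr, PTree.rootRaise, Finsupp.mapDomain_single]
  rfl

theorem linT_rootGraft_tr (i : Fin S.numKernels) (a : MI S) {c : Bool} (τ : PTree S c) {b : Bool}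
    (σ : PTree S b) : linT K (PTree.rootGraft K i a τ) (tr K σ) =
      ∑ l ∈ Finset.Iic (σ.rootDec ⊓ a), ((σ.rootDec.choose l : ℕ) : K) •
        kerT K i (a - l) (tr K τ) (mapRootT K (fun n => n - l) (tr K σ)) := by
  rw [linT_tr, PTree.rootGraft, Finsupp.mapDomain_finsetSum]
  refine Finset.sum_congr rfl fun l _ => ?_
  rw [Finsupp.mapDomain_single, mapRootT_tr, kerT_tr, tr, Finsupp.smul_single_one]

variable (K S) in
/-- The relations satisfied by left multiplications on `𝔗`. -/
def moduleRelations : Relations K S (Module.End K (T K S)) where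
  E m := linT K (PTree.rootRaise K m)
  P p := linT K (PTree.rootGraft K p.i p.a p.τ.2)
  E_zero := by
    refine T_ext fun b t => ?_
    rw [linT_rootRaise, mapRootT_tr]
    simp only [add_zero]
    rw [PTree.mapRoot_id]
    rfl
  E_add m n := by
    refine T_ext fun b t => ?_
    rw [Module.End.mul_apply, linT_rootRaise, linT_rootRaise, linT_rootRaise, mapRootT_tr,
      mapRootT_tr, mapRootT_tr, PTree.mapRoot_mapRoot]
    simp only [add_assoc, add_comm m]
  P_E p i := by
    refine T_ext fun b t => ?_
    rw [Module.End.mul_apply, LinearMap.add_apply, Module.End.mul_apply, linT_rootRaise,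
      mapRootT_tr, linT_rootGraft_tr, linT_rootGraft_tr, PTree.rootDec_mapRoot,
      MI.sum_choose_add_inf, MI.sum_Iic_unit_inf]
    simp only [MI.choose_zero_right, MI.choose_self, Nat.cast_one, one_smul, tsub_zero, add_zero]
    congr 1
    · rw [map_sum]
      refine Finset.sum_congr rfl fun l hl => ?_
      simp only [Finset.mem_Iic, le_inf_iff] at hl
      rw [map_smul, mapRootT_kerT, mapRootT_tr, mapRootT_tr, mapRootT_tr, PTree.mapRoot_mapRoot,
        PTree.mapRoot_mapRoot]
      congr 3
      exact PTree.mapRoot_congr _ (tsub_add_eq_add_tsub hl.1).symm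
    · split_ifs with ha
      · rw [linT_rootGraft_tr]
        refine Finset.sum_congr rfl fun l hl => ?_
        rw [mapRootT_tr, mapRootT_tr, PTree.mapRoot_mapRoot, Planted.lower, tsub_tsub,
          add_comm (MI.unit i)]
        congr 3
        exact PTree.mapRoot_congr _ (add_tsub_add_eq_tsub_right _ _ _)
      · simp

variable (K S) in
/-- The left action of the associative algebra `𝔗⁺` on `𝔗`. -/
def dotA : Alg K S →ₐ[K] Module.End K (T K S) := (moduleRelations K S).toHom

theorem dotA_powX (m : MI S) : dotA K S (Alg.powX K m) = mapRootT K (fun n => n + m) :=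
  ((moduleRelations K S).toHom_powX m).trans (linT_rootRaise m)

theorem dotA_X (i : Fin S.d) : dotA K S (Alg.X K i) = mapRootT K (fun n => n + MI.unit i) :=
  dotA_powX _

variable (K) in
/-- Deformed grafting onto the root, as a bilinear operation. -/
def graftRoot (i : Fin S.numKernels) (a : MI S) : T K S →ₗ[K] Module.End K (T K S) :=
  Finsupp.linearCombination K fun τ : Tree S => linT K (PTree.rootGraft K i a τ.2)

theorem graftRoot_tr (i : Fin S.numKernels) (a : MI S) {b : Bool} (τ : PTree S b) :
    graftRoot K i a (tr K τ) = linT K (PTree.rootGraft K i a τ) := by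
  simp [graftRoot, tr]

theorem dotA_pl (p : Planted S) : dotA K S (Alg.pl K p) = graftRoot K p.i p.a (tr K p.τ.2) := by
  rw [graftRoot_tr]
  exact (moduleRelations K S).toHom_pl p

variable (K S) in
/-- The span of the trees whose root is of the given kind. -/
def rootSpan (b : Bool) (n : MI S) : Submodule K (T K S) :=
  Finsupp.supported K K {t | t.1 = b ∧ t.2.rootDec = n}

theorem tr_mem_rootSpan {b : Bool} (t : PTree S b) : tr K t ∈ rootSpan K S b t.rootDec :=
  Finsupp.single_mem_supported _ _ ⟨rfl, rfl⟩

@[elab_as_elim]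
theorem rootSpan_induction {b : Bool} {n : MI S} {p : T K S → Prop} {s : T K S}
    (hs : s ∈ rootSpan K S b n) (h0 : p 0) (ha : ∀ x y, p x → p y → p (x + y))
    (hc : ∀ (c : K) x, p x → p (c • x)) (ht : ∀ t : PTree S b, t.rootDec = n → p (tr K t)) :
    p s := by
  rw [rootSpan, Finsupp.supported_eq_span_single] at hs
  induction hs using Submodule.span_induction with
  | mem x hx =>
    obtain ⟨⟨c, t⟩, ⟨h, h'⟩, rfl⟩ := hx
    obtain rfl : c = b := h
    exact ht t h'
  | zero => exact h0
  | add x y _ _ hx hy => exact ha x y hx hy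
  | smul c x _ hx => exact hc c x hx

/-- The coefficients of a deformed root grafting depend only on the root decoration n, so on
combinations of trees sharing n a single formula, linear in s and in t, is valid. -/
theorem graftRoot_of_mem (i : Fin S.numKernels) (a : MI S) (s : T K S) {b : Bool} {n : MI S}
    {t : T K S} (ht : t ∈ rootSpan K S b n) : graftRoot K i a s t =
      ∑ l ∈ Finset.Iic (n ⊓ a), ((n.choose l : ℕ) : K) •
        kerT K i (a - l) s (mapRootT K (fun n => n - l) t) := by
  refine rootSpan_induction ht ?_ (fun x y hx hy => ?_) (fun c x hx => ?_) (fun t h => ?_)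
  · simp
  · simp only [map_add, smul_add, Finset.sum_add_distrib, hx, hy]
  · simp only [map_smul, hx, Finset.smul_sum]
    exact Finset.sum_congr rfl fun l _ => smul_comm _ _ _
  · subst h
    have : (graftRoot K i a).flip (tr K t) = ∑ l ∈ Finset.Iic (t.rootDec ⊓ a),
        ((t.rootDec.choose l : ℕ) : K) •
          (kerT K i (a - l)).flip (mapRootT K (fun n => n - l) (tr K t)) := by
      refine T_ext fun c τ => ?_
      rw [LinearMap.flip_apply, graftRoot_tr, linT_rootGraft_tr]
      simp
    simpa using LinearMap.congr_fun this s

theorem kerT_mem_rootSpan (i : Fin S.numKernels) (a : MI S) (s : T K S) {b : Bool} {n : MI S}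
    {t : T K S} (ht : t ∈ rootSpan K S b n) : kerT K i a s t ∈ rootSpan K S b n := by
  refine rootSpan_induction ht ?_ (fun x y hx hy => ?_) (fun c x hx => ?_) (fun t h => ?_)
  · simp
  · rw [map_add]; exact add_mem hx hy
  · rw [map_smul]; exact Submodule.smul_mem _ _ hx
  · induction s using Finsupp.induction_linear with
    | zero => simp
    | add x y hx hy => rw [map_add]; exact add_mem hx hy
    | single x c =>
      rw [← Finsupp.smul_single_one, tr_eq, map_smul, LinearMap.smul_apply, kerT_tr]
      subst h
      exact Submodule.smul_mem _ _ (tr_mem_rootSpan (PTree.kernel i a x.2 t))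

theorem noiseT_mem_rootSpan (j : Fin S.numNoises) (a m : MI S) {n : MI S} {t : T K S}
    (ht : t ∈ rootSpan K S false n) : noiseT K j a m t ∈ rootSpan K S true n := by
  refine rootSpan_induction ht ?_ (fun x y hx hy => ?_) (fun c x hx => ?_) (fun t h => ?_)
  · simp
  · rw [map_add]; exact add_mem hx hy
  · rw [map_smul]; exact Submodule.smul_mem _ _ hx
  · subst h
    rw [noiseT_tr]
    exact tr_mem_rootSpan (PTree.noise j a m t)

theorem noiseT_of_mem_true (j : Fin S.numNoises) (a m : MI S) {n : MI S} {t : T K S}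
    (ht : t ∈ rootSpan K S true n) : noiseT K j a m t = 0 := by
  refine rootSpan_induction ht ?_ (fun x y hx hy => ?_) (fun c x hx => ?_) (fun t h => ?_)
  · simp
  · rw [map_add, hx, hy, add_zero]
  · rw [map_smul, hx, smul_zero]
  · exact noiseT_tr_true j a m t

end TreeModule

/-! ### Grafting by recursion on the tree -/

section Grafting

open Coalgebra

variable (K : Type*) [Field K] {S : TreeData}

/-- The result of grafting the elements of `𝔗⁺` on all inner vertices of a tree, as a linear map. -/
def actTree : {b : Bool} → PTree S b → (Alg K S →ₗ[K] T K S)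
  | _, .vertex m => counit.smulRight (tr K (PTree.vertex m))
  | _, .kernel i a τ σ =>
      bconv (kerT K i a) (bconv (dotA K S).toLinearMap LinearMap.id (actTree τ)) (actTree σ)
  | _, .noise j a m σ => noiseT K j a m ∘ₗ actTree σ

variable (S)

/-- The grafting operation `x ▷ t`, for `x ∈ 𝔗⁺` and `t ∈ 𝔗`. -/
def act : Alg K S →ₗ[K] Module.End K (T K S) :=
  (Finsupp.linearCombination K fun t : Tree S => actTree K t.2).flip

/-- The action `x ∗ t = x₍₁₎ · (x₍₂₎ ▷ t)` of `𝔗⁺` on `𝔗`. -/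
def star : Alg K S →ₗ[K] Module.End K (T K S) :=
  cv (C := Alg K S) (B := Module.End K (T K S)) (dotA K S).toLinearMap (act K S)

variable {K S}

theorem act_tr (x : Alg K S) {b : Bool} (t : PTree S b) : act K S x (tr K t) = actTree K t x := by
  simp [act, tr]

theorem act_vertex (x : Alg K S) (m : MI S) :
    act K S x (tr K (PTree.vertex m)) = counit (R := K) x • tr K (PTree.vertex m) := by
  rw [act_tr, actTree, LinearMap.smulRight_apply]

theorem star_apply {x : Alg K S} {ι : Type*} (r : Repr K x ι) (t : T K S) :
    star K S x t = ∑ i ∈ r.index, dotA K S (r.left i) (act K S (r.right i) t) := by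
  rw [star, cv, bconv_apply _ _ _ r, LinearMap.sum_apply]
  rfl

/-- The root of s becomes an inner vertex of the joined tree and may itself receive grafts, which
turns ▷ into ∗ on s. The root of t remains the root. -/
theorem act_kerT {x : Alg K S} {ι : Type*} (r : Repr K x ι) (i : Fin S.numKernels) (a : MI S)
    (s t : T K S) : act K S x (kerT K i a s t) =
      ∑ k ∈ r.index, kerT K i a (star K S (r.left k) s) (act K S (r.right k) t) := by
  have h : (kerT K i a).compr₂ (act K S x) =
      ∑ k ∈ r.index, (kerT K i a).compl₁₂ (star K S (r.left k)) (act K S (r.right k)) := by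
    refine T_ext fun b τ => T_ext fun c σ => ?_
    rw [LinearMap.compr₂_apply, kerT_tr, act_tr, actTree, bconv_apply _ _ _ r,
      LinearMap.sum_apply, LinearMap.sum_apply]
    refine Finset.sum_congr rfl fun k _ => ?_
    rw [LinearMap.compl₁₂_apply, act_tr, star_apply (ℛ K _), bconv_apply _ _ _ (ℛ K _)]
    simp only [act_tr]
    rfl
  simpa using LinearMap.congr_fun (LinearMap.congr_fun h s) t

/-- Grafting never reaches the root. With `graftRoot_of_mem`, this allows a deformed root grafting
to be performed after x ▷ with the same coefficients as before. -/
theorem act_mem_rootSpan (x : Alg K S) {b : Bool} {n : MI S} {t : T K S}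
    (ht : t ∈ rootSpan K S b n) : act K S x t ∈ rootSpan K S b n := by
  refine rootSpan_induction ht ?_ (fun x y hx hy => ?_) (fun c x hx => ?_) (fun t h => ?_)
  · simp
  · rw [map_add]; exact add_mem hx hy
  · rw [map_smul]; exact Submodule.smul_mem _ _ hx
  · subst h
    clear ht
    induction t generalizing x with
    | vertex m => rw [act_vertex]; exact Submodule.smul_mem _ _ (tr_mem_rootSpan _)
    | kernel i a τ σ _ ih =>
      rw [← kerT_tr, act_kerT (ℛ K x)]
      exact sum_mem fun k _ => kerT_mem_rootSpan _ _ _ (ih _)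
    | noise j a m σ ih =>
      rw [act_tr, actTree, LinearMap.comp_apply, ← act_tr]
      exact noiseT_mem_rootSpan _ _ _ (ih _)

theorem act_noiseT (x : Alg K S) (j : Fin S.numNoises) (a m : MI S) (t : T K S) :
    act K S x (noiseT K j a m t) = noiseT K j a m (act K S x t) := by
  have h : act K S x ∘ₗ noiseT K j a m = noiseT K j a m ∘ₗ act K S x := by
    refine T_ext fun b σ => ?_
    rw [LinearMap.comp_apply, LinearMap.comp_apply]
    cases b
    · rw [noiseT_tr, act_tr, actTree, act_tr]
      rfl
    · rw [noiseT_tr_true, noiseT_of_mem_true _ _ _ (act_mem_rootSpan x (tr_mem_rootSpan σ)),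
        map_zero]
  exact LinearMap.congr_fun h t

theorem act_mapRootT (x : Alg K S) (f : MI S → MI S) (t : T K S) :
    act K S x (mapRootT K f t) = mapRootT K f (act K S x t) := by
  have h : ∀ x : Alg K S, act K S x ∘ₗ mapRootT K f = mapRootT K f ∘ₗ act K S x := by
    intro x
    refine T_ext fun b σ => ?_
    rw [LinearMap.comp_apply, LinearMap.comp_apply]
    induction σ generalizing x with
    | vertex m => simp only [mapRootT_tr, PTree.mapRoot, act_vertex, map_smul]
    | kernel i a τ σ _ ih =>
      rw [← kerT_tr, mapRootT_kerT, act_kerT (ℛ K x), act_kerT (ℛ K x), map_sum]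
      refine Finset.sum_congr rfl fun k _ => ?_
      rw [mapRootT_kerT, ih]
    | noise j a m σ ih =>
      rw [← noiseT_tr, mapRootT_noiseT, act_noiseT, act_noiseT, mapRootT_noiseT, ih]
  exact LinearMap.congr_fun (h x) t

/-- Since x ▷ preserves the root decoration, the binomial coefficients are the same on both sides,
and `act_kerT` applies term by term in ℓ. -/
theorem act_graftRoot {x : Alg K S} {ι : Type*} (r : Repr K x ι) (i : Fin S.numKernels) (a : MI S)
    (s t : T K S) : act K S x (graftRoot K i a s t) =
      ∑ k ∈ r.index, graftRoot K i a (star K S (r.left k) s) (act K S (r.right k) t) := by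
  have h : act K S x ∘ₗ graftRoot K i a s =
      ∑ k ∈ r.index, graftRoot K i a (star K S (r.left k) s) ∘ₗ act K S (r.right k) := by
    refine T_ext fun b σ => ?_
    rw [LinearMap.comp_apply, LinearMap.sum_apply]
    simp only [LinearMap.comp_apply]
    simp only [graftRoot_of_mem _ _ _ (act_mem_rootSpan _ (tr_mem_rootSpan σ)),
      graftRoot_of_mem _ _ _ (tr_mem_rootSpan σ)]
    rw [map_sum, Finset.sum_comm]
    refine Finset.sum_congr rfl fun l _ => ?_
    rw [map_smul, act_kerT r, Finset.smul_sum]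
    refine Finset.sum_congr rfl fun k _ => ?_
    rw [act_mapRootT]
  simpa using LinearMap.congr_fun h t

theorem act_one : act K S 1 = 1 := by
  have h1 : comul (R := K) (1 : Alg K S) = (1 : Alg K S) ⊗ₜ[K] (1 : Alg K S) :=
    Bialgebra.comul_one
  have h2 : ∀ (M N Q : Type _) [AddCommGroup M] [AddCommGroup N] [AddCommGroup Q] [Module K M]
      [Module K N] [Module K Q] (β : M →ₗ[K] N →ₗ[K] Q) (f : Alg K S →ₗ[K] M)
      (g : Alg K S →ₗ[K] N), bconv β f g 1 = β (f 1) (g 1) := by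
    intros
    rw [bconv, LinearMap.comp_apply, h1]
    rfl
  refine T_ext fun b t => ?_
  rw [act_tr, Module.End.one_apply]
  induction t with
  | vertex m => simp [actTree]
  | kernel i a τ σ ih ih' =>
    rw [actTree, h2, h2, ih, ih', ← kerT_tr]
    simp
  | noise j a m σ ih => rw [actTree, LinearMap.comp_apply, ih, noiseT_tr]

theorem star_one : star K S 1 = 1 := by
  have h1 : comul (R := K) (1 : Alg K S) = (1 : Alg K S) ⊗ₜ[K] (1 : Alg K S) :=
    Bialgebra.comul_one
  rw [star, cv, bconv, LinearMap.comp_apply, h1]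
  change dotA K S 1 * act K S 1 = 1
  rw [act_one, map_one, mul_one]

end Grafting

end

section

/-! ### Additivity of regularity and edge number -/

section Weights

variable {K : Type*} [Field K] {S : TreeData}

namespace PTree

/-- The number of edges. -/
def edges {b : Bool} : PTree S b → ℕ
  | vertex _ => 0
  | kernel _ _ τ σ => 1 + τ.edges + σ.edges
  | noise _ _ _ σ => 1 + σ.edges

/-- The regularity and the number of edges. -/
def wt {b : Bool} (t : PTree S b) : ℝ × ℕ := (t.reg, t.edges)

/-- The weight of a kernel edge. -/
def edgeWt (i : Fin S.numKernels) (a : MI S) : ℝ × ℕ := (S.kernelReg i - (a.size : ℝ), 1)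

theorem wt_vertex (m : MI S) : (vertex m).wt = ((m.size : ℝ), 0) := rfl

theorem wt_kernel (i : Fin S.numKernels) (a : MI S) {b c : Bool} (τ : PTree S b) (σ : PTree S c) :
    (kernel i a τ σ).wt = edgeWt i a + τ.wt + σ.wt := rfl

theorem wt_noise (j : Fin S.numNoises) (a m : MI S) (σ : PTree S false) :
    (noise j a m σ).wt = (S.noiseReg j - 1 - (a.size : ℝ) + (m.size : ℝ), 1) + σ.wt := rfl

theorem edgeWt_sub (i : Fin S.numKernels) {a l : MI S} (h : l ≤ a) :
    edgeWt i (a - l) = edgeWt i a + ((l.size : ℝ), 0) := by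
  have h' : ((a.size : ℕ) : ℝ) = ((a - l).size : ℝ) + (l.size : ℝ) := by
    exact_mod_cast (MI.size_sub h).symm
  ext
  · simp [edgeWt, h']
    ring
  · rfl

theorem wt_mapRoot_add (m : MI S) {b : Bool} (t : PTree S b) :
    (t.mapRoot fun n => n + m).wt = ((m.size : ℝ), 0) + t.wt := by
  induction t with
  | vertex n =>
    ext
    · simp [mapRoot, wt_vertex, MI.size_add, add_comm]
    · rfl
  | kernel i a τ σ _ ih => rw [mapRoot, wt_kernel, wt_kernel, ih]; abel
  | noise j a n σ ih => rw [mapRoot, wt_noise, wt_noise, ih]; abel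

theorem mapRoot_sub_add {l : MI S} {b : Bool} (t : PTree S b) (h : l ≤ t.rootDec) :
    (t.mapRoot fun n => n - l).mapRoot (fun n => n + l) = t := by
  rw [mapRoot_mapRoot]
  conv_rhs => rw [← mapRoot_id t]
  exact mapRoot_congr _ (tsub_add_cancel_of_le h)

theorem wt_mapRoot_sub {l : MI S} {b : Bool} (t : PTree S b) (h : l ≤ t.rootDec) :
    ((l.size : ℝ), 0) + (t.mapRoot fun n => n - l).wt = t.wt := by
  rw [← wt_mapRoot_add, mapRoot_sub_add t h]

end PTree

/-- The weight of a planted tree. -/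
def Planted.wt (p : Planted S) : ℝ × ℕ := PTree.edgeWt p.i p.a + p.τ.2.wt

/-- The weight of a basis element of `𝔗⁺`. -/
def PosTree.wt (x : PosTree S) : ℝ × ℕ := ((x.1.size : ℝ), 0) + (x.2.map Planted.wt).sum

/-- The tree `x` is split into `y` and `z` by the deshuffle coproduct. -/
def IsSplit (x y z : PosTree S) : Prop := y.1 + z.1 = x.1 ∧ (y.2, z.2) ∈ unshuffles x.2

theorem sum_of_mem_unshuffles {α M : Type*} [AddCommMonoid M] (f : α → M) {w : List α}
    {q : List α × List α} (h : q ∈ unshuffles w) :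
    (w.map f).sum = (q.1.map f).sum + (q.2.map f).sum := by
  induction w generalizing q with
  | nil =>
    simp only [unshuffles, List.mem_singleton] at h
    simp [h]
  | cons a w ih =>
    simp only [unshuffles, List.mem_append, List.mem_map] at h
    rcases h with ⟨q', hq', rfl⟩ | ⟨q', hq', rfl⟩
    · simp [ih hq', add_assoc]
    · simp [ih hq', add_left_comm]

theorem IsSplit.wt {x y z : PosTree S} (h : IsSplit x y z) : x.wt = y.wt + z.wt := by
  have h1 : ((x.1.size : ℝ), 0) = ((y.1.size : ℝ), 0) + (((z.1.size : ℝ), 0) : ℝ × ℕ) := by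
    ext
    · rw [← h.1, MI.size_add]; simp
    · rfl
  rw [PosTree.wt, PosTree.wt, PosTree.wt, sum_of_mem_unshuffles _ h.2, h1]
  abel

theorem PosTree.wt_fst_nonneg (x : PosTree S) : 0 ≤ x.wt.1 := by
  obtain ⟨m, w⟩ := x
  simp only [PosTree.wt, Prod.fst_add]
  refine add_nonneg (Nat.cast_nonneg _) ?_
  induction w with
  | nil => simp
  | cons p w ih =>
    rw [List.map_cons, List.sum_cons, Prod.fst_add]
    exact add_nonneg p.pos.le ih

theorem bconv_mono_mem {M N Q : Type*} [AddCommMonoid M] [Module K M] [AddCommMonoid N] [Module K N]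
    [AddCommMonoid Q] [Module K Q] (β : M →ₗ[K] N →ₗ[K] Q) (f : Alg K S →ₗ[K] M)
    (g : Alg K S →ₗ[K] N) (W : Submodule K Q) {x : PosTree S}
    (h : ∀ y z, IsSplit x y z → β (f (Alg.mono K y)) (g (Alg.mono K z)) ∈ W) :
    bconv β f g (Alg.mono K x) ∈ W := by
  rw [bconv, LinearMap.comp_apply, Alg.comul_mono, map_sum]
  refine sum_mem fun l hl => ?_
  rw [map_smul]
  refine Submodule.smul_mem _ _ ?_
  rw [map_list_sum, List.map_map]
  refine list_sum_mem fun u hu => ?_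
  obtain ⟨q, hq, rfl⟩ := List.mem_map.1 hu
  exact h _ _ ⟨add_tsub_cancel_of_le (Finset.mem_Iic.1 hl), hq⟩

variable (K S) in
/-- The span of the trees of a given weight. -/
def wtSpan (d : ℝ × ℕ) : Submodule K (T K S) := Finsupp.supported K K {t | t.2.wt = d}

theorem tr_mem_wtSpan {b : Bool} (t : PTree S b) : tr K t ∈ wtSpan K S t.wt :=
  Finsupp.single_mem_supported _ _ rfl

theorem tr_mem_wtSpan' {b : Bool} (t : PTree S b) {d : ℝ × ℕ} (h : t.wt = d) :
    tr K t ∈ wtSpan K S d := h ▸ tr_mem_wtSpan t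

theorem map_mem_of_supported {M : Type*} [AddCommMonoid M] [Module K M] {U : Set (Tree S)}
    (f : T K S →ₗ[K] M) {W : Submodule K M} (h : ∀ t ∈ U, f (tr K t.2) ∈ W) {s : T K S}
    (hs : s ∈ Finsupp.supported K K U) : f s ∈ W := by
  have h' : Finsupp.supported K K U ≤ W.comap f := by
    rw [Finsupp.supported_eq_span_single, Submodule.span_le]
    rintro _ ⟨t, ht, rfl⟩
    exact h t ht
  exact h' hs

theorem map_mem_wtSpan {f : Module.End K (T K S)} {w d : ℝ × ℕ}
    (hf : ∀ (b : Bool) (t : PTree S b), f (tr K t) ∈ wtSpan K S (w + t.wt)) {s : T K S}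
    (hs : s ∈ wtSpan K S d) : f s ∈ wtSpan K S (w + d) := by
  refine map_mem_of_supported f ?_ hs
  rintro ⟨b, t⟩ rfl
  exact hf b t

theorem kerT_mem_wtSpan (i : Fin S.numKernels) (a : MI S) {s t : T K S} {d e : ℝ × ℕ}
    (hs : s ∈ wtSpan K S d) (ht : t ∈ wtSpan K S e) :
    kerT K i a s t ∈ wtSpan K S (PTree.edgeWt i a + d + e) := by
  refine map_mem_of_supported (kerT K i a s) ?_ ht
  rintro ⟨c, σ⟩ rfl
  refine map_mem_of_supported ((kerT K i a).flip (tr K σ)) ?_ hs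
  rintro ⟨b, τ⟩ rfl
  rw [LinearMap.flip_apply, kerT_tr]
  exact tr_mem_wtSpan _

/-- A deformation by ℓ removes |ℓ| from the root decoration and |ℓ| from an edge decoration, which
counts negatively. The two changes cancel, so regularities add exactly. -/
theorem dotA_mem_wtSpan (x : PosTree S) {d : ℝ × ℕ} {s : T K S} (hs : s ∈ wtSpan K S d) :
    dotA K S (Alg.mono K x) s ∈ wtSpan K S (x.wt + d) := by
  have hE : ∀ (m : MI S) (d : ℝ × ℕ) (s : T K S), s ∈ wtSpan K S d →
      dotA K S (Alg.powX K m) s ∈ wtSpan K S (((m.size : ℝ), 0) + d) := by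
    intro m d s hs
    refine map_mem_wtSpan (fun b t => ?_) hs
    rw [dotA_powX, mapRootT_tr]
    exact tr_mem_wtSpan' _ (PTree.wt_mapRoot_add m t)
  have hP : ∀ (p : Planted S) (d : ℝ × ℕ) (s : T K S), s ∈ wtSpan K S d →
      dotA K S (Alg.pl K p) s ∈ wtSpan K S (p.wt + d) := by
    intro p d s hs
    refine map_mem_wtSpan (fun b t => ?_) hs
    rw [dotA_pl, graftRoot_of_mem _ _ _ (tr_mem_rootSpan t)]
    refine sum_mem fun l hl => Submodule.smul_mem _ _ ?_
    simp only [Finset.mem_Iic, le_inf_iff] at hl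
    rw [mapRootT_tr, kerT_tr]
    refine tr_mem_wtSpan' _ ?_
    rw [PTree.wt_kernel, PTree.edgeWt_sub _ hl.2, ← PTree.wt_mapRoot_sub t hl.1, Planted.wt]
    abel
  obtain ⟨m, w⟩ := x
  rw [Alg.mono_eq, map_mul, Module.End.mul_apply, PosTree.wt, add_assoc]
  refine hE _ _ _ ?_
  simp only
  induction w with
  | nil => simpa [Alg.mono_zero] using hs
  | cons p w ih =>
    rw [← Alg.pl_mul_mono, map_mul, Module.End.mul_apply, List.map_cons, List.sum_cons, add_assoc]
    exact hP _ _ _ ih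

theorem act_kerT_eq (x : Alg K S) (i : Fin S.numKernels) (a : MI S) (s t : T K S) :
    act K S x (kerT K i a s t) = bconv (kerT K i a) ((star K S).flip s) ((act K S).flip t) x := by
  rw [act_kerT (Coalgebra.Repr.arbitrary K x), bconv_apply _ _ _ (Coalgebra.Repr.arbitrary K x)]
  rfl

theorem star_eq (x : Alg K S) (t : T K S) : star K S x t =
    bconv (C := Alg K S) (M := Module.End K (T K S)) (N := T K S) (Q := T K S) LinearMap.id
      (dotA K S).toLinearMap ((act K S).flip t) x := by
  rw [star_apply (Coalgebra.Repr.arbitrary K x), bconv_apply _ _ _ (Coalgebra.Repr.arbitrary K x)]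
  rfl

theorem act_tr_mem_wtSpan (x : PosTree S) {b : Bool} (t : PTree S b) :
    act K S (Alg.mono K x) (tr K t) ∈ wtSpan K S (x.wt + t.wt) ∧
      star K S (Alg.mono K x) (tr K t) ∈ wtSpan K S (x.wt + t.wt) := by
  suffices h : ∀ x, act K S (Alg.mono K x) (tr K t) ∈ wtSpan K S (x.wt + t.wt) by
    refine ⟨h x, ?_⟩
    rw [star_eq]
    refine bconv_mono_mem _ _ _ _ fun y z hyz => ?_
    rw [hyz.wt, add_assoc]
    exact dotA_mem_wtSpan _ (h z)
  clear x
  induction t with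
  | vertex m =>
    intro x
    rw [act_vertex]
    by_cases hx : x = (0, [])
    · subst hx
      refine Submodule.smul_mem _ _ (tr_mem_wtSpan' _ ?_)
      have : PosTree.wt ((0, []) : PosTree S) = 0 := by simp [PosTree.wt, MI.size_zero]
      rw [this, zero_add]
    · have : Coalgebra.counit (R := K) (Alg.mono K x) = 0 := by
        rw [Alg.counit_eq]
        exact Finsupp.single_eq_of_ne (Ne.symm hx)
      rw [this, zero_smul]
      exact zero_mem _
  | kernel i a τ σ ih ih' =>
    intro x
    rw [← kerT_tr, act_kerT_eq]
    refine bconv_mono_mem _ _ _ _ fun y z hyz => ?_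
    have hτ : star K S (Alg.mono K y) (tr K τ) ∈ wtSpan K S (y.wt + τ.wt) := by
      rw [star_eq]
      refine bconv_mono_mem _ _ _ _ fun y z hyz => ?_
      rw [hyz.wt, add_assoc]
      exact dotA_mem_wtSpan _ (ih z)
    have := kerT_mem_wtSpan i a hτ (ih' z)
    rw [hyz.wt, PTree.wt_kernel]
    have h : y.wt + z.wt + (PTree.edgeWt i a + τ.wt + σ.wt) =
        PTree.edgeWt i a + (y.wt + τ.wt) + (z.wt + σ.wt) := by abel
    rw [h]
    exact this
  | noise j a m σ ih =>
    intro x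
    rw [← noiseT_tr, act_noiseT, PTree.wt_noise, add_left_comm]
    refine map_mem_of_supported (noiseT K j a m) ?_ (ih x)
    rintro ⟨b, t⟩ ht
    cases b
    · rw [noiseT_tr]
      exact tr_mem_wtSpan' _ (by rw [PTree.wt_noise]; exact congrArg _ ht)
    · rw [noiseT_tr_true]
      exact zero_mem _

theorem star_mem_wtSpan (x : PosTree S) {d : ℝ × ℕ} {s : T K S} (hs : s ∈ wtSpan K S d) :
    star K S (Alg.mono K x) s ∈ wtSpan K S (x.wt + d) :=
  map_mem_wtSpan (fun _ t => (act_tr_mem_wtSpan x t).2) hs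

variable (K S) in
/-- The span of the trees of regularity at least `r`. -/
def regGE (r : ℝ) : Submodule K (T K S) := Finsupp.supported K K {t | r ≤ t.2.reg}

/-- Weights add and the trees of 𝔗⁺ have nonnegative regularity. Consequently I_a(x ∗ τ) is again of
positive regularity whenever I_a(τ) is. -/
theorem star_mem_regGE (x : Alg K S) {b : Bool} (t : PTree S b) :
    star K S x (tr K t) ∈ regGE K S t.reg := by
  have h : (⊤ : Submodule K (Alg K S)) ≤
      (regGE K S t.reg).comap ((star K S).flip (tr K t)) := by
    rw [← Alg.span_mono, Submodule.span_le]
    rintro _ ⟨x, rfl⟩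
    refine Finsupp.supported_mono ?_ (star_mem_wtSpan x (tr_mem_wtSpan t))
    intro u hu
    have h1 : u.2.reg = x.wt.1 + t.reg := congrArg Prod.fst (hu : u.2.wt = _)
    have := x.wt_fst_nonneg
    change t.reg ≤ u.2.reg
    linarith
  exact h (Submodule.mem_top : x ∈ ⊤)

end Weights

end

section

open Coalgebra

variable {K : Type*} [Field K] {S : TreeData}

namespace Alg

/-- Induction on elements of `𝔗⁺`. -/
theorem induction {p : Alg K S → Prop} (h1 : p 1) (hX : ∀ i y, p y → p (X K i * y))
    (hp : ∀ q y, p y → p (pl K q * y)) (ha : ∀ x y, p x → p y → p (x + y))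
    (hc : ∀ (c : K) x, p x → p (c • x)) (y : Alg K S) : p y := by
  let W : Submodule K (Alg K S) :=
    { carrier := {y | p y}
      add_mem' := fun {x y} hx hy => ha x y hx hy
      zero_mem' := by simpa using hc 0 1 h1
      smul_mem' := hc }
  have : W = ⊤ := eq_top_of_mul_mem W h1 hX hp
  exact (this ▸ Submodule.mem_top : y ∈ W)

theorem map_mem {M : Type*} [AddCommMonoid M] [Module K M] (f : Alg K S →ₗ[K] M)
    {W : Submodule K M} (h : ∀ x, f (mono K x) ∈ W) (y : Alg K S) : f y ∈ W := by
  have h' : (⊤ : Submodule K (Alg K S)) ≤ W.comap f := by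
    rw [← span_mono, Submodule.span_le]
    rintro _ ⟨x, rfl⟩
    exact h x
  exact h' Submodule.mem_top

end Alg

/-! ### The inclusion of 𝔗⁺ in 𝔗 and stability of 𝔗⁺ under grafting -/

section Inclusion

namespace PosTree

/-- The tree given by a root decoration and a word of planted trees. -/
def tree (m : MI S) (w : List (Planted S)) : PTree S false :=
  w.foldr (fun p σ => PTree.kernel p.i p.a p.τ.2 σ) (PTree.vertex m)

theorem toTree_eq (x : PosTree S) : x.toTree = ⟨false, tree x.1 x.2⟩ := rfl

theorem tree_injective {m n : MI S} {v w : List (Planted S)} (h : tree m v = tree n w) :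
    m = n ∧ v = w := by
  induction v generalizing w with
  | nil =>
    cases w with
    | nil => exact ⟨by injection h, rfl⟩
    | cons q w => simp [tree] at h
  | cons p v ih =>
    cases w with
    | nil => simp [tree] at h
    | cons q w =>
      change PTree.kernel p.i p.a p.τ.2 (tree m v) = PTree.kernel q.i q.a q.τ.2 (tree n w) at h
      injection h with h1 h2 h3 h4 h5 h6
      obtain ⟨rfl, rfl⟩ := ih h6
      refine ⟨rfl, ?_⟩
      congr 1
      exact Planted.ext h3 h4 (Sigma.ext h1 h5)

theorem toTree_injective : Function.Injective (toTree (S := S)) := by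
  intro x y h
  rw [toTree_eq, toTree_eq] at h
  obtain ⟨h1, h2⟩ := tree_injective (eq_of_heq (Sigma.mk.inj h).2)
  exact Prod.ext h1 h2

theorem rootDec_tree (m : MI S) (w : List (Planted S)) : (tree m w).rootDec = m := by
  induction w with
  | nil => rfl
  | cons p w ih => exact ih

theorem mapRoot_tree (f : MI S → MI S) (m : MI S) (w : List (Planted S)) :
    (tree m w).mapRoot f = tree (f m) w := by
  induction w with
  | nil => rfl
  | cons p w ih =>
    exact congrArg (PTree.kernel p.i p.a p.τ.2) ih

end PosTree

variable (K S) in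
/-- The inclusion of `𝔗⁺` in `𝔗`. -/
def inc : Alg K S →ₗ[K] T K S := incl K S

theorem inc_mono (m : MI S) (w : List (Planted S)) :
    inc K S (Alg.mono K (m, w)) = tr K (PosTree.tree m w) :=
  Finsupp.mapDomain_single

theorem inc_one : inc K S 1 = tr K (PTree.vertex 0) := inc_mono 0 []

/-- Identities in 𝔗⁺ are established in 𝔗, where no positivity has to be tracked, and pulled back
along this injection. -/
theorem inc_injective : Function.Injective (inc K S) :=
  Finsupp.mapDomain_injective PosTree.toTree_injective

theorem tree_cons (m : MI S) (p : Planted S) (w : List (Planted S)) :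
    (tr K (PosTree.tree m (p :: w)) : T K S) =
      kerT K p.i p.a (tr K p.τ.2) (tr K (PosTree.tree m w)) := by
  rw [kerT_tr]
  rfl

theorem inc_powX_mul (m : MI S) (y : Alg K S) :
    inc K S (Alg.powX K m * y) = dotA K S (Alg.powX K m) (inc K S y) := by
  have h : inc K S ∘ₗ LinearMap.mulLeft K (Alg.powX K m) =
      dotA K S (Alg.powX K m) ∘ₗ inc K S := by
    refine Alg.lhom_ext fun x => ?_
    obtain ⟨n, w⟩ := x
    rw [LinearMap.comp_apply, LinearMap.mulLeft_apply, Alg.powX_mul_mono, LinearMap.comp_apply,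
      inc_mono, inc_mono, dotA_powX, mapRootT_tr, PosTree.mapRoot_tree]
  exact LinearMap.congr_fun h y

theorem inc_pl_mul (p : Planted S) (y : Alg K S) :
    inc K S (Alg.pl K p * y) = dotA K S (Alg.pl K p) (inc K S y) := by
  have h : inc K S ∘ₗ LinearMap.mulLeft K (Alg.pl K p) =
      dotA K S (Alg.pl K p) ∘ₗ inc K S := by
    refine Alg.lhom_ext fun x => ?_
    obtain ⟨n, w⟩ := x
    have h1 : Alg.pl K p * Alg.mono K (n, w) = ∑ l ∈ Finset.Iic (n ⊓ p.a),
        ((n.choose l : ℕ) : K) • Alg.mono K (n - l, p.lower l :: w) := by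
      have h2 : Relations.graft K p (Finsupp.single (n, w) 1) = ∑ l ∈ Finset.Iic (n ⊓ p.a),
          ((n.choose l : ℕ) : K) • (Finsupp.single (n - l, p.lower l :: w) 1 : TPlus K S) := by
        rw [Relations.graft, Finsupp.linearCombination_single, one_smul]
        exact Finset.sum_congr rfl fun l _ => (Finsupp.smul_single_one _ _).symm
      exact (Alg.pl_mul p _).trans h2
    rw [LinearMap.comp_apply, LinearMap.mulLeft_apply, LinearMap.comp_apply, h1, map_sum,
      inc_mono, dotA_pl, graftRoot_of_mem _ _ _ (tr_mem_rootSpan _), PosTree.rootDec_tree]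
    refine Finset.sum_congr rfl fun l _ => ?_
    rw [map_smul, inc_mono, tree_cons, mapRootT_tr, PosTree.mapRoot_tree]
    rfl
  exact LinearMap.congr_fun h y

theorem inc_mul (x y : Alg K S) : inc K S (x * y) = dotA K S x (inc K S y) := by
  induction x using Alg.induction generalizing y with
  | h1 => rw [one_mul, map_one, Module.End.one_apply]
  | hX i x hx =>
    rw [mul_assoc, ← Alg.powX_unit, inc_powX_mul, hx, map_mul, Module.End.mul_apply]
  | hp p x hx => rw [mul_assoc, inc_pl_mul, hx, map_mul, Module.End.mul_apply]
  | ha x x' hx hx' => rw [add_mul, map_add, hx, hx', map_add, LinearMap.add_apply]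
  | hc c x hx => rw [smul_mul_assoc, map_smul, hx, map_smul, LinearMap.smul_apply]

variable (K S) in
/-- The span of the planted trees. -/
def plSpan : Submodule K (Alg K S) := Submodule.span K (Set.range (Alg.pl K))

/-- One and the same y must represent I_a(s) both as a combination of trees and as an operator of
root grafting; sending s to the pair of the two values produces a common witness. -/
theorem exists_planted (i : Fin S.numKernels) (a : MI S) {r : ℝ}
    (hr : 0 < S.kernelReg i - (a.size : ℝ) + r) {s : T K S} (hs : s ∈ regGE K S r) :
    ∃ y ∈ plSpan K S, inc K S y = kerT K i a s (tr K (PTree.vertex 0)) ∧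
      dotA K S y = graftRoot K i a s := by
  let f : T K S →ₗ[K] T K S × Module.End K (T K S) :=
    ((kerT K i a).flip (tr K (PTree.vertex 0))).prod (graftRoot K i a)
  let g : Alg K S →ₗ[K] T K S × Module.End K (T K S) := (inc K S).prod (dotA K S).toLinearMap
  have h : f s ∈ (plSpan K S).map g := by
    refine map_mem_of_supported f ?_ hs
    intro t ht
    have hp : 0 < S.kernelReg i - (a.size : ℝ) + t.2.reg := hr.trans_le (by
      have : r ≤ t.2.reg := ht
      linarith)
    refine ⟨Alg.pl K ⟨i, a, t, hp⟩, Submodule.subset_span ⟨_, rfl⟩, Prod.ext ?_ ?_⟩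
    · exact (inc_mono 0 [⟨i, a, t, hp⟩]).trans (tree_cons _ _ _)
    · exact dotA_pl ⟨i, a, t, hp⟩
  obtain ⟨y, hy, h⟩ := h
  exact ⟨y, hy, congrArg Prod.fst h, congrArg Prod.snd h⟩

theorem kerT_mem_range_inc (i : Fin S.numKernels) (a : MI S) {r : ℝ}
    (hr : 0 < S.kernelReg i - (a.size : ℝ) + r) {s u : T K S} (hs : s ∈ regGE K S r)
    (hu : u ∈ LinearMap.range (inc K S)) : kerT K i a s u ∈ LinearMap.range (inc K S) := by
  obtain ⟨y, rfl⟩ := hu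
  rw [← LinearMap.comp_apply]
  refine Alg.map_mem _ (fun x => ?_) y
  rw [LinearMap.comp_apply]
  refine map_mem_of_supported ((kerT K i a).flip _) ?_ hs
  intro t ht
  have hp : 0 < S.kernelReg i - (a.size : ℝ) + t.2.reg := hr.trans_le (by
    have : r ≤ t.2.reg := ht
    linarith)
  obtain ⟨m, w⟩ := x
  exact ⟨Alg.mono K (m, ⟨i, a, t, hp⟩ :: w), by
    rw [inc_mono, tree_cons, LinearMap.flip_apply, inc_mono]⟩

/-- Along the word, the first letter I_a(τ) is replaced by I_a(x₍₁₎ ∗ τ), whose regularity is no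
smaller, and the rest of the word is treated by induction. -/
theorem act_inc_mem_range (x y : Alg K S) : act K S x (inc K S y) ∈ LinearMap.range (inc K S) := by
  rw [← LinearMap.comp_apply]
  refine Alg.map_mem _ (fun z => ?_) y
  obtain ⟨m, w⟩ := z
  rw [LinearMap.comp_apply, inc_mono]
  clear y
  induction w generalizing x with
  | nil =>
    change act K S x (tr K (PTree.vertex m)) ∈ _
    rw [act_vertex]
    exact Submodule.smul_mem _ _ ⟨Alg.mono K (m, []), inc_mono m []⟩
  | cons p w ih =>
    rw [tree_cons, act_kerT (ℛ K x)]
    exact sum_mem fun k _ => kerT_mem_range_inc _ _ p.pos (star_mem_regGE _ _) (ih _)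

theorem exists_tri : ∃ tri : Alg K S →ₗ[K] Module.End K (Alg K S),
    ∀ x y, inc K S (tri x y) = act K S x (inc K S y) := by
  -- Any linear left inverse of the inclusion serves, because x ▷ maps 𝔗⁺ into itself.
  obtain ⟨π, hπ⟩ := (inc K S).exists_leftInverse_of_injective (LinearMap.ker_eq_bot.2 inc_injective)
  refine ⟨((act K S).compl₂ (inc K S)).compr₂ π, fun x y => ?_⟩
  obtain ⟨z, hz⟩ := act_inc_mem_range x y
  rw [LinearMap.compr₂_apply, LinearMap.compl₂_apply, ← hz, ← LinearMap.comp_apply π, hπ]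
  rfl

variable (K S) in
/-- The grafting operation `x ▷ y` on `𝔗⁺`. -/
def tri : Alg K S →ₗ[K] Module.End K (Alg K S) := exists_tri.choose

theorem inc_tri (x y : Alg K S) : inc K S (tri K S x y) = act K S x (inc K S y) :=
  exists_tri.choose_spec x y

end Inclusion

/-! ### Distributivity of grafting over the associative product -/

section GuinOudom

theorem tri_one_left : tri K S 1 = 1 := by
  refine LinearMap.ext fun y => inc_injective ?_
  rw [inc_tri, act_one]
  rfl

theorem tri_one_right (x : Alg K S) : tri K S x 1 = counit (R := K) x • (1 : Alg K S) := by
  refine inc_injective ?_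
  rw [inc_tri, inc_one, act_vertex, map_smul, inc_one]

theorem tri_X (x : Alg K S) (i : Fin S.d) :
    tri K S x (Alg.X K i) = counit (R := K) x • Alg.X K i := by
  refine inc_injective ?_
  have h : inc K S (Alg.X K i) = tr K (PTree.vertex (MI.unit i)) := inc_mono (MI.unit i) []
  rw [inc_tri, map_smul, h, act_vertex]

/-- On the one-vertex tree below the planted edge x₍₂₎ acts through the counit, and x₍₁₎ ε(x₍₂₎) =
x, so all of x acts on τ, through ∗. -/
theorem tri_pl (x : Alg K S) (p : Planted S) : tri K S x (Alg.pl K p) ∈ plSpan K S ∧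
    inc K S (tri K S x (Alg.pl K p)) =
      kerT K p.i p.a (star K S x (tr K p.τ.2)) (tr K (PTree.vertex 0)) ∧
    dotA K S (tri K S x (Alg.pl K p)) = graftRoot K p.i p.a (star K S x (tr K p.τ.2)) := by
  obtain ⟨y, hy, hy1, hy2⟩ := exists_planted p.i p.a p.pos (star_mem_regGE x p.τ.2)
  have : tri K S x (Alg.pl K p) = y := by
    refine inc_injective ?_
    have h : inc K S (Alg.pl K p) = kerT K p.i p.a (tr K p.τ.2) (tr K (PTree.vertex 0)) :=
      (inc_mono 0 [p]).trans (tree_cons 0 p [])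
    rw [hy1, inc_tri, h, act_kerT (ℛ K x)]
    simp only [act_vertex, map_smul]
    conv_rhs => rw [← sum_smul_counit (ℛ K x), map_sum, LinearMap.sum_apply, map_sum,
      LinearMap.sum_apply]
    refine Finset.sum_congr rfl fun k _ => ?_
    simp
  rw [this]
  exact ⟨hy, hy1, hy2⟩

/-- This evaluates the operator identity for g on elements of 𝔗⁺. It is isolated because its
conclusion enters the induction by which `act_mul_dotA` establishes that identity for every g. -/
theorem tri_mul_of {g : Alg K S} (hg : ∀ x, act K S x * dotA K S g =
    cv ((dotA K S).toLinearMap ∘ₗ (tri K S).flip g) (act K S) x) (y : Alg K S) :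
    (tri K S).flip (g * y) = cv ((tri K S).flip g) ((tri K S).flip y) := by
  refine LinearMap.ext fun x => inc_injective ?_
  rw [LinearMap.flip_apply, inc_tri, inc_mul, ← Module.End.mul_apply, hg,
    bconv_apply _ _ _ (ℛ K x), bconv_apply _ _ _ (ℛ K x), map_sum, LinearMap.sum_apply]
  refine Finset.sum_congr rfl fun k _ => ?_
  rw [LinearMap.mul_apply', LinearMap.mul_apply', inc_mul, LinearMap.flip_apply,
    LinearMap.flip_apply, inc_tri]
  rfl

/-- For X^i this holds because grafting does not touch the root, for a planted tree it is
`act_graftRoot`, and it passes to products by coassociativity. Working on all of 𝔗 rather than on 𝔗⁺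
makes it usable for branches of arbitrary trees. -/
theorem act_mul_dotA (x y : Alg K S) : act K S x * dotA K S y =
    cv ((dotA K S).toLinearMap ∘ₗ (tri K S).flip y) (act K S) x := by
  have step : ∀ g y : Alg K S, (∀ x, act K S x * dotA K S g =
      cv ((dotA K S).toLinearMap ∘ₗ (tri K S).flip g) (act K S) x) →
      (∀ x, act K S x * dotA K S y =
        cv ((dotA K S).toLinearMap ∘ₗ (tri K S).flip y) (act K S) x) →
      ∀ x, act K S x * dotA K S (g * y) =
        cv ((dotA K S).toLinearMap ∘ₗ (tri K S).flip (g * y)) (act K S) x := by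
    intro g y hg hy x
    have hy' : LinearMap.mulRight K (dotA K S y) ∘ₗ act K S =
        cv (C := Alg K S) (B := Module.End K (T K S))
          ((dotA K S).toLinearMap ∘ₗ (tri K S).flip y) (act K S) := LinearMap.ext hy
    have e : (dotA K S).toLinearMap ∘ₗ cv ((tri K S).flip g) ((tri K S).flip y) =
        cv ((dotA K S).toLinearMap ∘ₗ (tri K S).flip g)
          ((dotA K S).toLinearMap ∘ₗ (tri K S).flip y) :=
      algHom_comp_cv (C := Alg K S) (dotA K S) ((tri K S).flip g) ((tri K S).flip y)
    rw [tri_mul_of hg, e, cv_assoc, ← hy', map_mul, ← mul_assoc, hg,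
      bconv_apply _ _ _ (ℛ K x), bconv_apply _ _ _ (ℛ K x), Finset.sum_mul]
    exact Finset.sum_congr rfl fun k _ => mul_assoc _ _ _
  induction y using Alg.induction generalizing x with
  | h1 =>
    have : (dotA K S).toLinearMap ∘ₗ (tri K S).flip 1 = counit.smulRight 1 := by
      refine LinearMap.ext fun x => ?_
      rw [LinearMap.comp_apply, LinearMap.flip_apply, tri_one_right, map_smul]
      simp
    rw [this, cv, bconv_counit_left, map_one, mul_one]
    simp
  | hX i y hy =>
    refine step _ _ (fun x => ?_) hy x
    have : (dotA K S).toLinearMap ∘ₗ (tri K S).flip (Alg.X K i) =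
        counit.smulRight (dotA K S (Alg.X K i)) := by
      refine LinearMap.ext fun x => ?_
      rw [LinearMap.comp_apply, LinearMap.flip_apply, tri_X, map_smul]
      simp
    rw [this, cv, bconv_counit_left]
    refine LinearMap.ext fun t => ?_
    simp only [Module.End.mul_apply, LinearMap.comp_apply, LinearMap.mul_apply', dotA_X,
      act_mapRootT]
  | hp p y hy =>
    refine step _ _ (fun x => ?_) hy x
    refine LinearMap.ext fun t => ?_
    rw [dotA_pl, Module.End.mul_apply, act_graftRoot (ℛ K x), bconv_apply _ _ _ (ℛ K x),
      LinearMap.sum_apply]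
    refine Finset.sum_congr rfl fun k _ => ?_
    rw [← (tri_pl _ p).2.2]
    rfl
  | ha y y' hy hy' =>
    rw [map_add, mul_add, hy, hy', bconv_apply _ _ _ (ℛ K x), bconv_apply _ _ _ (ℛ K x),
      bconv_apply _ _ _ (ℛ K x), ← Finset.sum_add_distrib]
    refine Finset.sum_congr rfl fun k _ => ?_
    simp
  | hc c y hy =>
    rw [map_smul, mul_smul_comm, hy, bconv_apply _ _ _ (ℛ K x), bconv_apply _ _ _ (ℛ K x),
      Finset.smul_sum]
    refine Finset.sum_congr rfl fun k _ => ?_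
    simp

theorem tri_mul (y z : Alg K S) :
    (tri K S).flip (y * z) = cv ((tri K S).flip y) ((tri K S).flip z) :=
  tri_mul_of (fun x => act_mul_dotA x y) z

end GuinOudom

end

section

open Coalgebra

variable {K : Type*} [Field K] {S : TreeData}

/-! ### Compatibility of ▷ and ∗ with the coproduct -/

section Coproduct

section

variable {C M N Q : Type*} [AddCommMonoid C] [Module K C] [Coalgebra K C] [AddCommMonoid M]
  [Module K M] [AddCommMonoid N] [Module K N] [AddCommMonoid Q] [Module K Q]
  (β : M →ₗ[K] N →ₗ[K] Q) (f f' : C →ₗ[K] M) (g g' : C →ₗ[K] N)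

theorem bconv_add_left : bconv β (f + f') g = bconv β f g + bconv β f' g := by
  refine LinearMap.ext fun x => ?_
  rw [LinearMap.add_apply, bconv_apply _ _ _ (ℛ K x), bconv_apply _ _ _ (ℛ K x),
    bconv_apply _ _ _ (ℛ K x), ← Finset.sum_add_distrib]
  exact Finset.sum_congr rfl fun k _ => by simp

theorem bconv_add_right : bconv β f (g + g') = bconv β f g + bconv β f g' := by
  refine LinearMap.ext fun x => ?_
  rw [LinearMap.add_apply, bconv_apply _ _ _ (ℛ K x), bconv_apply _ _ _ (ℛ K x),
    bconv_apply _ _ _ (ℛ K x), ← Finset.sum_add_distrib]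
  exact Finset.sum_congr rfl fun k _ => by simp

theorem bconv_zero_left : bconv β (0 : C →ₗ[K] M) g = 0 := by
  refine LinearMap.ext fun x => ?_
  rw [bconv_apply _ _ _ (ℛ K x)]
  simp

theorem bconv_zero_right : bconv β f (0 : C →ₗ[K] N) = 0 := by
  refine LinearMap.ext fun x => ?_
  rw [bconv_apply _ _ _ (ℛ K x)]
  simp

end

/-- Middle-four interchange: cocommutativity exchanges the two inner factors, whose values commute.
-/
theorem cv_cv_cv_comm {C B : Type*} [AddCommMonoid C] [Module K C] [Coalgebra K C] [IsCocomm K C]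
    [Semiring B] [Algebra K B] {f g h k : C →ₗ[K] B} (hc : ∀ x y, Commute (g x) (h y)) :
    cv (cv f g) (cv h k) = cv (cv f h) (cv g k) := by
  rw [cv_assoc, ← cv_assoc g, cv_comm hc, cv_assoc h, cv_assoc f]

variable (K S) in
/-- The first inclusion of `𝔗⁺` in its tensor square. -/
def inl : Alg K S →ₐ[K] Alg K S ⊗[K] Alg K S := Algebra.TensorProduct.includeLeft

variable (K S) in
/-- The second inclusion of `𝔗⁺` in its tensor square. -/
def inr : Alg K S →ₐ[K] Alg K S ⊗[K] Alg K S := Algebra.TensorProduct.includeRight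

theorem inl_mul_inr (x y : Alg K S) : inl K S x * inr K S y = x ⊗ₜ[K] y := by
  simp [inl, inr]

theorem inr_mul_inl (x y : Alg K S) : inr K S y * inl K S x = x ⊗ₜ[K] y := by
  simp [inl, inr]

theorem commute_inr_inl (x y : Alg K S) : Commute (inr K S x) (inl K S y) := by
  rw [Commute, SemiconjBy, inl_mul_inr, inr_mul_inl]

/-- The diagonal extension of a bilinear operation on `𝔗⁺` to its tensor square, as a function of
the first argument. -/
def diag (μ : Alg K S →ₗ[K] Module.End K (Alg K S)) :
    Alg K S ⊗[K] Alg K S →ₗ[K] Alg K S →ₗ[K] Alg K S ⊗[K] Alg K S :=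
  ((TensorProduct.map₂ μ μ) ∘ₗ comul).flip

theorem diag_apply (μ : Alg K S →ₗ[K] Module.End K (Alg K S)) (u : Alg K S ⊗[K] Alg K S)
    (x : Alg K S) : diag μ u x = TensorProduct.map₂ μ μ (comul x) u := rfl

theorem diag_tmul (μ : Alg K S →ₗ[K] Module.End K (Alg K S)) (y z : Alg K S) :
    diag μ (y ⊗ₜ z) =
      cv ((inl K S).toLinearMap ∘ₗ μ.flip y) ((inr K S).toLinearMap ∘ₗ μ.flip z) := by
  refine LinearMap.ext fun x => ?_
  rw [diag_apply, bconv_apply _ _ _ (ℛ K x), ← (ℛ K x).eq, map_sum, LinearMap.sum_apply]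
  refine Finset.sum_congr rfl fun k _ => ?_
  rw [TensorProduct.map₂_apply_tmul, TensorProduct.map_tmul, LinearMap.mul_apply',
    LinearMap.comp_apply, LinearMap.comp_apply]
  exact (inl_mul_inr _ _).symm

theorem diag_tri_mul (u v : Alg K S ⊗[K] Alg K S) :
    diag (tri K S) (u * v) = cv (diag (tri K S) u) (diag (tri K S) v) := by
  induction u using TensorProduct.induction_on with
  | zero => rw [zero_mul, map_zero, cv, bconv_zero_left]
  | add u u' hu hu' =>
    rw [add_mul, map_add, hu, hu', map_add]
    exact (bconv_add_left _ _ _ _).symm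
  | tmul a b =>
    induction v using TensorProduct.induction_on with
    | zero => rw [mul_zero, map_zero, cv, bconv_zero_right]
    | add u u' hu hu' =>
      rw [mul_add, map_add, hu, hu', map_add]
      exact (bconv_add_right _ _ _ _).symm
    | tmul c d =>
      rw [Algebra.TensorProduct.tmul_mul_tmul, diag_tmul, diag_tmul, diag_tmul, tri_mul, tri_mul,
        algHom_comp_cv, algHom_comp_cv, cv_cv_cv_comm]
      intro x y
      exact (commute_inr_inl _ _).symm

theorem flip_tri_one : (tri K S).flip 1 = counit.smulRight 1 := by
  refine LinearMap.ext fun x => ?_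
  rw [LinearMap.flip_apply, tri_one_right, LinearMap.smulRight_apply]

theorem algHom_comp_smulRight_one {B : Type*} [Semiring B] [Algebra K B] (f : Alg K S →ₐ[K] B) :
    f.toLinearMap ∘ₗ counit.smulRight 1 = (counit : Alg K S →ₗ[K] K).smulRight 1 := by
  refine LinearMap.ext fun x => ?_
  simp

theorem cv_one_left {B : Type*} [Semiring B] [Algebra K B] (f : Alg K S →ₗ[K] B) :
    cv (counit.smulRight 1) f = f := by
  rw [cv, bconv_counit_left]
  refine LinearMap.ext fun x => ?_
  simp

theorem cv_one_right {B : Type*} [Semiring B] [Algebra K B] (f : Alg K S →ₗ[K] B) :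
    cv f (counit.smulRight 1) = f := by
  rw [cv, bconv_counit_right]
  refine LinearMap.ext fun x => ?_
  simp

theorem plSpan_le_lieP : plSpan K S ≤ Alg.lieP K S := by
  refine Submodule.span_le.2 ?_
  rintro _ ⟨p, rfl⟩
  exact Alg.pl_mem_lieP p

/-- A generator is sent by x ▷ to a primitive element, which settles the case of generators; for
products, both sides are convolutions by `tri_mul` and `diag_tri_mul`. -/
theorem comul_tri (x y : Alg K S) :
    comul (R := K) (tri K S x y) = TensorProduct.map₂ (tri K S) (tri K S) (comul x) (comul y) := by
  rw [← diag_apply]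
  have prim : ∀ g : Alg K S, comul (R := K) g = g ⊗ₜ[K] (1 : Alg K S) + 1 ⊗ₜ[K] g →
      (∀ x, comul (R := K) (tri K S x g) =
        tri K S x g ⊗ₜ[K] (1 : Alg K S) + 1 ⊗ₜ[K] tri K S x g) →
      comul ∘ₗ (tri K S).flip g = diag (tri K S) (comul g) := by
    intro g hg h
    rw [hg, map_add, diag_tmul, diag_tmul, flip_tri_one, algHom_comp_smulRight_one,
      algHom_comp_smulRight_one, cv_one_left, cv_one_right]
    refine LinearMap.ext fun x => ?_
    rw [LinearMap.comp_apply, LinearMap.flip_apply, h]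
    rfl
  have step : ∀ g y : Alg K S, comul ∘ₗ (tri K S).flip g = diag (tri K S) (comul g) →
      comul ∘ₗ (tri K S).flip y = diag (tri K S) (comul y) →
      comul ∘ₗ (tri K S).flip (g * y) = diag (tri K S) (comul (g * y)) := by
    intro g y hg hy
    have h : (comul : Alg K S →ₗ[K] _) ∘ₗ cv ((tri K S).flip g) ((tri K S).flip y) =
        cv (comul ∘ₗ (tri K S).flip g) (comul ∘ₗ (tri K S).flip y) :=
      algHom_comp_cv (Bialgebra.comulAlgHom K (Alg K S)) _ _
    rw [tri_mul, h, hg, hy, Bialgebra.comul_mul, diag_tri_mul]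
  suffices h : comul ∘ₗ (tri K S).flip y = diag (tri K S) (comul y) from LinearMap.congr_fun h x
  induction y using Alg.induction with
  | h1 =>
    rw [Bialgebra.comul_one, Algebra.TensorProduct.one_def, diag_tmul, flip_tri_one,
      algHom_comp_smulRight_one, algHom_comp_smulRight_one, cv_one_left]
    exact algHom_comp_smulRight_one (Bialgebra.comulAlgHom K (Alg K S))
  | hX i y hy =>
    refine step _ _ (prim _ (Alg.comul_X i) fun x => ?_) hy
    rw [tri_X, map_smul, Alg.comul_X, smul_add, TensorProduct.smul_tmul', TensorProduct.tmul_smul]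
  | hp p y hy =>
    exact step _ _ (prim _ (Alg.comul_pl p) fun x =>
      Alg.comul_of_mem_lieV (Alg.lieP_le_lieV (plSpan_le_lieP (tri_pl x p).1))) hy
  | ha y y' hy hy' => rw [map_add, map_add, map_add, ← hy, ← hy', LinearMap.comp_add]
  | hc c y hy => rw [map_smul, map_smul, map_smul, ← hy, LinearMap.comp_smul]

variable (K S) in
/-- The product `x ∗ y = x₍₁₎ · (x₍₂₎ ▷ y)`. -/
def gl : Alg K S →ₗ[K] Module.End K (Alg K S) :=
  bconv (LinearMap.mul K (Module.End K (Alg K S))) (LinearMap.mul K (Alg K S)) (tri K S)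

theorem gl_apply {x : Alg K S} {ι : Type*} (r : Repr K x ι) (y : Alg K S) :
    gl K S x y = ∑ k ∈ r.index, r.left k * tri K S (r.right k) y := by
  rw [gl, bconv_apply _ _ _ r, LinearMap.sum_apply]
  rfl

theorem flip_gl (y : Alg K S) : (gl K S).flip y = cv LinearMap.id ((tri K S).flip y) := by
  refine LinearMap.ext fun x => ?_
  rw [LinearMap.flip_apply, gl_apply (ℛ K x), bconv_apply _ _ _ (ℛ K x)]
  rfl

theorem inc_gl (x y : Alg K S) : inc K S (gl K S x y) = star K S x (inc K S y) := by
  rw [gl_apply (ℛ K x), star_apply (ℛ K x), map_sum]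
  refine Finset.sum_congr rfl fun k _ => ?_
  rw [inc_mul, inc_tri]

theorem cv_inl_inr : cv (inl K S).toLinearMap (inr K S).toLinearMap = comul := by
  refine LinearMap.ext fun x => ?_
  conv_rhs => rw [← (ℛ K x).eq]
  rw [bconv_apply _ _ _ (ℛ K x)]
  exact Finset.sum_congr rfl fun k _ => inl_mul_inr _ _

/-- The left side is the convolution of the coproduct with the coproduct of (· ▷ y). Writing the
former as the convolution of the two inclusions of 𝔗⁺ in 𝔗⁺ ⊗ 𝔗⁺, the interchange law regroups the
four factors. -/
theorem comul_gl (x y : Alg K S) :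
    comul (R := K) (gl K S x y) = TensorProduct.map₂ (gl K S) (gl K S) (comul x) (comul y) := by
  rw [← diag_apply]
  suffices h : comul ∘ₗ (gl K S).flip y = diag (gl K S) (comul y) from LinearMap.congr_fun h x
  have h1 : (comul : Alg K S →ₗ[K] _) ∘ₗ cv LinearMap.id ((tri K S).flip y) =
      cv comul (comul ∘ₗ (tri K S).flip y) :=
    algHom_comp_cv (Bialgebra.comulAlgHom K (Alg K S)) LinearMap.id _
  have h2 : comul ∘ₗ (tri K S).flip y = diag (tri K S) (comul y) :=
    LinearMap.ext fun x => comul_tri x y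
  rw [flip_gl, h1, h2]
  generalize comul (R := K) y = u
  rw [← cv_inl_inr]
  induction u using TensorProduct.induction_on with
  | zero => rw [map_zero, map_zero, cv, bconv_zero_right]
  | add u u' hu hu' => rw [map_add, map_add, ← hu, ← hu', cv, bconv_add_right]
  | tmul a b =>
    rw [diag_tmul, diag_tmul, flip_gl, flip_gl, algHom_comp_cv, algHom_comp_cv, cv_cv_cv_comm]
    · rfl
    · intro x y
      exact commute_inr_inl _ _

theorem counit_tri (x y : Alg K S) : counit (R := K) (tri K S x y) = counit x * counit y := by
  have step : ∀ g y : Alg K S, (∀ x, counit (R := K) (tri K S x g) = counit x * counit g) →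
      (∀ x, counit (R := K) (tri K S x y) = counit x * counit y) →
      ∀ x, counit (R := K) (tri K S x (g * y)) = counit x * counit (g * y) := by
    intro g y hg hy x
    have h := LinearMap.congr_fun (tri_mul g y) x
    rw [LinearMap.flip_apply, bconv_apply _ _ _ (ℛ K x)] at h
    rw [h, map_sum, Bialgebra.counit_mul]
    conv_rhs => rw [← sum_counit_smul (ℛ K x), map_sum, Finset.sum_mul]
    refine Finset.sum_congr rfl fun k _ => ?_
    rw [LinearMap.mul_apply', Bialgebra.counit_mul, LinearMap.flip_apply, LinearMap.flip_apply,
      hg, hy, map_smul, smul_eq_mul]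
    ring
  induction y using Alg.induction generalizing x with
  | h1 => rw [tri_one_right, map_smul, smul_eq_mul]
  | hX i y hy =>
    refine step _ _ (fun x => ?_) hy x
    rw [tri_X, map_smul, smul_eq_mul]
  | hp p y hy =>
    refine step _ _ (fun x => ?_) hy x
    rw [Alg.counit_pl, mul_zero]
    exact Alg.counit_of_mem_lieV (Alg.lieP_le_lieV (plSpan_le_lieP (tri_pl x p).1))
  | ha y y' hy hy' => rw [map_add, map_add, map_add, hy, hy', mul_add]
  | hc c y hy => rw [map_smul, map_smul, map_smul, hy, smul_eq_mul, smul_eq_mul, mul_left_comm]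

theorem counit_gl (x y : Alg K S) : counit (R := K) (gl K S x y) = counit x * counit y := by
  rw [gl_apply (ℛ K x), map_sum]
  conv_rhs => rw [← sum_counit_smul (ℛ K x), map_sum, Finset.sum_mul]
  refine Finset.sum_congr rfl fun k _ => ?_
  rw [Bialgebra.counit_mul, counit_tri, map_smul, smul_eq_mul, mul_assoc]

end Coproduct

/-! ### Associativity of ∗ -/

section Associativity

theorem bconv_gl {M N Q : Type*} [AddCommMonoid M] [Module K M] [AddCommMonoid N] [Module K N]
    [AddCommMonoid Q] [Module K Q] (β : M →ₗ[K] N →ₗ[K] Q) (f : Alg K S →ₗ[K] M)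
    (g : Alg K S →ₗ[K] N) {x y : Alg K S} {ι ι' : Type*} (r : Repr K x ι) (r' : Repr K y ι') :
    bconv β f g (gl K S x y) = ∑ k ∈ r.index, ∑ l ∈ r'.index,
      β (f (gl K S (r.left k) (r'.left l))) (g (gl K S (r.right k) (r'.right l))) := by
  rw [bconv, LinearMap.comp_apply, comul_gl, ← r.eq, ← r'.eq]
  simp only [map_sum, LinearMap.sum_apply, TensorProduct.map₂_apply_tmul, TensorProduct.map_tmul,
    TensorProduct.lift.tmul, LinearMap.compl₁₂_apply]
  exact Finset.sum_comm

/-- By coassociativity the left side is a sum of x₍₁₎ · (x₍₂₎ ▷ y) · (x₍₃₎ ▷ t), and `act_mul_dotA`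
contracts the last two factors to x₍₂₎ ▷ (y · t). -/
theorem sum_dotA_gl_mul_act {x : Alg K S} {ι : Type*} (r : Repr K x ι) (y : Alg K S) :
    ∑ k ∈ r.index, dotA K S (gl K S (r.left k) y) * act K S (r.right k) =
      star K S x * dotA K S y := by
  have h1 : (dotA K S).toLinearMap ∘ₗ (gl K S).flip y =
      cv (dotA K S).toLinearMap ((dotA K S).toLinearMap ∘ₗ (tri K S).flip y) := by
    rw [flip_gl]
    exact algHom_comp_cv (C := Alg K S) (dotA K S) LinearMap.id ((tri K S).flip y)
  have h2 : cv (C := Alg K S) (B := Module.End K (T K S))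
      ((dotA K S).toLinearMap ∘ₗ (tri K S).flip y) (act K S) =
      LinearMap.mulRight K (dotA K S y) ∘ₗ act K S :=
    (LinearMap.ext fun x => act_mul_dotA x y).symm
  have h3 : cv (C := Alg K S) (B := Module.End K (T K S))
      ((dotA K S).toLinearMap ∘ₗ (gl K S).flip y) (act K S) x = star K S x * dotA K S y := by
    rw [h1, cv_assoc, h2, bconv_apply _ _ _ r, star, cv, bconv_apply _ _ _ r, Finset.sum_mul]
    exact Finset.sum_congr rfl fun k _ => (mul_assoc _ _ _).symm
  rw [← h3, bconv_apply _ _ _ r]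
  rfl

/-- Stated for one fixed t, so that the inductive hypothesis on a branch for ▷ yields the
corresponding law for ∗ on the same branch. -/
theorem star_gl_of_act_gl {t : T K S}
    (h : ∀ x y, act K S (gl K S x y) t = act K S x (act K S y t)) (x y : Alg K S) :
    star K S (gl K S x y) t = star K S x (star K S y t) := by
  rw [star_eq, bconv_gl _ _ _ (ℛ K x) (ℛ K y), star_apply (ℛ K y), map_sum, Finset.sum_comm]
  refine Finset.sum_congr rfl fun l _ => ?_
  rw [← Module.End.mul_apply, ← sum_dotA_gl_mul_act (ℛ K x), LinearMap.sum_apply]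
  refine Finset.sum_congr rfl fun k _ => ?_
  rw [LinearMap.flip_apply, h]
  rfl

/-- Structural induction on the tree. By `comul_gl` the action of x ∗ y on a joined tree splits over
the two parts; the upper part is governed by ∗, for which the law follows from the inductive
hypothesis through `star_gl_of_act_gl`. -/
theorem act_gl (x y : Alg K S) : act K S (gl K S x y) = act K S x * act K S y := by
  refine T_ext fun b t => ?_
  rw [Module.End.mul_apply]
  induction t generalizing x y with
  | vertex m =>
    rw [act_vertex, act_vertex, map_smul, act_vertex, counit_gl, smul_smul, mul_comm]
  | kernel i a τ σ ih ih' =>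
    rw [← kerT_tr, act_kerT_eq, bconv_gl _ _ _ (ℛ K x) (ℛ K y), act_kerT (ℛ K y), map_sum,
      Finset.sum_comm]
    refine Finset.sum_congr rfl fun l _ => ?_
    rw [act_kerT (ℛ K x)]
    refine Finset.sum_congr rfl fun k _ => ?_
    rw [LinearMap.flip_apply, LinearMap.flip_apply, star_gl_of_act_gl ih, ih']
  | noise j a m σ ih =>
    rw [← noiseT_tr, act_noiseT, act_noiseT, act_noiseT, ih]

theorem star_gl (x y : Alg K S) : star K S (gl K S x y) = star K S x * star K S y :=
  LinearMap.ext fun t => star_gl_of_act_gl (fun x y => LinearMap.congr_fun (act_gl x y) t) x y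

theorem gl_assoc (x y : Alg K S) : gl K S (gl K S x y) = gl K S x * gl K S y := by
  refine LinearMap.ext fun z => inc_injective ?_
  rw [Module.End.mul_apply, inc_gl, inc_gl, inc_gl, star_gl, Module.End.mul_apply]

theorem gl_one_left : gl K S 1 = 1 := by
  refine LinearMap.ext fun z => inc_injective ?_
  rw [inc_gl, star_one]
  rfl

theorem gl_one_right (x : Alg K S) : gl K S x 1 = x := by
  have := LinearMap.congr_fun (flip_gl (K := K) (S := S) 1) x
  rw [flip_tri_one, cv_one_right] at this
  exact this

end Associativity

end

section

open Coalgebra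

variable {K : Type*} [Field K] {S : TreeData}

/-! ### Primitive elements act as sums over inner vertices -/

section InnerVertices

theorem kerT_mapDomain_left (i : Fin S.numKernels) (a : MI S) {b c : Bool} (u : PTree S b →₀ K)
    (σ : PTree S c) : kerT K i a (Finsupp.mapDomain (Sigma.mk b) u) (tr K σ) =
      Finsupp.mapDomain (Sigma.mk c) (Finsupp.mapDomain (fun τ => PTree.kernel i a τ σ) u) := by
  induction u using Finsupp.induction_linear with
  | zero => simp
  | add x y hx hy => simp only [Finsupp.mapDomain_add, map_add, LinearMap.add_apply, hx, hy]
  | single τ r =>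
    simp only [Finsupp.mapDomain_single]
    simp [kerT, tr, Finsupp.mapDomain_single]

theorem kerT_mapDomain_right (i : Fin S.numKernels) (a : MI S) {b c : Bool} (τ : PTree S b)
    (u : PTree S c →₀ K) : kerT K i a (tr K τ) (Finsupp.mapDomain (Sigma.mk c) u) =
      Finsupp.mapDomain (Sigma.mk c) (Finsupp.mapDomain (fun σ => PTree.kernel i a τ σ) u) := by
  induction u using Finsupp.induction_linear with
  | zero => simp
  | add x y hx hy => simp only [Finsupp.mapDomain_add, map_add, hx, hy]
  | single σ r =>
    simp only [Finsupp.mapDomain_single]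
    simp [kerT, tr, Finsupp.mapDomain_single]

theorem noiseT_mapDomain (j : Fin S.numNoises) (a m : MI S) (u : PTree S false →₀ K) :
    noiseT K j a m (Finsupp.mapDomain (Sigma.mk false) u) =
      Finsupp.mapDomain (Sigma.mk true) (Finsupp.mapDomain (fun σ => PTree.noise j a m σ) u) := by
  induction u using Finsupp.induction_linear with
  | zero => simp
  | add x y hx hy => simp only [Finsupp.mapDomain_add, map_add, hx, hy]
  | single σ r =>
    simp only [Finsupp.mapDomain_single]
    simp [noiseT, noiseTree, tr]

/-- A primitive element acts as a derivation with respect to joining trees. On the upper branch, x ∗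
s = x · s + x ▷ s separates the contribution of its root from that of the vertices above, which is
the recursion defining `sumInner`. -/
theorem act_eq_linT_sumInner {x : Alg K S}
    (hx : comul (R := K) x = x ⊗ₜ[K] (1 : Alg K S) + 1 ⊗ₜ[K] x) (hc : counit (R := K) x = 0)
    (R : ∀ b : Bool, PTree S b → (PTree S b →₀ K)) (hR : dotA K S x = linT K R) :
    act K S x = linT K fun _ t => PTree.sumInner K R t := by
  have hs : ∀ s, star K S x s = dotA K S x s + act K S x s := by
    intro s
    rw [star, cv, bconv_of_comul _ _ _ hx, act_one]
    simp
  refine T_ext fun b t => ?_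
  induction t with
  | vertex m => rw [act_vertex, hc, zero_smul, linT_tr, PTree.sumInner, Finsupp.mapDomain_zero]
  | kernel i a τ σ ih ih' =>
    rw [linT_tr, PTree.sumInner, Finsupp.mapDomain_add, ← kerT_mapDomain_left,
      ← kerT_mapDomain_right, Finsupp.mapDomain_add, ← linT_tr R, ← hR,
      ← linT_tr (fun _ t => PTree.sumInner K R t), ← linT_tr (fun _ t => PTree.sumInner K R t),
      ← ih, ← ih', ← hs, ← kerT_tr, act_kerT_eq, bconv_of_comul _ _ _ hx]
    simp only [LinearMap.flip_apply, star_one, act_one, Module.End.one_apply]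
  | noise j a m σ ih =>
    rw [linT_tr, PTree.sumInner, ← noiseT_mapDomain, ← linT_tr (fun _ t => PTree.sumInner K R t),
      ← ih, ← noiseT_tr, act_noiseT]

theorem act_pl (p : Planted S) : act K S (Alg.pl K p) = graftT K p :=
  act_eq_linT_sumInner (Alg.comul_pl p) (Alg.counit_pl p) _
    ((dotA_pl p).trans (graftRoot_tr p.i p.a p.τ.2))

theorem act_X (i : Fin S.d) : act K S (Alg.X K i) = raiseT K i :=
  act_eq_linT_sumInner (Alg.comul_X i) (Alg.counit_X i) _
    ((dotA_X i).trans (linT_rootRaise (MI.unit i)).symm)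

end InnerVertices

/-! ### The post-Lie and Guin–Oudom identities -/

section PostLie

theorem tri_mul_of_primitive {x : Alg K S}
    (hx : comul (R := K) x = x ⊗ₜ[K] (1 : Alg K S) + 1 ⊗ₜ[K] x) (y z : Alg K S) :
    tri K S x (y * z) = tri K S x y * z + y * tri K S x z := by
  have h := LinearMap.congr_fun (tri_mul y z) x
  rw [cv, bconv_of_comul _ _ _ hx] at h
  simp only [LinearMap.flip_apply, tri_one_left, Module.End.one_apply, LinearMap.mul_apply'] at h
  exact h

theorem tri_mem_lieP {x : Alg K S} (hx : comul (R := K) x = x ⊗ₜ[K] (1 : Alg K S) + 1 ⊗ₜ[K] x)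
    {y : Alg K S} (hy : y ∈ Alg.lieP K S) : tri K S x y ∈ Alg.lieP K S := by
  have h : Alg.lieP K S ≤ Alg.lieP K S ⊓ (Alg.lieP K S).comap (tri K S x) := by
    refine Alg.lieP_le (fun p => ⟨Alg.pl_mem_lieP p, plSpan_le_lieP (tri_pl x p).1⟩) ?_
    rintro y ⟨hy, hy'⟩ z ⟨hz, hz'⟩
    rw [SetLike.mem_coe, Submodule.mem_comap] at hy' hz'
    refine ⟨Alg.commutator_mem_lieP hy hz, ?_⟩
    rw [SetLike.mem_coe, Submodule.mem_comap, map_sub, tri_mul_of_primitive hx,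
      tri_mul_of_primitive hx]
    convert add_mem (Alg.commutator_mem_lieP hy' hz) (Alg.commutator_mem_lieP hy hz') using 1
    abel
  exact (h hy).2

theorem tri_mem_lieV {x : Alg K S} (hx : x ∈ Alg.lieV K S) {y : Alg K S}
    (hy : y ∈ Alg.lieV K S) : tri K S x y ∈ Alg.lieV K S := by
  have h : Alg.lieV K S ≤ (Alg.lieV K S).comap (tri K S x) := by
    refine Alg.lieV_le (fun y hy => Alg.lieP_le_lieV (tri_mem_lieP (Alg.comul_of_mem_lieV hx) hy))
      fun i => ?_
    rw [Submodule.mem_comap, tri_X, Alg.counit_of_mem_lieV hx, zero_smul]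
    exact zero_mem _
  exact h hy

theorem tri_gl (x y : Alg K S) : tri K S (gl K S x y) = tri K S x * tri K S y := by
  refine LinearMap.ext fun z => inc_injective ?_
  rw [Module.End.mul_apply, inc_tri, inc_tri, inc_tri, act_gl, Module.End.mul_apply]

theorem gl_of_primitive {x : Alg K S}
    (hx : comul (R := K) x = x ⊗ₜ[K] (1 : Alg K S) + 1 ⊗ₜ[K] x) (y : Alg K S) :
    gl K S x y = x * y + tri K S x y := by
  rw [gl, bconv_of_comul _ _ _ hx, tri_one_left]
  simp

/-- For primitive x one has x ∗ y = xy + x ▷ y, so this is `act_gl` solved for the contribution of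
xy. -/
theorem act_mul_of_primitive {x : Alg K S}
    (hx : comul (R := K) x = x ⊗ₜ[K] (1 : Alg K S) + 1 ⊗ₜ[K] x) (y : Alg K S) (t : T K S) :
    act K S (x * y) t = act K S x (act K S y t) - act K S (tri K S x y) t := by
  rw [← Module.End.mul_apply, ← act_gl, gl_of_primitive hx, map_add, LinearMap.add_apply,
    add_sub_cancel_right]

theorem tri_mul_left_of_primitive {x : Alg K S}
    (hx : comul (R := K) x = x ⊗ₜ[K] (1 : Alg K S) + 1 ⊗ₜ[K] x) (y z : Alg K S) :
    tri K S (x * y) z = tri K S x (tri K S y z) - tri K S (tri K S x y) z := by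
  rw [← Module.End.mul_apply, ← tri_gl, gl_of_primitive hx, map_add, LinearMap.add_apply,
    add_sub_cancel_right]

theorem isDeformedPostLie : IsDeformedPostLie (K := K) (S := S) (tri K S) where
  closed x hx y hy := tri_mem_lieV (x := x) (y := y) hx hy
  planted_planted p q := (inc_tri (Alg.pl K p) (Alg.pl K q)).trans (by rw [act_pl]; rfl)
  X_left i y _ := (inc_tri (Alg.X K i) y).trans (by rw [act_X]; rfl)
  X_right y hy i := by
    have h := Alg.counit_of_mem_lieV (x := y) hy
    have h' := tri_X (K := K) y i
    rw [h, zero_smul] at h'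
    exact h'
  post_lie x hx y hy z hz := by
    have h : ∀ x ∈ Alg.lieV K S, ∀ y ∈ Alg.lieV K S, ∀ z,
        (tri K S x (tri K S y z) - tri K S (tri K S x y) z) -
          (tri K S y (tri K S x z) - tri K S (tri K S y x) z) = tri K S (x * y - y * x) z := by
      intro x hx y hy z
      -- The associator x ▷ (y ▷ z) - (x ▷ y) ▷ z equals (xy) ▷ z, so antisymmetrisation leaves the
      -- commutator.
      rw [map_sub, LinearMap.sub_apply, tri_mul_left_of_primitive (Alg.comul_of_mem_lieV hx),
        tri_mul_left_of_primitive (Alg.comul_of_mem_lieV hy)]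
    exact h x hx y hy z
  derivation x hx y hy z hz := by
    have h : ∀ x y z : Alg K S, x ∈ Alg.lieV K S → tri K S x (y * z - z * y) =
        (tri K S x y * z - z * tri K S x y) + (y * tri K S x z - tri K S x z * y) := by
      intro x y z hx
      rw [map_sub, tri_mul_of_primitive (Alg.comul_of_mem_lieV hx),
        tri_mul_of_primitive (Alg.comul_of_mem_lieV hx)]
      abel
    exact h x y z hx

theorem isGuinOudom : IsGuinOudom (K := K) (S := S) (tri K S) where
  one_left x := LinearMap.congr_fun (tri_one_left (K := K) (S := S)) x
  one_right x := (tri_one_right (K := K) (S := S) x).trans (by rw [Alg.counit_eq]; rfl)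
  mul_left v hv x u _ := tri_mul_left_of_primitive (Alg.comul_of_mem_lieV (x := v) hv) x u
  mul_right x y z := (LinearMap.congr_fun (tri_mul (K := K) (S := S) y z) x).trans (by
    rw [cv, bconv, Alg.comul_eq]
    rfl)

theorem isExtendedGrafting : IsExtendedGrafting (K := K) (S := S) (tri K S) (act K S) where
  one_left := act_one
  planted_left := act_pl
  X_left := act_X
  mul_left v hv x t := act_mul_of_primitive (Alg.comul_of_mem_lieV (x := v) hv) x t
  extends_tri := inc_tri

theorem grossmanLarson_eq_bconv {M : Type*} [AddCommGroup M] [Module K M]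
    (μ τ : TPlus K S →ₗ[K] Module.End K M) (μ' τ' : Alg K S →ₗ[K] Module.End K M) (h : μ = μ')
    (h' : τ = τ') : grossmanLarson μ τ = bconv (LinearMap.mul K (Module.End K M)) μ' τ' := by
  have e : bconv (LinearMap.mul K (Module.End K M)) μ' τ' =
      TensorProduct.lift ((LinearMap.mul K (Module.End K M)).compl₁₂ μ' τ') ∘ₗ comul := rfl
  rw [e, Alg.comul_eq, grossmanLarson, h, h']
  rfl

theorem grossmanLarson_tri : grossmanLarson (dot K S) (tri K S) = gl K S :=
  grossmanLarson_eq_bconv _ _ (LinearMap.mul K (Alg K S)) (tri K S) rfl rfl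

theorem grossmanLarson_act : grossmanLarson (dotT K S) (act K S) = star K S :=
  grossmanLarson_eq_bconv _ _ (dotA K S).toLinearMap (act K S) rfl rfl

end PostLie

/-! ### Uniqueness by induction on word length -/

section Uniqueness

variable (K S) in
/-- The generators of `𝔗⁺`. -/
def generators : Set (Alg K S) := Set.range (Alg.X K) ∪ Set.range (Alg.pl K)

theorem comul_of_mem_generators {g : Alg K S} (hg : g ∈ generators K S) :
    comul (R := K) g = g ⊗ₜ[K] (1 : Alg K S) + 1 ⊗ₜ[K] g := by
  rcases hg with ⟨i, rfl⟩ | ⟨p, rfl⟩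
  · exact Alg.comul_X i
  · exact Alg.comul_pl p

theorem mem_lieV_of_mem_generators {g : Alg K S} (hg : g ∈ generators K S) :
    g ∈ Alg.lieV K S := by
  rcases hg with ⟨i, rfl⟩ | ⟨p, rfl⟩
  · exact Alg.X_mem_lieV i
  · exact Alg.pl_mem_lieV p

variable (K S) in
/-- The span of the words of length at most one. -/
def lengthLeOne : Submodule K (Alg K S) := 1 ⊔ Submodule.span K (generators K S)

theorem lengthLeOne_le {W : Submodule K (Alg K S)} (h1 : 1 ∈ W)
    (hg : ∀ g ∈ generators K S, g ∈ W) : lengthLeOne K S ≤ W :=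
  sup_le (Submodule.one_le.2 h1) (Submodule.span_le.2 hg)

theorem one_mem_lengthLeOne : (1 : Alg K S) ∈ lengthLeOne K S :=
  (le_sup_left : _ ≤ lengthLeOne K S) (Submodule.one_le.1 le_rfl)

theorem generator_mem_lengthLeOne {g : Alg K S} (hg : g ∈ generators K S) :
    g ∈ lengthLeOne K S :=
  (le_sup_right : _ ≤ lengthLeOne K S) (Submodule.subset_span hg)

theorem plSpan_le_lengthLeOne : plSpan K S ≤ lengthLeOne K S := by
  refine Submodule.span_le.2 ?_
  rintro _ ⟨p, rfl⟩
  exact generator_mem_lengthLeOne (Or.inr ⟨p, rfl⟩)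

theorem tri_mem_lengthLeOne (x : Alg K S) {y : Alg K S} (hy : y ∈ lengthLeOne K S) :
    tri K S x y ∈ lengthLeOne K S := by
  have h : lengthLeOne K S ≤ (lengthLeOne K S).comap (tri K S x) := by
    refine lengthLeOne_le ?_ ?_
    · rw [Submodule.mem_comap, tri_one_right]
      exact Submodule.smul_mem _ _ one_mem_lengthLeOne
    · rintro _ (⟨i, rfl⟩ | ⟨p, rfl⟩)
      · rw [Submodule.mem_comap, tri_X]
        exact Submodule.smul_mem _ _ (generator_mem_lengthLeOne (Or.inl ⟨i, rfl⟩))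
      · exact plSpan_le_lengthLeOne (tri_pl x p).1
  exact h hy

/-- As a derivation preserving the span of 1 and the generators, g ▷ does not lengthen words. -/
theorem tri_mem_lengthLeOne_pow {g : Alg K S} (hg : g ∈ generators K S) (n : ℕ) {y : Alg K S}
    (hy : y ∈ lengthLeOne K S ^ n) : tri K S g y ∈ lengthLeOne K S ^ n := by
  induction n generalizing y with
  | zero =>
    rw [pow_zero] at hy ⊢
    obtain ⟨c, rfl⟩ := Submodule.mem_one.1 hy
    rw [Algebra.algebraMap_eq_smul_one, map_smul, tri_one_right]
    exact Submodule.smul_mem _ _ (Submodule.smul_mem _ _ (Submodule.one_le.1 le_rfl))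
  | succ n ih =>
    have h : lengthLeOne K S ^ (n + 1) ≤ (lengthLeOne K S ^ (n + 1)).comap (tri K S g) := by
      conv_lhs => rw [pow_succ']
      refine Submodule.mul_le.2 fun a ha b hb => ?_
      rw [Submodule.mem_comap, tri_mul_of_primitive (comul_of_mem_generators hg), pow_succ']
      exact add_mem (Submodule.mul_mem_mul (tri_mem_lengthLeOne g ha) hb)
        (Submodule.mul_mem_mul ha (ih hb))
    exact h hy

theorem exists_mem_lengthLeOne_pow (y : Alg K S) : ∃ n, y ∈ lengthLeOne K S ^ n := by
  have mono : Monotone fun n => lengthLeOne K S ^ n := monotone_nat_of_le_succ fun n y hy => by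
    rw [pow_succ']
    simpa using Submodule.mul_mem_mul one_mem_lengthLeOne hy
  have step : ∀ g ∈ generators K S, ∀ y, (∃ n, y ∈ lengthLeOne K S ^ n) →
      ∃ n, g * y ∈ lengthLeOne K S ^ n := by
    rintro g hg y ⟨n, hn⟩
    refine ⟨n + 1, ?_⟩
    rw [pow_succ']
    exact Submodule.mul_mem_mul (generator_mem_lengthLeOne hg) hn
  induction y using Alg.induction with
  | h1 => exact ⟨0, by rw [pow_zero]; exact (Submodule.one_le.1 le_rfl)⟩
  | hX i y hy => exact step _ (Or.inl ⟨i, rfl⟩) y hy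
  | hp p y hy => exact step _ (Or.inr ⟨p, rfl⟩) y hy
  | ha x y hx hy =>
    obtain ⟨n, hn⟩ := hx
    obtain ⟨k, hk⟩ := hy
    exact ⟨max n k, add_mem (mono (le_max_left n k) hn) (mono (le_max_right n k) hk)⟩
  | hc c x hx =>
    obtain ⟨n, hn⟩ := hx
    exact ⟨n, Submodule.smul_mem _ _ hn⟩

/-- In the relation (gx) ▷ u = g ▷ (x ▷ u) - (g ▷ x) ▷ u the element g ▷ x is not a subword of gx,
so induction over subwords fails. Its length is at most that of x, so it is already covered in an
induction on length. -/
theorem eq_top_of_tri_mem {W : Submodule K (Alg K S)} (h1 : 1 ∈ W)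
    (hg : ∀ g ∈ generators K S, ∀ x ∈ W, tri K S g x ∈ W → g * x ∈ W) : W = ⊤ := by
  have h : ∀ n, lengthLeOne K S ^ n ≤ W := by
    intro n
    induction n with
    | zero => rw [pow_zero]; exact Submodule.one_le.2 h1
    | succ n ih =>
      rw [pow_succ']
      refine Submodule.mul_le.2 fun a ha b hb => ?_
      have h : lengthLeOne K S ≤ W.comap (LinearMap.mulRight K b) := by
        refine lengthLeOne_le ?_ fun g h => ?_
        · rw [Submodule.mem_comap, LinearMap.mulRight_apply, one_mul]
          exact ih hb
        · exact hg g h b (ih hb) (ih (tri_mem_lengthLeOne_pow h n hb))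
      exact h ha
  exact eq_top_iff.2 fun y _ => (exists_mem_lengthLeOne_pow y).elim fun n hn => h n hn

theorem eq_of_mul_left_eq {M : Type*} [AddCommGroup M] [Module K M]
    {f f' : Alg K S →ₗ[K] M} {F : Alg K S → M → M} (h1 : f 1 = f' 1)
    (hf : ∀ g ∈ generators K S, ∀ x, f (g * x) = F g (f x) - f (tri K S g x))
    (hf' : ∀ g ∈ generators K S, ∀ x, f' (g * x) = F g (f' x) - f' (tri K S g x)) : f = f' := by
  have h : LinearMap.eqLocus f f' = ⊤ := by
    refine eq_top_of_tri_mem h1 fun g hg x hx hx' => ?_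
    rw [LinearMap.mem_eqLocus] at hx hx' ⊢
    rw [hf g hg, hf' g hg, hx, hx']
  exact LinearMap.eqLocus_eq_top.1 h

theorem extendedGrafting_unique {τ : Alg K S →ₗ[K] Module.End K (T K S)}
    (h : IsExtendedGrafting (K := K) (S := S) (tri K S) τ) : τ = act K S := by
  refine LinearMap.ext fun x => LinearMap.ext fun t => ?_
  have hg : ∀ g ∈ generators K S, τ g = act K S g := by
    rintro _ (⟨i, rfl⟩ | ⟨p, rfl⟩)
    · exact (h.X_left i).trans (act_X i).symm
    · exact (h.planted_left p).trans (act_pl p).symm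
  -- On a product gx the recursion uses τ only at g, where it is already identified, and at the
  -- elements x and g ▷ x, which are not longer than x.
  have := eq_of_mul_left_eq (f := τ.flip t) (f' := (act K S).flip t) (F := fun g => act K S g)
    (by
      rw [LinearMap.flip_apply, LinearMap.flip_apply, act_one]
      exact congrArg (fun e : Module.End K (T K S) => e t) h.one_left)
    (fun g hg' x => by
      rw [← hg g hg']
      exact h.mul_left g (mem_lieV_of_mem_generators hg') x t)
    (fun g hg' x => act_mul_of_primitive (comul_of_mem_generators hg') x t)
  exact LinearMap.congr_fun this x

/-- For a primitive left argument, τ is a derivation in the right argument and is fixed by its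
values on generators. The relation for (vx) ▷ u then determines it for every left argument when u ∈
V, and distributivity over products removes the restriction on u. -/
theorem postLie_unique {τ : Alg K S →ₗ[K] Module.End K (Alg K S)}
    (h : IsDeformedPostLie (K := K) (S := S) τ) (h' : IsGuinOudom (K := K) (S := S) τ) :
    τ = tri K S := by
  have hmul : ∀ y z, τ.flip (y * z) = cv (τ.flip y) (τ.flip z) := by
    intro y z
    refine LinearMap.ext fun x => (h'.mul_right x y z).trans ?_
    rw [cv, bconv, Alg.comul_eq]
    rfl
  have h1 : ∀ x, τ x 1 = counit (R := K) x • (1 : Alg K S) := fun x =>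
    (h'.one_right x).trans (by rw [Alg.counit_eq]; rfl)
  have ind : ∀ x : Alg K S, comul (R := K) x = x ⊗ₜ[K] (1 : Alg K S) + 1 ⊗ₜ[K] x →
      (∀ g ∈ generators K S, τ x g = tri K S x g) → ∀ y, τ x y = tri K S x y := by
    intro x hx hg y
    have step : ∀ g ∈ generators K S, ∀ y, τ x y = tri K S x y →
        τ x (g * y) = tri K S x (g * y) := by
      intro g hg' y hy
      have e := LinearMap.congr_fun (hmul g y) x
      rw [cv, bconv_of_comul _ _ _ hx] at e
      have o : ∀ y, τ 1 y = y := h'.one_left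
      simp only [LinearMap.flip_apply, o, LinearMap.mul_apply'] at e
      rw [e, tri_mul_of_primitive hx, hg g hg', hy]
    induction y using Alg.induction with
    | h1 => rw [h1, tri_one_right]
    | hX i y hy => exact step _ (Or.inl ⟨i, rfl⟩) y hy
    | hp p y hy => exact step _ (Or.inr ⟨p, rfl⟩) y hy
    | ha y z hy hz => rw [map_add, map_add, hy, hz]
    | hc c y hy => rw [map_smul, map_smul, hy]
  have hX : ∀ x ∈ Alg.lieV K S, ∀ i, τ x (Alg.X K i) = tri K S x (Alg.X K i) := by
    intro x hx i
    rw [tri_X, Alg.counit_of_mem_lieV hx, zero_smul]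
    exact h.X_right x hx i
  have hgen : ∀ g ∈ generators K S, ∀ y, τ g y = tri K S g y := by
    intro g hg
    refine ind g (comul_of_mem_generators hg) ?_
    rintro _ (⟨i, rfl⟩ | ⟨q, rfl⟩)
    · exact hX g (mem_lieV_of_mem_generators hg) i
    · refine inc_injective ?_
      rcases hg with ⟨i, rfl⟩ | ⟨p, rfl⟩
      · exact (h.X_left i _ (Alg.pl_mem_lieP q)).trans
          (isDeformedPostLie.X_left i _ (Alg.pl_mem_lieP q)).symm
      · exact (h.planted_planted p q).trans (isDeformedPostLie.planted_planted p q).symm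
  have hV : ∀ u ∈ Alg.lieV K S, τ.flip u = (tri K S).flip u := by
    intro u hu
    refine eq_of_mul_left_eq (F := fun g => tri K S g) ?_ ?_ ?_
    · rw [LinearMap.flip_apply, LinearMap.flip_apply, tri_one_left]
      exact h'.one_left u
    · intro g hg x
      rw [← hgen g hg, ← hgen g hg]
      exact h'.mul_left g (mem_lieV_of_mem_generators hg) x u hu
    · exact fun g hg x => tri_mul_left_of_primitive (comul_of_mem_generators hg) x u
  suffices e : ∀ y, τ.flip y = (tri K S).flip y from
    LinearMap.ext fun x => LinearMap.ext fun y => LinearMap.congr_fun (e y) x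
  intro y
  induction y using Alg.induction with
  | h1 => exact LinearMap.ext fun x => (h1 x).trans (tri_one_right x).symm
  | hX i y hy => rw [hmul, tri_mul, hy, hV _ (Alg.X_mem_lieV i)]
  | hp p y hy => rw [hmul, tri_mul, hy, hV _ (Alg.pl_mem_lieV p)]
  | ha y z hy hz => rw [map_add, map_add, hy, hz]
  | hc c y hy => rw [map_smul, map_smul, hy]

end Uniqueness

end

section

open Coalgebra

/-! ### Convolution inverses on connected coalgebras -/

section Antipode

universe u v

variable {K : Type u} [Field K]

section

variable {C : Type*} [AddCommGroup C] [Module K C] {β W : Type*} [Preorder W]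
  [WellFoundedLT W] {B : Type*} [Ring B] [Algebra K B]

theorem lift_eq_of_mem_span (e : Module.Basis β K C) {s : Set β} {g g' : C →ₗ[K] B}
    (f : C →ₗ[K] B) (h : ∀ x ∈ s, g (e x) = g' (e x)) {u : C ⊗[K] C}
    (hu : u ∈ Submodule.span K {u | ∃ x ∈ s, ∃ c : C, u = e x ⊗ₜ[K] c}) :
    TensorProduct.lift ((LinearMap.mul K B).compl₁₂ g f) u =
      TensorProduct.lift ((LinearMap.mul K B).compl₁₂ g' f) u := by
  refine LinearMap.eqOn_span ?_ hu
  rintro _ ⟨x, hx, c, rfl⟩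
  simp [h x hx]

variable [Coalgebra K C]

/-- The map P replaces the right factor z of a tensor by z - ε(z) e_o. It kills the terms with right
factor e_o, and sends the coproduct of c to its difference with c ⊗ e_o by the counit axiom. Hence
the terms ending in e_o need not be identified beforehand. -/
theorem comul_sub_mem_span (e : Module.Basis β K C) {o : β} {s : Set β}
    (hε' : counit (R := K) (e o) = 1) {c : C} (hc : comul (R := K) c ∈
      Submodule.span K {u | ∃ x y, (y = o ∨ x ∈ s) ∧ u = e x ⊗ₜ[K] e y}) :
    comul (R := K) c - c ⊗ₜ[K] e o ∈
      Submodule.span K {u | ∃ x ∈ s, ∃ c : C, u = e x ⊗ₜ[K] c} := by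
  let P : C ⊗[K] C →ₗ[K] C ⊗[K] C := LinearMap.id - (TensorProduct.mk K C C).flip (e o) ∘ₗ
    (TensorProduct.rid K C).toLinearMap ∘ₗ (counit (R := K) (A := C)).lTensor C
  have hP : P (comul c) = comul (R := K) c - c ⊗ₜ[K] e o := by
    simp [P]
  rw [← hP, ← Submodule.mem_comap]
  refine Submodule.span_le.2 ?_ hc
  rintro _ ⟨x, y, hxy, rfl⟩
  rcases hxy with rfl | hx
  · have : P (e x ⊗ₜ[K] e y) = 0 := by simp [P, hε']
    rw [SetLike.mem_coe, Submodule.mem_comap, this]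
    exact zero_mem _
  · have : P (e x ⊗ₜ[K] e y) = e x ⊗ₜ[K] (e y - counit (R := K) (e y) • e o) := by
      simp [P, TensorProduct.tmul_sub, TensorProduct.smul_tmul']
    rw [SetLike.mem_coe, Submodule.mem_comap, this]
    exact Submodule.subset_span ⟨x, hx, _, rfl⟩

/-- In a connected coalgebra, a map which is unital has a left inverse for the convolution. -/
theorem exists_left_convInverse (e : Module.Basis β K C) (o : β) (μ : β → W)
    (ho : comul (R := K) (e o) = e o ⊗ₜ[K] e o) (hε : ∀ b, b ≠ o → counit (R := K) (e b) = 0)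
    (hε' : counit (R := K) (e o) = 1)
    (hΔ : ∀ b, comul (R := K) (e b) ∈
      Submodule.span K {u | ∃ x s, (s = o ∨ μ x < μ b) ∧ u = e x ⊗ₜ[K] e s})
    (f : C →ₗ[K] B) (hf : f (e o) = 1) :
    ∃ g : C →ₗ[K] B, g (e o) = 1 ∧ cv g f = counit.smulRight 1 := by
  classical
  -- The equation (g ∗ f)(e_b) = 0 is solved for g(e_b), whose coefficient is f(e_o) = 1. The
  -- default value 0 is harmless, since only basis elements below b occur in the remaining terms.
  let F : ∀ b, (∀ x, μ x < μ b → B) → B := fun b IH =>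
    if b = o then 1 else -TensorProduct.lift ((LinearMap.mul K B).compl₁₂
      (e.constr K fun x => if h : μ x < μ b then IH x h else 0) f)
        (comul (R := K) (e b) - e b ⊗ₜ[K] e o)
  let G : β → B := (InvImage.wf μ wellFounded_lt).fix F
  have hG : ∀ b, G b = F b fun x _ => G x := fun b => WellFounded.fix_eq _ _ _
  have hGo : G o = 1 := by rw [hG]; exact if_pos rfl
  refine ⟨e.constr K G, by rw [e.constr_basis, hGo], e.ext fun b => ?_⟩
  rw [cv, bconv, LinearMap.comp_apply, LinearMap.smulRight_apply]
  by_cases hb : b = o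
  · rw [hb, ho, hε']
    simp [hGo, hf]
  · have h1 := lift_eq_of_mem_span e (g := e.constr K G)
      (g' := e.constr K fun x => if μ x < μ b then G x else 0) f
      (fun x hx => by rw [e.constr_basis, e.constr_basis]; exact (if_pos hx).symm)
      (comul_sub_mem_span e hε' (hΔ b))
    have h2 : G b = -TensorProduct.lift ((LinearMap.mul K B).compl₁₂ (e.constr K G) f)
        (comul (R := K) (e b) - e b ⊗ₜ[K] e o) := by
      rw [h1, hG]
      exact (if_neg hb).trans (by simp only [dite_eq_ite])
    rw [hε b hb, zero_smul, ← sub_add_cancel (comul (R := K) (e b)) (e b ⊗ₜ[K] e o), map_add]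
    rw [TensorProduct.lift.tmul, LinearMap.compl₁₂_apply, e.constr_basis, h2, hf]
    simp

/-- The left inverse g also takes the value 1 at e_o, so it has a left inverse in turn; by
associativity that left inverse is f. -/
theorem exists_convInverse (e : Module.Basis β K C) (o : β) (μ : β → W)
    (ho : comul (R := K) (e o) = e o ⊗ₜ[K] e o) (hε : ∀ b, b ≠ o → counit (R := K) (e b) = 0)
    (hε' : counit (R := K) (e o) = 1)
    (hΔ : ∀ b, comul (R := K) (e b) ∈
      Submodule.span K {u | ∃ x s, (s = o ∨ μ x < μ b) ∧ u = e x ⊗ₜ[K] e s})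
    (f : C →ₗ[K] B) (hf : f (e o) = 1) :
    ∃ g : C →ₗ[K] B, cv g f = counit.smulRight 1 ∧ cv f g = counit.smulRight 1 := by
  have one_left : ∀ f : C →ₗ[K] B, cv (counit.smulRight 1) f = f := fun f => by
    rw [cv, bconv_counit_left]
    exact LinearMap.ext fun x => by simp
  have one_right : ∀ f : C →ₗ[K] B, cv f (counit.smulRight 1) = f := fun f => by
    rw [cv, bconv_counit_right]
    exact LinearMap.ext fun x => by simp
  obtain ⟨g, hg, hgf⟩ := exists_left_convInverse e o μ ho hε hε' hΔ f hf
  obtain ⟨k, -, hkg⟩ := exists_left_convInverse e o μ ho hε hε' hΔ g hg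
  refine ⟨g, hgf, ?_⟩
  have : k = f := by rw [← one_right k, ← hgf, ← cv_assoc, hkg, one_left]
  rw [← this, hkg]

end

/-- A bialgebra whose underlying coalgebra is connected has an antipode. -/
theorem exists_antipode {H : Type v} [Ring H] [Bialgebra K H] {β W : Type*} [Preorder W]
    [WellFoundedLT W] (e : Module.Basis β K H) (o : β) (μ : β → W) (ho : e o = 1)
    (hε : ∀ b, b ≠ o → counit (R := K) (e b) = 0)
    (hΔ : ∀ b, comul (R := K) (e b) ∈
      Submodule.span K {u | ∃ x s, (s = o ∨ μ x < μ b) ∧ u = e x ⊗ₜ[K] e s}) :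
    ∃ s : H →ₗ[K] H,
      LinearMap.mul' K H ∘ₗ s.rTensor H ∘ₗ comul = Algebra.linearMap K H ∘ₗ counit ∧
      LinearMap.mul' K H ∘ₗ s.lTensor H ∘ₗ comul = Algebra.linearMap K H ∘ₗ counit := by
  -- An antipode is a two-sided convolution inverse of the identity map.
  obtain ⟨s, h, h'⟩ := exists_convInverse e o μ
    (by rw [ho, Bialgebra.comul_one, Algebra.TensorProduct.one_def]) hε
    (by rw [ho, Bialgebra.counit_one]) hΔ LinearMap.id ho
  refine ⟨s, ?_, ?_⟩
  · refine LinearMap.ext fun x => ?_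
    have := LinearMap.congr_fun h x
    rw [bconv_apply _ _ _ (ℛ K x)] at this
    rw [LinearMap.comp_apply, LinearMap.comp_apply, ← (ℛ K x).eq]
    simpa [Algebra.algebraMap_eq_smul_one] using this
  · refine LinearMap.ext fun x => ?_
    have := LinearMap.congr_fun h' x
    rw [bconv_apply _ _ _ (ℛ K x)] at this
    rw [LinearMap.comp_apply, LinearMap.comp_apply, ← (ℛ K x).eq]
    simpa [Algebra.algebraMap_eq_smul_one] using this

end Antipode

/-! ### The Hopf algebra with product ∗ and the deshuffle coproduct -/

section GrossmanLarson

variable {K : Type*} [Field K] {S : TreeData}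

variable (K S) in
/-- The space `𝔗⁺`, with the product `∗₊` and the deshuffle coproduct. -/
def GLAlg : Type _ := Alg K S

instance : AddCommGroup (GLAlg K S) := inferInstanceAs (AddCommGroup (Alg K S))

instance : Module K (GLAlg K S) := inferInstanceAs (Module K (Alg K S))

instance : Ring (GLAlg K S) where
  __ := (inferInstance : AddCommGroup (GLAlg K S))
  mul x y := gl K S x y
  one := (1 : Alg K S)
  left_distrib x y z := map_add (gl K S x) y z
  right_distrib x y z := LinearMap.congr_fun (map_add (gl K S) x y) z
  zero_mul x := LinearMap.congr_fun (map_zero (gl K S)) x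
  mul_zero x := map_zero (gl K S x)
  mul_assoc x y z := LinearMap.congr_fun (gl_assoc x y) z
  one_mul x := LinearMap.congr_fun gl_one_left x
  mul_one x := gl_one_right x

instance : Algebra K (GLAlg K S) :=
  Algebra.ofModule (fun r x y => LinearMap.congr_fun (map_smul (gl K S) r x) y)
    (fun r x y => map_smul (gl K S x) r y)

instance : Coalgebra K (GLAlg K S) := inferInstanceAs (Coalgebra K (Alg K S))

theorem map₂_mul {H : Type*} [Ring H] [Algebra K H] (u v : H ⊗[K] H) :
    TensorProduct.map₂ (LinearMap.mul K H) (LinearMap.mul K H) u v = u * v := by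
  induction u using TensorProduct.induction_on with
  | zero => simp
  | add u u' hu hu' => rw [map_add, LinearMap.add_apply, hu, hu', add_mul]
  | tmul a b =>
    induction v using TensorProduct.induction_on with
    | zero => simp
    | add u u' hu hu' => rw [map_add, hu, hu', mul_add]
    | tmul c d => simp

instance : Bialgebra K (GLAlg K S) :=
  Bialgebra.mk' K (GLAlg K S) (Bialgebra.counit_one (R := K) (A := Alg K S))
    (fun {x y} => counit_gl x y) (Bialgebra.comul_one (R := K) (A := Alg K S))
    (fun {x y} => (comul_gl x y).trans (map₂_mul (H := GLAlg K S) _ _))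

variable (K S) in
/-- The basis of `𝔗⁺` consisting of trees. -/
def treeBasis : Module.Basis (PosTree S) K (Alg K S) :=
  Module.Basis.ofRepr (LinearEquiv.refl K (TPlus K S))

theorem counit_mono {x : PosTree S} (hx : x ≠ (0, [])) :
    counit (R := K) (Alg.mono K x) = 0 := by
  rw [Alg.counit_eq]
  exact Finsupp.single_eq_of_ne hx.symm

/-- The number of letters of a basis element, where the `X^i` are counted too. -/
def PosTree.length (x : PosTree S) : ℕ := x.1.size + x.2.length

theorem IsSplit.length {x y z : PosTree S} (h : IsSplit x y z) :
    x.length = y.length + z.length := by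
  have := sum_of_mem_unshuffles (fun _ => 1) h.2
  simp only [List.map_const', List.sum_replicate, smul_eq_mul, mul_one] at this
  rw [PosTree.length, PosTree.length, PosTree.length, this, ← h.1, MI.size_add]
  omega

theorem PosTree.length_eq_zero {x : PosTree S} : x.length = 0 ↔ x = (0, []) := by
  obtain ⟨m, w⟩ := x
  rw [PosTree.length, Nat.add_eq_zero_iff, MI.size_eq_zero, List.length_eq_zero_iff, Prod.mk.injEq]

/-- Letters are distributed between the two factors, so the left one is strictly shorter unless the
right one is empty. -/
theorem comul_mono_mem_span (b : PosTree S) : comul (R := K) (Alg.mono K b) ∈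
    Submodule.span K {u | ∃ x s : PosTree S, (s = (0, []) ∨ x.length < b.length) ∧
      u = Alg.mono K x ⊗ₜ[K] Alg.mono K s} := by
  rw [Alg.comul_mono]
  refine sum_mem fun l hl => Submodule.smul_mem _ _ (list_sum_mem fun u hu => ?_)
  obtain ⟨q, hq, rfl⟩ := List.mem_map.1 hu
  refine Submodule.subset_span ⟨(l, q.1), (b.1 - l, q.2), ?_, rfl⟩
  have h : IsSplit b (l, q.1) (b.1 - l, q.2) :=
    ⟨add_tsub_cancel_of_le (Finset.mem_Iic.1 hl), hq⟩
  rw [← PosTree.length_eq_zero]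
  have := h.length
  omega

theorem GLAlg.exists_antipode : ∃ s : GLAlg K S →ₗ[K] GLAlg K S,
    LinearMap.mul' K _ ∘ₗ s.rTensor _ ∘ₗ comul = Algebra.linearMap K _ ∘ₗ counit ∧
    LinearMap.mul' K _ ∘ₗ s.lTensor _ ∘ₗ comul = Algebra.linearMap K _ ∘ₗ counit :=
  PlanarRS.exists_antipode (H := GLAlg K S) (treeBasis K S) (0, []) PosTree.length rfl
    (fun _ hb => counit_mono hb) comul_mono_mem_span

instance : HopfAlgebra K (GLAlg K S) where
  antipode := GLAlg.exists_antipode.choose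
  mul_antipode_rTensor_comul := GLAlg.exists_antipode.choose_spec.1
  mul_antipode_lTensor_comul := GLAlg.exists_antipode.choose_spec.2

theorem isHopfAlgebra_gl :
    IsHopfAlgebra (K := K) (A := TPlus K S) (gl K S) (one K S) (deshuffle K S) (eps K S) := by
  refine ⟨GLAlg K S, inferInstance, inferInstance, LinearEquiv.refl K (TPlus K S), fun x y => rfl,
    rfl, fun x => ?_, fun x => ?_⟩
  · refine (LinearMap.congr_fun (Alg.comul_eq (K := K) (S := S)) x).trans ?_
    exact (LinearMap.congr_fun TensorProduct.map_id _).symm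
  · exact LinearMap.congr_fun (Alg.counit_eq (K := K) (S := S)) x

end GrossmanLarson

end

section

open Coalgebra

/-! ### Shuffles and unshuffles as transposes -/

section Shuffles

variable {α : Type*}

open Classical in
theorem count_map_cons (l : List (List α)) (a c : α) (w : List α) :
    (l.map (a :: ·)).count (c :: w) = if a = c then l.count w else 0 := by
  induction l with
  | nil => simp
  | cons v l ih =>
    rw [List.map_cons, List.count_cons, ih, List.count_cons]
    by_cases h : a = c <;> simp [h]

open Classical in
theorem count_nil_map_cons (l : List (List α)) (a : α) : (l.map (a :: ·)).count [] = 0 := by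
  rw [List.count_eq_zero]
  simp

open Classical in
theorem count_map_cons_left (l : List (List α × List α)) (a : α) (u v : List α) :
    (l.map fun q => (a :: q.1, q.2)).count (u, v) =
      (match u with
        | [] => 0
        | b :: u => if b = a then l.count (u, v) else 0) := by
  cases u with
  | nil => rw [List.count_eq_zero]; simp
  | cons b u =>
    induction l with
    | nil => simp
    | cons q l ih =>
      simp only at ih
      rw [List.map_cons, List.count_cons, ih]
      simp only [List.count_cons]
      by_cases h : b = a
      · subst h
        simp [Prod.ext_iff]
      · simp [h, Ne.symm h]

open Classical in
theorem count_map_cons_right (l : List (List α × List α)) (a : α) (u v : List α) :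
    (l.map fun q => (q.1, a :: q.2)).count (u, v) =
      (match v with
        | [] => 0
        | b :: v => if b = a then l.count (u, v) else 0) := by
  cases v with
  | nil => rw [List.count_eq_zero]; simp
  | cons b v =>
    induction l with
    | nil => simp
    | cons q l ih =>
      simp only at ih
      rw [List.map_cons, List.count_cons, ih]
      simp only [List.count_cons]
      by_cases h : b = a
      · subst h
        simp [Prod.ext_iff]
      · simp [h, Ne.symm h]

open Classical in
-- The first letter of w comes from u or from v, and both multiplicities obey the resulting
-- recursion. Multiplicities cannot be replaced by membership, because letters may repeat.
theorem count_shuffles (u v w : List α) :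
    (shuffles u v).count w = (unshuffles w).count (u, v) := by
  induction w generalizing u v with
  | nil =>
    cases u with
    | nil => cases v <;> simp [shuffles, unshuffles]
    | cons a u =>
      cases v with
      | nil => simp [shuffles, unshuffles]
      | cons b v =>
        rw [shuffles, List.count_append, count_nil_map_cons, count_nil_map_cons]
        simp [unshuffles]
  | cons c w ih =>
    rw [unshuffles, List.count_append, count_map_cons_left, count_map_cons_right]
    cases u with
    | nil =>
      cases v with
      | nil => simp [shuffles]
      | cons b v =>
        have := ih [] v
        rw [shuffles] at this ⊢
        simp only [← this]
        by_cases h : b = c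
        · subst h; simp [List.count_cons]
        · simp [h]
    | cons a u =>
      cases v with
      | nil =>
        have := ih u []
        have h' : shuffles u [] = [u] := by cases u <;> simp [shuffles]
        rw [h'] at this
        simp only [← this]
        rw [shuffles]
        by_cases h : a = c
        · subst h; simp [List.count_cons]
        · simp [h]
      | cons b v =>
        rw [shuffles, List.count_append, count_map_cons, count_map_cons, ih, ih]

theorem mem_shuffles {u v w : List α} : w ∈ shuffles u v ↔ (u, v) ∈ unshuffles w := by
  classical
  rw [← List.count_pos_iff, count_shuffles, List.count_pos_iff]

end Shuffles

/-! ### Each tree arises in finitely many products -/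

section Finiteness

variable {K : Type*} [Field K] {S : TreeData}

theorem finite_isSplit (y z : PosTree S) : {x | IsSplit x y z}.Finite := by
  refine ((List.finite_toSet (shuffles y.2 z.2)).image fun w => (y.1 + z.1, w)).subset ?_
  rintro ⟨m, w⟩ ⟨h1, h2⟩
  exact ⟨w, mem_shuffles.2 h2, Prod.ext h1 rfl⟩

/-- This and the next lemmas trace a nonzero coefficient back through linear maps, convolutions and
joins to basis elements; the finiteness proofs then enumerate the possible origins. -/
theorem exists_of_apply_ne_zero {α M : Type*} [AddCommMonoid M] [Module K M]
    (f : (α →₀ K) →ₗ[K] M) (g : M →ₗ[K] K) {v : α →₀ K} (h : g (f v) ≠ 0) :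
    ∃ a, v a ≠ 0 ∧ g (f (Finsupp.single a 1)) ≠ 0 := by
  by_contra! hc
  refine h ?_
  rw [← Finsupp.sum_single v, Finsupp.sum, map_sum, map_sum]
  refine Finset.sum_eq_zero fun a ha => ?_
  rw [← Finsupp.smul_single_one, map_smul, map_smul, hc a (Finsupp.mem_support_iff.1 ha), smul_zero]

theorem exists_of_bconv_ne_zero {M N Q : Type*} [AddCommMonoid M] [Module K M] [AddCommMonoid N]
    [Module K N] [AddCommMonoid Q] [Module K Q] {β : M →ₗ[K] N →ₗ[K] Q} {f : Alg K S →ₗ[K] M}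
    {g : Alg K S →ₗ[K] N} (φ : Q →ₗ[K] K) {x : PosTree S}
    (h : φ (bconv β f g (Alg.mono K x)) ≠ 0) :
    ∃ y z, IsSplit x y z ∧ φ (β (f (Alg.mono K y)) (g (Alg.mono K z))) ≠ 0 := by
  by_contra! hc
  exact h (bconv_mono_mem β f g (LinearMap.ker φ) hc)

theorem exists_of_kerT_ne_zero {i : Fin S.numKernels} {a : MI S} {s u : T K S} {t : Tree S}
    (h : kerT K i a s u t ≠ 0) :
    ∃ τ σ : Tree S, s τ ≠ 0 ∧ u σ ≠ 0 ∧ t = ⟨σ.1, PTree.kernel i a τ.2 σ.2⟩ := by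
  obtain ⟨σ, hσ, h⟩ := exists_of_apply_ne_zero (kerT K i a s) (Finsupp.lapply t) h
  obtain ⟨τ, hτ, h⟩ := exists_of_apply_ne_zero ((kerT K i a).flip (tr K σ.2)) (Finsupp.lapply t) h
  refine ⟨τ, σ, hτ, hσ, ?_⟩
  have e : (kerT K i a).flip (tr K σ.2) (Finsupp.single τ 1) =
      tr K (PTree.kernel i a τ.2 σ.2) := kerT_tr i a τ.2 σ.2
  rw [e] at h
  by_contra hne
  exact h (Finsupp.single_eq_of_ne hne)

theorem exists_of_noiseT_ne_zero {j : Fin S.numNoises} {a m : MI S} {u : T K S} {t : Tree S}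
    (h : noiseT K j a m u t ≠ 0) :
    ∃ σ : PTree S false, u ⟨false, σ⟩ ≠ 0 ∧ t = ⟨true, PTree.noise j a m σ⟩ := by
  obtain ⟨⟨b, σ⟩, hσ, h⟩ := exists_of_apply_ne_zero (noiseT K j a m) (Finsupp.lapply t) h
  cases b with
  | false =>
    refine ⟨σ, hσ, ?_⟩
    rw [tr_eq, noiseT_tr] at h
    by_contra hne
    exact h (Finsupp.single_eq_of_ne hne)
  | true =>
    rw [tr_eq, noiseT_tr_true] at h
    exact absurd (map_zero _) h

theorem exists_of_star_ne_zero {x : PosTree S} {s t : Tree S}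
    (h : star K S (Alg.mono K x) (tr K s.2) t ≠ 0) : ∃ y z u, IsSplit x y z ∧
      act K S (Alg.mono K z) (tr K s.2) u ≠ 0 ∧ dotA K S (Alg.mono K y) (tr K u.2) t ≠ 0 := by
  rw [star_eq] at h
  obtain ⟨y, z, hx, h⟩ := exists_of_bconv_ne_zero (Finsupp.lapply t) h
  obtain ⟨u, hu, h⟩ := exists_of_apply_ne_zero (dotA K S (Alg.mono K y)) (Finsupp.lapply t) h
  exact ⟨y, z, u, hx, hu, h⟩

theorem wt_of_apply_ne_zero {d : ℝ × ℕ} {s : T K S} (hs : s ∈ wtSpan K S d) {t : Tree S}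
    (h : s t ≠ 0) : t.2.wt = d :=
  hs (Finsupp.mem_support_iff.2 h)

theorem wt_of_dotA_ne_zero {y : PosTree S} {u t : Tree S}
    (h : dotA K S (Alg.mono K y) (tr K u.2) t ≠ 0) : t.2.wt = y.wt + u.2.wt :=
  wt_of_apply_ne_zero (dotA_mem_wtSpan y (tr_mem_wtSpan u.2)) h

theorem wt_of_star_ne_zero {y : PosTree S} {u t : Tree S}
    (h : star K S (Alg.mono K y) (tr K u.2) t ≠ 0) : t.2.wt = y.wt + u.2.wt :=
  wt_of_apply_ne_zero (star_mem_wtSpan y (tr_mem_wtSpan u.2)) h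

variable (K) in
theorem finite_dotA_powX (t : Tree S) : {q : MI S × Tree S |
    dotA K S (Alg.powX K q.1) (tr K q.2.2) t ≠ 0}.Finite := by
  refine ((Set.finite_Iic t.2.rootDec).image fun m =>
    (m, (⟨t.1, t.2.mapRoot (fun n => n - m)⟩ : Tree S))).subset ?_
  rintro ⟨m, u⟩ h
  rw [Set.mem_ofPred_eq, dotA_powX, mapRootT_tr] at h
  have e : t = ⟨u.1, u.2.mapRoot fun n => n + m⟩ := by
    by_contra hne
    exact h (Finsupp.single_eq_of_ne hne)
  subst e
  refine ⟨m, ?_, ?_⟩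
  · rw [Set.mem_Iic, PTree.rootDec_mapRoot]
    exact le_add_self
  · simp only [PTree.mapRoot_mapRoot, add_tsub_cancel_right, PTree.mapRoot_id]

variable (K) in
-- The result of a deformed grafting does not reveal ℓ: an edge decoration b may come from any a = b
-- + ℓ. Only the positive regularity of the planted tree bounds ℓ.
theorem finite_dotA_pl (t : Tree S) : {q : Planted S × Tree S |
    dotA K S (Alg.pl K q.1) (tr K q.2.2) t ≠ 0}.Finite := by
  have key : ∀ q : Planted S × Tree S, dotA K S (Alg.pl K q.1) (tr K q.2.2) t ≠ 0 →
      ∃ l ≤ q.1.a, l ≤ q.2.2.rootDec ∧ t = ⟨q.2.1, PTree.kernel q.1.i (q.1.a - l) q.1.τ.2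
        (q.2.2.mapRoot fun n => n - l)⟩ := by
    rintro ⟨p, u⟩ h
    simp only at h ⊢
    rw [dotA_pl, graftRoot_of_mem _ _ _ (tr_mem_rootSpan u.2), Finsupp.finsetSum_apply] at h
    obtain ⟨l, hl, h⟩ := Finset.exists_ne_zero_of_sum_ne_zero h
    rw [Finset.mem_Iic, le_inf_iff] at hl
    refine ⟨l, hl.2, hl.1, ?_⟩
    rw [mapRootT_tr, kerT_tr] at h
    by_contra hne
    refine h ?_
    rw [Finsupp.smul_apply, tr, Finsupp.single_eq_of_ne hne, smul_zero]
  obtain ⟨c, t⟩ := t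
  cases t with
  | vertex m =>
    refine Set.finite_empty.subset ?_
    rintro ⟨p, ⟨c, u⟩⟩ hq
    obtain ⟨l, -, -, h⟩ := key _ hq
    cases h
  | noise j a m σ =>
    refine Set.finite_empty.subset ?_
    rintro ⟨p, ⟨c, u⟩⟩ hq
    obtain ⟨l, -, -, h⟩ := key _ hq
    cases h
  | kernel i b τ σ =>
    let F : MI S → (Fin S.numKernels × MI S × Tree S) × Tree S := fun l =>
      ((i, b + l, ⟨_, τ⟩), ⟨c, σ.mapRoot fun n => n + l⟩)
    let G : Planted S × Tree S → (Fin S.numKernels × MI S × Tree S) × Tree S := fun q =>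
      ((q.1.i, q.1.a, q.1.τ), q.2)
    have hG : Function.Injective G := by
      rintro ⟨p, u⟩ ⟨p', u'⟩ h
      simp only [G, Prod.mk.injEq] at h
      exact Prod.ext (Planted.ext h.1.1 h.1.2.1 h.1.2.2) h.2
    -- Positivity reads |a| < |G_i| + |τ|, and ℓ ≤ a; this is the origin of the bound on |ℓ|.
    refine Set.Finite.subset (Set.Finite.preimage hG.injOn
      ((MI.finite_size_le ⌈S.kernelReg i + τ.reg⌉₊).image F)) ?_
    rintro ⟨⟨i', a, τ', hp⟩, u⟩ hq
    obtain ⟨l, hl, hl', h⟩ := key _ hq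
    obtain ⟨bτ, τ'⟩ := τ'
    obtain ⟨c', u⟩ := u
    simp only at hl hl' h
    cases h
    refine ⟨l, ?_, ?_⟩
    · simp only at hp
      have h1 : l.size ≤ a.size := MI.size_mono hl
      have h2 : (a.size : ℝ) ≤ ⌈S.kernelReg i + τ.reg⌉₊ :=
        le_trans (by linarith) (Nat.le_ceil _)
      exact h1.trans (by exact_mod_cast h2)
    · simp only [F, G, PTree.mapRoot_sub_add _ hl', tsub_add_cancel_of_le hl]

theorem edges_lt_of_dotA_pl_ne_zero {p : Planted S} {u t : Tree S}
    (h : dotA K S (Alg.pl K p) (tr K u.2) t ≠ 0) : u.2.edges < t.2.edges := by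
  have h1 := congrArg Prod.snd (wt_of_dotA_ne_zero (y := (0, [p])) h)
  have h2 : (PosTree.wt ((0, [p]) : PosTree S)).2 = 1 + p.τ.2.edges := by
    simp [PosTree.wt, Planted.wt, PTree.edgeWt, PTree.wt]
  rw [Prod.snd_add, h2] at h1
  change t.2.edges = _ + u.2.edges at h1
  omega

variable (K) in
-- Every letter contributes at least one edge, so the word can be peeled off letter by letter with
-- the number of edges as induction variable.
theorem finite_dotA_word (n : ℕ) (t : Tree S) (ht : t.2.edges ≤ n) :
    {q : List (Planted S) × Tree S |
      dotA K S (Alg.mono K (0, q.1)) (tr K q.2.2) t ≠ 0}.Finite := by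
  induction n generalizing t with
  | zero =>
    refine (Set.finite_singleton (([], t) : List (Planted S) × Tree S)).subset ?_
    rintro ⟨w, u⟩ h
    cases w with
    | nil =>
      rw [Set.mem_ofPred_eq, Alg.mono_zero, map_one, Module.End.one_apply] at h
      have : t = u := by
        by_contra hne
        exact h (Finsupp.single_eq_of_ne hne)
      rw [this]
      rfl
    | cons p w =>
      rw [Set.mem_ofPred_eq, ← Alg.pl_mul_mono, map_mul, Module.End.mul_apply] at h
      obtain ⟨v, -, hv⟩ := exists_of_apply_ne_zero (dotA K S (Alg.pl K p)) (Finsupp.lapply t) h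
      have := edges_lt_of_dotA_pl_ne_zero (p := p) (u := v) hv
      omega
  | succ n ih =>
    refine ((Set.finite_singleton (([], t) : List (Planted S) × Tree S)).union
      ((finite_dotA_pl K t).biUnion' (t := fun q hq => (fun r : List (Planted S) × Tree S =>
        (q.1 :: r.1, r.2)) '' {r : List (Planted S) × Tree S |
          dotA K S (Alg.mono K (0, r.1)) (tr K r.2.2) q.2 ≠ 0})
        fun q hq => (ih q.2 ?_).image _)).subset ?_
    · have := edges_lt_of_dotA_pl_ne_zero (p := q.1) (u := q.2) hq
      omega
    · rintro ⟨w, u⟩ h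
      cases w with
      | nil =>
        rw [Set.mem_ofPred_eq, Alg.mono_zero, map_one, Module.End.one_apply] at h
        have : t = u := by
          by_contra hne
          exact h (Finsupp.single_eq_of_ne hne)
        rw [this]
        exact Or.inl rfl
      | cons p w =>
        rw [Set.mem_ofPred_eq, ← Alg.pl_mul_mono, map_mul, Module.End.mul_apply] at h
        obtain ⟨v, hv', hv⟩ :=
          exists_of_apply_ne_zero (dotA K S (Alg.pl K p)) (Finsupp.lapply t) h
        refine Or.inr (Set.mem_iUnion₂.2 ⟨(p, v), hv, (w, u), hv', rfl⟩)

variable (K) in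
theorem finite_dotA (t : Tree S) : {q : PosTree S × Tree S |
    dotA K S (Alg.mono K q.1) (tr K q.2.2) t ≠ 0}.Finite := by
  refine ((finite_dotA_powX K t).biUnion (t := fun q => (fun r : List (Planted S) × Tree S =>
    (((q.1, r.1), r.2) : PosTree S × Tree S)) '' {r : List (Planted S) × Tree S |
      dotA K S (Alg.mono K (0, r.1)) (tr K r.2.2) q.2 ≠ 0})
    fun q _ => (finite_dotA_word K _ q.2 le_rfl).image _).subset ?_
  rintro ⟨⟨m, w⟩, u⟩ h
  rw [Set.mem_ofPred_eq, Alg.mono_eq, map_mul, Module.End.mul_apply] at h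
  obtain ⟨v, hv', hv⟩ := exists_of_apply_ne_zero (dotA K S (Alg.powX K m)) (Finsupp.lapply t) h
  exact Set.mem_iUnion₂.2 ⟨(m, v), hv, (w, u), hv', rfl⟩

/-- Finitely many (y, u) have t in y · u; such a u has no more edges than t, hence lies in z ▷ s for
finitely many (z, s); and y and z can be shuffled in finitely many ways. -/
theorem finite_star_of_finite_act {t : Tree S} (h : ∀ u : Tree S, u.2.edges ≤ t.2.edges →
    {q : PosTree S × Tree S | act K S (Alg.mono K q.1) (tr K q.2.2) u ≠ 0}.Finite) :
    {q : PosTree S × Tree S | star K S (Alg.mono K q.1) (tr K q.2.2) t ≠ 0}.Finite := by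
  refine ((finite_dotA K t).biUnion' (t := fun q _ => ⋃ r ∈ {r : PosTree S × Tree S |
    act K S (Alg.mono K r.1) (tr K r.2.2) q.2 ≠ 0},
      (fun x => (x, r.2)) '' {x | IsSplit x q.1 r.1})
    fun q hq => (h q.2 ?_).biUnion fun r _ => (finite_isSplit _ _).image _).subset ?_
  · have := congrArg Prod.snd (wt_of_dotA_ne_zero hq)
    change t.2.edges = _ + q.2.2.edges at this
    omega
  · rintro ⟨x, s⟩ hx
    obtain ⟨y, z, u, hs, h1, h2⟩ := exists_of_star_ne_zero hx
    exact Set.mem_iUnion₂.2 ⟨(y, u), h2, Set.mem_iUnion₂.2 ⟨(z, s), h1, x, hs, rfl⟩⟩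

variable (K) in
-- Grafting leaves the leftmost root edge of s in place with its decoration, so that edge is read
-- off from u. The parts into which it cuts u have fewer edges, and induction applies to each.
theorem finite_act (n : ℕ) (u : Tree S) (hu : u.2.edges ≤ n) :
    {q : PosTree S × Tree S | act K S (Alg.mono K q.1) (tr K q.2.2) u ≠ 0}.Finite := by
  induction n using Nat.strong_induction_on generalizing u with
  | _ n ih =>
  obtain ⟨c, u⟩ := u
  cases u with
  | vertex m =>
    refine (Set.finite_singleton (((0, []), ⟨false, PTree.vertex m⟩) : PosTree S × Tree S)).subset ?_
    rintro ⟨x, ⟨b, s⟩⟩ h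
    simp only [Set.mem_ofPred_eq] at h
    cases s with
    | vertex m' =>
      rw [act_vertex] at h
      have hx : x = (0, []) := by
        by_contra hne
        rw [counit_mono hne] at h
        simp at h
      have : (⟨false, PTree.vertex m⟩ : Tree S) = ⟨false, PTree.vertex m'⟩ := by
        by_contra hne
        rw [Finsupp.smul_apply, tr, Finsupp.single_eq_of_ne hne, smul_zero] at h
        exact h rfl
      rw [this, hx]
      rfl
    | kernel i a τ σ =>
      rw [← kerT_tr, act_kerT_eq] at h
      obtain ⟨y, z, -, h⟩ := exists_of_bconv_ne_zero (Finsupp.lapply _) h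
      obtain ⟨⟨_, τ'⟩, ⟨_, σ'⟩, -, -, h⟩ := exists_of_kerT_ne_zero h
      cases h
    | noise j a m σ =>
      rw [← noiseT_tr, act_noiseT] at h
      obtain ⟨σ', -, h⟩ := exists_of_noiseT_ne_zero h
      cases h
  | kernel i a τ σ =>
    change 1 + τ.edges + σ.edges ≤ n at hu
    refine ((finite_star_of_finite_act (K := K) (t := ⟨_, τ⟩) fun u hu' =>
      ih τ.edges (by omega) u hu').biUnion
        (t := fun q => ⋃ r ∈ {r : PosTree S × Tree S |
          act K S (Alg.mono K r.1) (tr K r.2.2) ⟨c, σ⟩ ≠ 0},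
            (fun x => (x, (⟨r.2.1, PTree.kernel i a q.2.2 r.2.2⟩ : Tree S))) ''
              {x | IsSplit x q.1 r.1}) fun q hq => (ih σ.edges (by omega) ⟨c, σ⟩ le_rfl).biUnion
                fun r _ => (finite_isSplit _ _).image _).subset ?_
    rintro ⟨x, ⟨b, s⟩⟩ h
    simp only [Set.mem_ofPred_eq] at h
    cases s with
    | vertex m' =>
      rw [act_vertex] at h
      refine absurd ?_ h
      rw [Finsupp.smul_apply, tr, Finsupp.single_eq_of_ne, smul_zero]
      intro h
      cases h
    | kernel i' a' τ' σ' =>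
      rw [← kerT_tr, act_kerT_eq] at h
      obtain ⟨y, z, hx, h⟩ := exists_of_bconv_ne_zero (Finsupp.lapply _) h
      obtain ⟨⟨_, τ''⟩, ⟨_, σ''⟩, h1, h2, h⟩ := exists_of_kerT_ne_zero h
      cases h
      exact Set.mem_iUnion₂.2 ⟨(y, ⟨_, τ'⟩), h1, Set.mem_iUnion₂.2 ⟨(z, ⟨_, σ'⟩), h2, x, hx, rfl⟩⟩
    | noise j a m σ =>
      rw [← noiseT_tr, act_noiseT] at h
      obtain ⟨σ', -, h⟩ := exists_of_noiseT_ne_zero h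
      cases h
  | noise j a m σ =>
    change 1 + σ.edges ≤ n at hu
    refine ((ih σ.edges (by omega) ⟨false, σ⟩ le_rfl).biUnion
      (t := fun r => {q : PosTree S × Tree S | ∃ σ' : PTree S false, r.2 = ⟨false, σ'⟩ ∧
        q = (r.1, ⟨true, PTree.noise j a m σ'⟩)}) fun r _ => ?_).subset ?_
    · refine Set.Subsingleton.finite ?_
      rintro _ ⟨σ₁, h1, rfl⟩ _ ⟨σ₂, h2, rfl⟩
      rw [h1] at h2
      cases h2
      rfl
    · rintro ⟨x, ⟨b, s⟩⟩ h
      simp only [Set.mem_ofPred_eq] at h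
      cases s with
      | vertex m' =>
        rw [act_vertex] at h
        refine absurd ?_ h
        rw [Finsupp.smul_apply, tr, Finsupp.single_eq_of_ne, smul_zero]
        intro h
        cases h
      | kernel i' a' τ' σ' =>
        rw [← kerT_tr, act_kerT_eq] at h
        obtain ⟨y, z, hx, h⟩ := exists_of_bconv_ne_zero (Finsupp.lapply _) h
        obtain ⟨⟨_, τ''⟩, ⟨_, σ''⟩, h1, h2, h⟩ := exists_of_kerT_ne_zero h
        cases h
      | noise j' a' m' σ' =>
        rw [← noiseT_tr, act_noiseT] at h
        obtain ⟨σ'', h1, h⟩ := exists_of_noiseT_ne_zero h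
        cases h
        exact Set.mem_iUnion₂.2 ⟨(x, ⟨_, σ'⟩), h1, σ', rfl, rfl⟩

variable (K) in
theorem finite_star (t : Tree S) :
    {q : PosTree S × Tree S | star K S (Alg.mono K q.1) (tr K q.2.2) t ≠ 0}.Finite :=
  finite_star_of_finite_act fun u _ => finite_act K _ u le_rfl

variable (K) in
/-- The coefficient of a tree in an element of `𝔗⁺`. -/
def Alg.coeff (x : PosTree S) : Alg K S →ₗ[K] K := Finsupp.lapply x

theorem inc_apply_toTree (y : Alg K S) (x : PosTree S) :
    inc K S y x.toTree = Alg.coeff K x y :=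
  Finsupp.mapDomain_apply PosTree.toTree_injective y x

theorem coeff_gl (x s t : PosTree S) :
    Alg.coeff K t (gl K S (Alg.mono K x) (Alg.mono K s)) =
      star K S (Alg.mono K x) (tr K s.toTree.2) t.toTree := by
  have h : inc K S (Alg.mono K s) = tr K s.toTree.2 := inc_mono s.1 s.2
  rw [← inc_apply_toTree, inc_gl, h]

variable (K) in
theorem finite_gl (t : PosTree S) : {q : PosTree S × PosTree S |
    Alg.coeff K t (gl K S (Alg.mono K q.1) (Alg.mono K q.2)) ≠ 0}.Finite := by
  have hinj : Function.Injective fun q : PosTree S × PosTree S => (q.1, q.2.toTree) := by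
    rintro ⟨x, s⟩ ⟨x', s'⟩ h
    simp only [Prod.mk.injEq] at h
    exact Prod.ext h.1 (PosTree.toTree_injective h.2)
  refine ((finite_star K t.toTree).preimage hinj.injOn).subset fun q hq => ?_
  rw [Set.mem_ofPred_eq, coeff_gl] at hq
  exact hq

/-- Finiteness says that the transposed coefficients have finite support in (x, s), so they define
an element of the algebraic tensor product. -/
theorem exists_isDualTo {α β : Type*} (μ : (α →₀ K) →ₗ[K] Module.End K (β →₀ K))
    (h : ∀ t, {q : α × β | μ (Finsupp.single q.1 1) (Finsupp.single q.2 1) t ≠ 0}.Finite) :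
    ∃ δ, IsDualTo δ μ := by
  refine ⟨Finsupp.linearCombination K fun t => (finsuppTensorFinsupp' K α β).symm
    (Finsupp.ofSupportFinite (fun q : α × β =>
      μ (Finsupp.single q.1 1) (Finsupp.single q.2 1) t) (h t)), fun x s t => ?_⟩
  rw [Finsupp.linearCombination_single, one_smul, LinearEquiv.apply_symm_apply]
  rfl

end Finiteness

end

section

open Coalgebra

/-! ### Duality for the orthonormal pairing -/

section Pairing

variable {K : Type*} [Field K] {α β γ : Type*}

variable (K α) in
/-- The pairing for which the basis elements are orthonormal. -/
def pair : (α →₀ K) →ₗ[K] (α →₀ K) →ₗ[K] K :=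
  Finsupp.linearCombination K fun a => Finsupp.lapply a

theorem pair_single (a : α) : pair K α (Finsupp.single a 1) = Finsupp.lapply a := by
  simp [pair]

theorem pair_single_single (a b : α) [Decidable (a = b)] :
    pair K α (Finsupp.single a 1) (Finsupp.single b 1) = if a = b then 1 else 0 := by
  classical
  rw [pair_single, Finsupp.lapply_apply, Finsupp.single_apply]
  simp only [eq_comm]

theorem pair_comm (x y : α →₀ K) : pair K α x y = pair K α y x := by
  classical
  have h : pair K α = (pair K α).flip := by
    refine Finsupp.lhom_ext' fun a => LinearMap.ext_ring ?_
    refine Finsupp.lhom_ext' fun b => LinearMap.ext_ring ?_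
    change pair K α (Finsupp.single a 1) (Finsupp.single b 1) =
      pair K α (Finsupp.single b 1) (Finsupp.single a 1)
    rw [pair_single_single, pair_single_single]
    simp only [eq_comm]
  exact LinearMap.congr_fun₂ h x y

theorem eq_of_pair_eq {y z : α →₀ K} (h : ∀ x, pair K α x y = pair K α x z) : y = z := by
  ext a
  have := h (Finsupp.single a 1)
  rwa [pair_single] at this

variable (K) in
/-- The contraction of a tensor by a pair of linear forms. -/
def contract {M N P : Type*} [AddCommMonoid M] [Module K M] [AddCommMonoid N] [Module K N]
    [AddCommMonoid P] [Module K P] (f : M →ₗ[K] K) (g : N →ₗ[K] P) : M ⊗[K] N →ₗ[K] P :=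
  (TensorProduct.lid K P).toLinearMap ∘ₗ TensorProduct.map f g

section

variable {M N P Q : Type*} [AddCommMonoid M] [Module K M] [AddCommMonoid N] [Module K N]
  [AddCommMonoid P] [Module K P] [AddCommMonoid Q] [Module K Q]

theorem contract_tmul (f : M →ₗ[K] K) (g : N →ₗ[K] P) (m : M) (n : N) :
    contract K f g (m ⊗ₜ n) = f m • g n := by
  simp [contract]

theorem comp_contract (h : P →ₗ[K] Q) (f : M →ₗ[K] K) (g : N →ₗ[K] P) :
    h ∘ₗ contract K f g = contract K f (h ∘ₗ g) :=
  TensorProduct.ext' fun m n => by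
    rw [LinearMap.comp_apply, contract_tmul, contract_tmul, map_smul, LinearMap.comp_apply]

theorem contract_comp_lTensor (f : M →ₗ[K] K) (g : N →ₗ[K] P) (h : Q →ₗ[K] N) :
    contract K f g ∘ₗ h.lTensor M = contract K f (g ∘ₗ h) :=
  TensorProduct.ext' fun m n => by
    rw [LinearMap.comp_apply, LinearMap.lTensor_tmul, contract_tmul, contract_tmul,
      LinearMap.comp_apply]

theorem contract_comp_rTensor (f : M →ₗ[K] K) (g : N →ₗ[K] P) (h : Q →ₗ[K] M) :
    contract K f g ∘ₗ h.rTensor N = contract K (f ∘ₗ h) g :=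
  TensorProduct.ext' fun m n => by
    rw [LinearMap.comp_apply, LinearMap.rTensor_tmul, contract_tmul, contract_tmul,
      LinearMap.comp_apply]

theorem contract_contract_assoc (f : M →ₗ[K] K) (g : N →ₗ[K] K) (h : P →ₗ[K] Q) :
    contract K f (contract K g h) ∘ₗ (TensorProduct.assoc K M N P).toLinearMap =
      contract K (contract K f g) h :=
  TensorProduct.ext_threefold fun m n p => by
    rw [LinearMap.comp_apply, LinearEquiv.coe_coe, TensorProduct.assoc_tmul, contract_tmul,
      contract_tmul, contract_tmul, contract_tmul, smul_smul, smul_eq_mul]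

theorem eq_of_contract_eq {u v : (α →₀ K) ⊗[K] M}
    (h : ∀ x, contract K (pair K α x) LinearMap.id u = contract K (pair K α x) LinearMap.id v) :
    u = v := by
  classical
  refine (TensorProduct.finsuppScalarLeft K M α).injective (Finsupp.ext fun a => ?_)
  have e : contract K (pair K α (Finsupp.single a 1)) LinearMap.id = (Finsupp.lapply a) ∘ₗ
      (TensorProduct.finsuppScalarLeft K M α).toLinearMap :=
    TensorProduct.ext' fun x m => by
      rw [contract_tmul, pair_single]
      simp [TensorProduct.finsuppScalarLeft_apply_tmul_apply]
  have := h (Finsupp.single a 1)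
  rw [e] at this
  exact this

theorem eq_of_contract_pair_eq {u v : (α →₀ K) ⊗[K] (β →₀ K)}
    (h : ∀ x y, contract K (pair K α x) (pair K β y) u = contract K (pair K α x) (pair K β y) v) :
    u = v := by
  refine eq_of_contract_eq fun x => eq_of_pair_eq fun y => ?_
  rw [← LinearMap.comp_apply, ← LinearMap.comp_apply, comp_contract, LinearMap.comp_id]
  exact h x y

end

theorem finsuppTensorFinsupp'_eq_contract (u : (α →₀ K) ⊗[K] (β →₀ K)) (a : α) (b : β) :
    finsuppTensorFinsupp' K α β u (a, b) =
      contract K (pair K α (Finsupp.single a 1)) (pair K β (Finsupp.single b 1)) u := by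
  induction u using TensorProduct.induction_on with
  | zero => simp
  | add u v hu hv => rw [map_add, map_add, Finsupp.add_apply, hu, hv]
  | tmul x y => simp [contract_tmul, pair_single]

theorem IsDualTo.contract_eq {δ : (β →₀ K) →ₗ[K] (α →₀ K) ⊗[K] (β →₀ K)}
    {μ : (α →₀ K) →ₗ[K] Module.End K (β →₀ K)} (h : IsDualTo δ μ) (x : α →₀ K) (s : β →₀ K) :
    contract K (pair K α x) (pair K β s) ∘ₗ δ = pair K β (μ x s) := by
  refine Finsupp.lhom_ext' fun t => LinearMap.ext_ring ?_
  change contract K (pair K α x) (pair K β s) (δ (Finsupp.single t 1)) =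
    pair K β (μ x s) (Finsupp.single t 1)
  rw [pair_comm, pair_single, Finsupp.lapply_apply]
  induction x using Finsupp.induction_linear with
  | zero => simp [contract]
  | add x y hx hy =>
    rw [map_add, map_add, LinearMap.add_apply, Finsupp.add_apply, ← hx, ← hy]
    simp [contract, TensorProduct.map_add_left]
  | single a r =>
    induction s using Finsupp.induction_linear with
    | zero => simp [contract]
    | add x y hx hy =>
      rw [map_add, map_add, Finsupp.add_apply, ← hx, ← hy]
      simp [contract, TensorProduct.map_add_right]
    | single b r' =>
      rw [← Finsupp.smul_single_one a, ← Finsupp.smul_single_one b]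
      simp only [map_smul, LinearMap.smul_apply, Finsupp.smul_apply]
      rw [← h, finsuppTensorFinsupp'_eq_contract]
      simp [contract, TensorProduct.map_smul_left, TensorProduct.map_smul_right]

/-- Tested against x ⊗ y ⊗ s, the two sides are the pairings with μ(m x y) s and μ x (μ y s). The
case μ = m gives coassociativity, the general case the coaction law. -/
theorem IsDualTo.assoc {Δ : (α →₀ K) →ₗ[K] (α →₀ K) ⊗[K] (α →₀ K)}
    {δ : (β →₀ K) →ₗ[K] (α →₀ K) ⊗[K] (β →₀ K)} {m : (α →₀ K) →ₗ[K] Module.End K (α →₀ K)}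
    {μ : (α →₀ K) →ₗ[K] Module.End K (β →₀ K)} (hΔ : IsDualTo Δ m) (hδ : IsDualTo δ μ)
    (h : ∀ x y, μ (m x y) = μ x * μ y) :
    (TensorProduct.assoc K _ _ _).toLinearMap ∘ₗ Δ.rTensor _ ∘ₗ δ = δ.lTensor _ ∘ₗ δ := by
  refine LinearMap.ext fun t => eq_of_contract_eq fun x => eq_of_contract_pair_eq fun y s => ?_
  have e := comp_contract (M := α →₀ K) (contract K (pair K α y) (pair K β s)) (pair K α x)
    (LinearMap.id (R := K) (M := (α →₀ K) ⊗[K] (β →₀ K)))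
  rw [← LinearMap.comp_apply, ← LinearMap.comp_apply (contract K _ _), e, LinearMap.comp_id,
    ← LinearMap.comp_apply, ← LinearMap.comp_apply]
  congr 1
  rw [← LinearMap.comp_assoc, contract_contract_assoc, ← LinearMap.comp_assoc,
    contract_comp_rTensor, hΔ.contract_eq, hδ.contract_eq, ← LinearMap.comp_assoc,
    contract_comp_lTensor, hδ.contract_eq, hδ.contract_eq, h]
  rfl

theorem IsDualTo.contract_one {δ : (β →₀ K) →ₗ[K] (α →₀ K) ⊗[K] (β →₀ K)}
    {μ : (α →₀ K) →ₗ[K] Module.End K (β →₀ K)} (hδ : IsDualTo δ μ) {e : α →₀ K} (h : μ e = 1) :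
    contract K (pair K α e) LinearMap.id ∘ₗ δ = LinearMap.id := by
  refine LinearMap.ext fun t => eq_of_pair_eq fun s => ?_
  rw [← LinearMap.comp_apply, ← LinearMap.comp_assoc, comp_contract, LinearMap.comp_id,
    hδ.contract_eq, h]
  rfl

end Pairing

/-! ### The shuffle product is dual to the deshuffle coproduct -/

section ShuffleDual

variable {K : Type*} [Field K] {S : TreeData}

theorem sum_map_single_apply {ι γ : Type*} [BEq γ] [LawfulBEq γ] (f : ι → γ) (l : List ι) (c : γ) :
    ((l.map fun i => (Finsupp.single (f i) (1 : K))).sum) c = ((l.map f).count c : K) := by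
  classical
  induction l with
  | nil => simp
  | cons a l ih =>
    rw [List.map_cons, List.sum_cons, Finsupp.add_apply, ih, List.map_cons, List.count_cons,
      Finsupp.single_apply]
    by_cases h : f a = c <;> simp [h, add_comm]

/-- Comparing coefficients, only the splitting l = m of the exponent can contribute, with the same
binomial on both sides; on words the identity is `count_shuffles`. -/
theorem isDualTo_deshuffle_shuffle : IsDualTo (deshuffle K S) (shuffle K S) := by
  classical
  intro x s t
  have hL : finsuppTensorFinsupp' K _ _ (deshuffle K S (Finsupp.single t 1)) =
      ∑ l ∈ Finset.Iic t.1, ((t.1.choose l : ℕ) : K) • ((unshuffles t.2).map fun q =>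
        (Finsupp.single (((l, q.1), (t.1 - l, q.2)) : PosTree S × PosTree S) (1 : K))).sum := by
    rw [deshuffle, Finsupp.linearCombination_single, one_smul, map_sum]
    refine Finset.sum_congr rfl fun l _ => ?_
    rw [map_smul, map_list_sum, List.map_map]
    congr 3
    funext q
    simp
  have hR : shuffle K S (Finsupp.single x 1) (Finsupp.single s 1) =
      (((x.1 + s.1).choose x.1 : ℕ) : K) • ((shuffles x.2 s.2).map fun w =>
        (Finsupp.single ((x.1 + s.1, w) : PosTree S) (1 : K))).sum := by
    rw [shuffle, Finsupp.linearCombination_single, one_smul, Finsupp.linearCombination_single,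
      one_smul]
  rw [hL, hR, Finsupp.finsetSum_apply, Finsupp.smul_apply, sum_map_single_apply]
  simp only [Finsupp.smul_apply, sum_map_single_apply]
  obtain ⟨m, u⟩ := x
  obtain ⟨n, v⟩ := s
  obtain ⟨k, w⟩ := t
  have hc : ∀ (l k : MI S), (List.map (fun q : List (Planted S) × List (Planted S) =>
      (((l, q.1), (k, q.2)) : PosTree S × PosTree S)) (unshuffles w)).count ((m, u), (n, v)) =
      if l = m ∧ k = n then (unshuffles w).count (u, v) else 0 := by
    intro l k
    split_ifs with h
    · rw [h.1, h.2]
      exact List.count_map_of_injective _ (fun q : List (Planted S) × List (Planted S) =>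
        (((m, q.1), (n, q.2)) : PosTree S × PosTree S))
        (fun q q' h => by simpa [Prod.ext_iff] using h) (u, v)
    · rw [List.count_eq_zero]
      intro hm
      obtain ⟨q, -, hq⟩ := List.mem_map.1 hm
      simp only [Prod.mk.injEq] at hq
      exact h ⟨hq.1.1, hq.2.1⟩
  have hd : (List.map (fun w : List (Planted S) => ((m + n, w) : PosTree S))
      (shuffles u v)).count (k, w) = if m + n = k then (shuffles u v).count w else 0 := by
    split_ifs with h
    · rw [h]
      exact List.count_map_of_injective _ (fun w : List (Planted S) => ((k, w) : PosTree S))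
        (fun q q' h => by simpa using h) w
    · rw [List.count_eq_zero]
      intro hm
      obtain ⟨q, -, hq⟩ := List.mem_map.1 hm
      simp only [Prod.mk.injEq] at hq
      exact h hq.1
  simp only [hc, hd, count_shuffles]
  by_cases h : m + n = k
  · subst h
    rw [Finset.sum_eq_single m]
    · simp
    · intro l _ hl
      simp [hl]
    · intro h
      exact absurd (Finset.mem_Iic.2 le_self_add) h
  · rw [if_neg h, Nat.cast_zero, smul_zero]
    refine Finset.sum_eq_zero fun l hl => ?_
    rw [if_neg, Nat.cast_zero, smul_zero]
    rintro ⟨rfl, rfl⟩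
    exact h (add_tsub_cancel_of_le (Finset.mem_Iic.1 hl))

end ShuffleDual

end

section

open Coalgebra

variable {K : Type*} [Field K] {S : TreeData}

/-! ### The coproduct, the coaction and the shuffle algebra -/

section DualAlgebra

variable (K S) in
/-- The coproduct dual to `∗₊`. -/
def cop : TPlus K S →ₗ[K] TPlus K S ⊗[K] TPlus K S :=
  (exists_isDualTo (K := K) (α := PosTree S) (β := PosTree S) (gl K S) (finite_gl K)).choose

theorem isDualTo_cop : IsDualTo (cop K S) (gl K S) :=
  (exists_isDualTo (K := K) (α := PosTree S) (β := PosTree S) (gl K S) (finite_gl K)).choose_spec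

variable (K S) in
/-- The coaction dual to the action of `(𝔗⁺, ∗₊)` on `𝔗`. -/
def coact : T K S →ₗ[K] TPlus K S ⊗[K] T K S :=
  (exists_isDualTo (K := K) (α := PosTree S) (β := Tree S) (star K S) (finite_star K)).choose

theorem isDualTo_coact : IsDualTo (coact K S) (star K S) :=
  (exists_isDualTo (K := K) (α := PosTree S) (β := Tree S) (star K S) (finite_star K)).choose_spec

/-- An element of `𝔗⁺`, as a linear form on `𝔗⁺`. -/
def form : TPlus K S →ₗ[K] Alg K S →ₗ[K] K := pair K (PosTree S)

theorem form_injective : Function.Injective (form (K := K) (S := S)) := by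
  intro x y h
  refine eq_of_pair_eq fun z => ?_
  rw [pair_comm z, pair_comm z]
  exact LinearMap.congr_fun h z

theorem pair_eq_form (x : Alg K S) (y : TPlus K S) : pair K (PosTree S) x y = form y x :=
  pair_comm _ _

theorem contract_eq_lift (f g : Alg K S →ₗ[K] K) :
    contract K f g = TensorProduct.lift ((LinearMap.mul K K).compl₁₂ f g) :=
  TensorProduct.ext' fun x y => by
    rw [contract_tmul, TensorProduct.lift.tmul, LinearMap.compl₁₂_apply, LinearMap.mul_apply',
      smul_eq_mul]

/-- Under the pairing, the shuffle is the convolution of linear forms on the deshuffle coalgebra.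
Its associativity, commutativity and unit are therefore coassociativity, cocommutativity and counit
of that coalgebra. -/
theorem form_shuffle (x y : TPlus K S) : form (shuffle K S x y) = cv (form x) (form y) := by
  have h := isDualTo_deshuffle_shuffle.contract_eq x y
  rw [← Alg.comul_eq] at h
  exact h.symm.trans (congrArg (· ∘ₗ comul) (contract_eq_lift (form x) (form y)))

theorem form_one : form (one K S) = (counit : Alg K S →ₗ[K] K) := by
  rw [Alg.counit_eq]
  exact pair_single _

theorem form_one' : form (one K S) = (counit : Alg K S →ₗ[K] K).smulRight 1 := by
  rw [form_one]
  exact LinearMap.ext fun x => by simp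

theorem eps_eq_pair : eps K S = pair K (PosTree S) (one K S) := (pair_single _).symm

theorem shuffle_comm (x y : TPlus K S) : shuffle K S x y = shuffle K S y x := by
  refine form_injective ?_
  rw [form_shuffle, form_shuffle, cv_comm fun _ _ => Commute.all _ _]

theorem shuffle_assoc (x y z : TPlus K S) :
    shuffle K S (shuffle K S x y) z = shuffle K S x (shuffle K S y z) := by
  refine form_injective ?_
  rw [form_shuffle, form_shuffle, form_shuffle, form_shuffle, cv_assoc]

theorem one_shuffle (x : TPlus K S) : shuffle K S (one K S) x = x := by
  refine form_injective ?_
  rw [form_shuffle, form_one', cv_one_left]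

variable (K S) in
/-- The space `𝔗⁺`, with the shuffle product and the coproduct dual to `∗₊`. -/
def HPlus : Type _ := TPlus K S

instance : AddCommGroup (HPlus K S) := inferInstanceAs (AddCommGroup (TPlus K S))

instance : Module K (HPlus K S) := inferInstanceAs (Module K (TPlus K S))

instance : CommRing (HPlus K S) where
  __ := (inferInstance : AddCommGroup (HPlus K S))
  mul x y := shuffle K S x y
  one := one K S
  left_distrib x y z := map_add (shuffle K S x) y z
  right_distrib x y z := LinearMap.congr_fun (map_add (shuffle K S) x y) z
  zero_mul x := LinearMap.congr_fun (map_zero (shuffle K S)) x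
  mul_zero x := map_zero (shuffle K S x)
  mul_assoc x y z := shuffle_assoc x y z
  one_mul x := one_shuffle x
  mul_one x := (shuffle_comm x _).trans (one_shuffle x)
  mul_comm x y := shuffle_comm x y

instance : Algebra K (HPlus K S) :=
  Algebra.ofModule (fun r x y => LinearMap.congr_fun (map_smul (shuffle K S) r x) y)
    (fun r x y => map_smul (shuffle K S x) r y)

end DualAlgebra

/-! ### The bialgebra H⁺ -/

section DualCoalgebra

theorem cop_assoc : (TensorProduct.assoc K _ _ _).toLinearMap ∘ₗ (cop K S).rTensor _ ∘ₗ cop K S =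
    (cop K S).lTensor _ ∘ₗ cop K S :=
  isDualTo_cop.assoc isDualTo_cop gl_assoc

theorem coact_assoc :
    (TensorProduct.assoc K _ _ _).toLinearMap ∘ₗ (cop K S).rTensor _ ∘ₗ coact K S =
      (coact K S).lTensor _ ∘ₗ coact K S :=
  isDualTo_cop.assoc isDualTo_coact star_gl

theorem contract_eps_cop : contract K (eps K S) LinearMap.id ∘ₗ cop K S = LinearMap.id := by
  rw [eps_eq_pair]
  exact isDualTo_cop.contract_one gl_one_left

theorem contract_eps_coact : contract K (eps K S) LinearMap.id ∘ₗ coact K S = LinearMap.id := by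
  rw [eps_eq_pair]
  exact isDualTo_coact.contract_one star_one

theorem eps_rTensor_cop : (eps K S).rTensor _ ∘ₗ cop K S = TensorProduct.mk K K _ 1 := by
  refine LinearMap.ext fun t => (TensorProduct.lid K (TPlus K S)).injective ?_
  have h : (TensorProduct.lid K (TPlus K S)).toLinearMap ∘ₗ (eps K S).rTensor _ =
      contract K (eps K S) LinearMap.id := rfl
  have h' := LinearMap.congr_fun (contract_eps_cop (K := K) (S := S)) t
  rw [← h] at h'
  refine h'.trans ?_
  simp

theorem eps_lTensor_cop :
    (eps K S).lTensor _ ∘ₗ cop K S = (TensorProduct.mk K (TPlus K S) K).flip 1 := by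
  refine LinearMap.ext fun t => eq_of_contract_eq fun x => ?_
  have h1 : gl K S x (1 : Alg K S) = x := gl_one_right x
  have h := isDualTo_cop.contract_eq x (one K S)
  rw [← eps_eq_pair, ← LinearMap.id_comp (eps K S), ← contract_comp_lTensor] at h
  refine (LinearMap.congr_fun h t).trans
    ((congrArg (fun z : TPlus K S => pair K (PosTree S) z t) h1).trans ?_)
  rw [LinearMap.flip_apply, TensorProduct.mk_apply, contract_tmul, LinearMap.id_apply, smul_eq_mul,
    mul_one]

instance : Coalgebra K (HPlus K S) where
  comul := cop K S
  counit := eps K S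
  coassoc := cop_assoc
  rTensor_counit_comp_comul := eps_rTensor_cop
  lTensor_counit_comp_comul := eps_lTensor_cop

theorem form_apply_one (y : TPlus K S) : form y (1 : Alg K S) = eps K S y := by
  rw [eps_eq_pair]
  exact pair_comm _ _

theorem eps_shuffle (x y : TPlus K S) :
    eps K S (shuffle K S x y) = eps K S x * eps K S y := by
  rw [← form_apply_one, form_shuffle, cv, bconv, LinearMap.comp_apply, Bialgebra.comul_one,
    ← form_apply_one, ← form_apply_one]
  rfl

theorem cop_one : cop K S (one K S) = one K S ⊗ₜ one K S := by
  refine eq_of_contract_pair_eq fun x y => ?_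
  have h : ∀ x : Alg K S, pair K (PosTree S) x (one K S) = counit (R := K) x := fun x => by
    rw [pair_eq_form, form_one]
  rw [← LinearMap.comp_apply, isDualTo_cop.contract_eq, contract_tmul]
  exact (h _).trans ((counit_gl x y).trans (congrArg₂ (· * ·) (h x).symm (h y).symm))

/-- An element of `𝔗⁺`, as a linear form on `H⁺`. -/
def dualForm (x : Alg K S) : HPlus K S →ₗ[K] K := pair K (PosTree S) x

theorem form_mul_form (x y : Alg K S) (a b : HPlus K S) :
    form (K := K) (S := S) a x * form (K := K) (S := S) b y = dualForm x a * dualForm y b :=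
  congrArg₂ (fun c d : K => c * d) (pair_eq_form x a).symm (pair_eq_form y b).symm

theorem dualForm_mul {x : Alg K S} {ι : Type*} (r : Repr K x ι) (a b : HPlus K S) :
    dualForm x (a * b) = ∑ k ∈ r.index, dualForm (r.left k) a * dualForm (r.right k) b := by
  have h := LinearMap.congr_fun (form_shuffle (K := K) (S := S) a b) x
  rw [bconv_apply _ _ _ r] at h
  exact (pair_eq_form _ _).trans (h.trans (Finset.sum_congr rfl fun k _ =>
    (form_mul_form _ _ _ _)))

theorem contract_mul {x s : Alg K S} {ι κ : Type*} (r : Repr K x ι) (r' : Repr K s κ)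
    (u v : HPlus K S ⊗[K] HPlus K S) :
    contract K (dualForm x) (dualForm s) (u * v) = ∑ k ∈ r.index, ∑ l ∈ r'.index,
      contract K (dualForm (r.left k)) (dualForm (r'.left l)) u *
        contract K (dualForm (r.right k)) (dualForm (r'.right l)) v := by
  induction u using TensorProduct.induction_on with
  | zero => simp
  | add u u' hu hu' => simp only [add_mul, map_add, hu, hu', Finset.sum_add_distrib]
  | tmul a b =>
    induction v using TensorProduct.induction_on with
    | zero => simp
    | add u u' hu hu' => simp only [mul_add, map_add, hu, hu', Finset.sum_add_distrib]
    | tmul c d =>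
      rw [Algebra.TensorProduct.tmul_mul_tmul, contract_tmul, dualForm_mul r, dualForm_mul r',
        smul_eq_mul, Finset.sum_mul_sum]
      refine Finset.sum_congr rfl fun k _ => Finset.sum_congr rfl fun l _ => ?_
      rw [contract_tmul, contract_tmul, smul_eq_mul, smul_eq_mul]
      ring

theorem contract_dualForm_comul (x s : Alg K S) (y : HPlus K S) :
    contract K (dualForm x) (dualForm s) (comul (R := K) y) = dualForm (gl K S x s) y :=
  LinearMap.congr_fun (isDualTo_cop.contract_eq x s) y

/-- The transpose of `comul_gl`: tested against x ⊗ s, both sides become the same double sum over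
the coproducts of x and s. -/
theorem cop_mul (y z : HPlus K S) :
    comul (R := K) (y * z) = comul (R := K) y * comul (R := K) z := by
  have h : ∀ x s : Alg K S, contract K (dualForm x) (dualForm s) (comul (R := K) (y * z)) =
      contract K (dualForm x) (dualForm s) (comul (R := K) y * comul (R := K) z) := by
    intro x s
    rw [contract_dualForm_comul, contract_mul (ℛ K x) (ℛ K s)]
    have e := LinearMap.congr_fun (form_shuffle (K := K) (S := S) y z) (gl K S x s)
    rw [bconv_gl _ _ _ (ℛ K x) (ℛ K s)] at e
    refine (pair_eq_form _ _).trans (e.trans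
      (Finset.sum_congr rfl fun k _ => Finset.sum_congr rfl fun l _ => ?_))
    rw [contract_dualForm_comul, contract_dualForm_comul]
    exact form_mul_form _ _ _ _
  exact eq_of_contract_pair_eq h

instance : Bialgebra K (HPlus K S) :=
  Bialgebra.mk' K (HPlus K S) (by exact Finsupp.single_eq_same) (fun {x y} => eps_shuffle x y)
    cop_one (fun {x y} => cop_mul x y)

end DualCoalgebra

/-! ### The antipode of H⁺ -/

section DualAntipode

theorem PosTree.wt_toTree (x : PosTree S) : x.toTree.2.wt = x.wt := by
  obtain ⟨m, w⟩ := x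
  rw [toTree_eq, PosTree.wt]
  induction w with
  | nil => simp [tree, PTree.wt_vertex]
  | cons p w ih =>
    simp only at ih ⊢
    rw [List.map_cons, List.sum_cons, Planted.wt]
    refine (PTree.wt_kernel p.i p.a p.τ.2 (tree m w)).trans ?_
    rw [ih]
    abel

theorem wt_of_gl_ne_zero {x s t : PosTree S}
    (h : Alg.coeff K t (gl K S (Alg.mono K x) (Alg.mono K s)) ≠ 0) : t.wt = x.wt + s.wt := by
  rw [coeff_gl] at h
  rw [← PosTree.wt_toTree, wt_of_star_ne_zero h, PosTree.wt_toTree]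

/-- The number of edges and the integer part of the regularity, ordered lexicographically. -/
def PosTree.rank (x : PosTree S) : ℕ ×ₗ ℕ := toLex (x.wt.2, ⌊x.wt.1⌋₊)

theorem PosTree.rank_lt {x s t : PosTree S} (h : t.wt = x.wt + s.wt) (hs : s ≠ (0, [])) :
    x.rank < t.rank := by
  rw [rank, rank, Prod.Lex.toLex_lt_toLex, h]
  obtain ⟨m, w⟩ := s
  cases w with
  | nil =>
    have hm : m.size ≠ 0 := fun h => hs (by rw [MI.size_eq_zero.1 h])
    have h1 : PosTree.wt ((m, []) : PosTree S) = ((m.size : ℝ), 0) := by simp [PosTree.wt]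
    rw [h1]
    refine Or.inr ⟨rfl, ?_⟩
    simp only [Prod.fst_add]
    rw [Nat.floor_add_natCast x.wt_fst_nonneg]
    omega
  | cons p w =>
    refine Or.inl ?_
    simp [PosTree.wt, Planted.wt, PTree.edgeWt]

variable (K S) in
/-- The basis of `H⁺` consisting of trees. -/
def dualBasis : Module.Basis (PosTree S) K (HPlus K S) :=
  Module.Basis.ofRepr (LinearEquiv.refl K (TPlus K S))

theorem mem_span_of_coeff {α β : Type*} {p : α → β → Prop} (u : (α →₀ K) ⊗[K] (β →₀ K))
    (h : ∀ a b, finsuppTensorFinsupp' K α β u (a, b) ≠ 0 → p a b) :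
    u ∈ Submodule.span K {u | ∃ a b, p a b ∧ u = Finsupp.single a 1 ⊗ₜ[K] Finsupp.single b 1} := by
  rw [← (finsuppTensorFinsupp' K α β).symm_apply_apply u,
    ← Finsupp.sum_single (finsuppTensorFinsupp' K α β u), Finsupp.sum, map_sum]
  refine sum_mem fun q hq => ?_
  rw [finsuppTensorFinsupp'_symm_single_eq_single_one_tmul, ← Finsupp.smul_single_one q.2,
    TensorProduct.tmul_smul]
  exact Submodule.smul_mem _ _ (Submodule.subset_span
    ⟨q.1, q.2, h _ _ (Finsupp.mem_support_iff.1 hq), rfl⟩)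

theorem cop_mem_span (t : PosTree S) : cop K S (Finsupp.single t 1) ∈
    Submodule.span K {u | ∃ x s : PosTree S, (s = (0, []) ∨ x.rank < t.rank) ∧
      u = Finsupp.single x 1 ⊗ₜ[K] Finsupp.single s 1} := by
  refine mem_span_of_coeff _ fun x s h => ?_
  rw [isDualTo_cop x s t] at h
  by_cases hs : s = (0, [])
  · exact Or.inl hs
  · exact Or.inr (PosTree.rank_lt (wt_of_gl_ne_zero h) hs)

theorem HPlus.exists_antipode : ∃ s : HPlus K S →ₗ[K] HPlus K S,
    LinearMap.mul' K _ ∘ₗ s.rTensor _ ∘ₗ comul = Algebra.linearMap K _ ∘ₗ counit ∧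
    LinearMap.mul' K _ ∘ₗ s.lTensor _ ∘ₗ comul = Algebra.linearMap K _ ∘ₗ counit :=
  PlanarRS.exists_antipode (H := HPlus K S) (dualBasis K S) (0, []) PosTree.rank rfl
    (fun _ hb => Finsupp.single_eq_of_ne hb.symm) cop_mem_span

instance : HopfAlgebra K (HPlus K S) where
  antipode := HPlus.exists_antipode.choose
  mul_antipode_rTensor_comul := HPlus.exists_antipode.choose_spec.1
  mul_antipode_lTensor_comul := HPlus.exists_antipode.choose_spec.2

theorem isHopfAlgebra_cop : IsHopfAlgebra (shuffle K S) (one K S) (cop K S) (eps K S) :=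
  ⟨HPlus K S, inferInstance, inferInstance, LinearEquiv.refl K (TPlus K S), fun _ _ => rfl, rfl,
    fun _ => (LinearMap.congr_fun TensorProduct.map_id _).symm, fun _ => rfl⟩

end DualAntipode

end

section

open Coalgebra

variable {K : Type*} [Field K] {S : TreeData}

/-! ### Characters and the recentering group -/

section Characters

variable (K S) in
/-- The linear form underlying a character of `H⁺`. -/
def ofAlgHom (f : WithConv (HPlus K S →ₐ[K] K)) : TPlus K S →ₗ[K] K := f.ofConv.toLinearMap

theorem isCharacter_ofAlgHom (f : WithConv (HPlus K S →ₐ[K] K)) :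
    IsCharacter (shuffle K S) (one K S) (ofAlgHom K S f) :=
  ⟨map_one f.ofConv, fun x y => map_mul (M := HPlus K S) f.ofConv x y⟩

theorem exists_ofAlgHom {g : TPlus K S →ₗ[K] K} (hg : IsCharacter (shuffle K S) (one K S) g) :
    ∃ f, ofAlgHom K S f = g :=
  ⟨WithConv.toConv (AlgHom.ofLinearMap (A := HPlus K S) g hg.map_one hg.map_mul), rfl⟩

theorem ofAlgHom_one : ofAlgHom K S 1 = eps K S := rfl

theorem ofAlgHom_mul (f g : WithConv (HPlus K S →ₐ[K] K)) :
    ofAlgHom K S (f * g) = conv (cop K S) (ofAlgHom K S f) (ofAlgHom K S g) := by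
  have h : LinearMap.mul' K K ∘ₗ TensorProduct.map (ofAlgHom K S f) (ofAlgHom K S g) =
      (TensorProduct.lid K K).toLinearMap ∘ₗ
        TensorProduct.map (ofAlgHom K S f) (ofAlgHom K S g) :=
    TensorProduct.ext' fun x y => by simp
  exact congrArg (· ∘ₗ cop K S) h

theorem Gam_eq_contract (g : TPlus K S →ₗ[K] K) :
    Gam (coact K S) g = contract K g LinearMap.id ∘ₗ coact K S := rfl

/-- The coaction applied first, the one contracted with h, produces the left tensor factor of the
iterated coaction. Hence the order of g and h is reversed. -/
theorem Gam_comp_Gam (g h : TPlus K S →ₗ[K] K) :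
    Gam (coact K S) g ∘ₗ Gam (coact K S) h = Gam (coact K S) (conv (cop K S) h g) := by
  have h1 : Gam (coact K S) (conv (cop K S) h g) = (contract K h (contract K g LinearMap.id) ∘ₗ
      (TensorProduct.assoc K _ _ _).toLinearMap) ∘ₗ (cop K S).rTensor _ ∘ₗ coact K S := by
    rw [contract_contract_assoc, ← LinearMap.comp_assoc, contract_comp_rTensor]
    rfl
  rw [h1, LinearMap.comp_assoc, coact_assoc, ← LinearMap.comp_assoc, contract_comp_lTensor,
    Gam_eq_contract, Gam_eq_contract, ← LinearMap.comp_assoc, comp_contract, LinearMap.comp_id]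

theorem Gam_eps : Gam (coact K S) (eps K S) = LinearMap.id := contract_eps_coact

variable (K S) in
/-- The operator attached to a character of `H⁺`. -/
def recenter (f : WithConv (HPlus K S →ₐ[K] K)) : T K S →ₗ[K] T K S :=
  Gam (coact K S) (ofAlgHom K S f)

theorem recenter_comp (f g : WithConv (HPlus K S →ₐ[K] K)) :
    recenter K S f ∘ₗ recenter K S g = recenter K S (g * f) := by
  rw [recenter, recenter, recenter, Gam_comp_Gam, ofAlgHom_mul]

theorem recenter_one : recenter K S 1 = LinearMap.id := Gam_eps

variable (K S) in
/-- The invertible operator attached to a character of `H⁺`. -/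
def recenterEquiv (f : WithConv (HPlus K S →ₐ[K] K)) : T K S ≃ₗ[K] T K S :=
  LinearEquiv.ofLinearMap (recenter K S f) (recenter K S f⁻¹)
    (by rw [recenter_comp, inv_mul_cancel, recenter_one])
    (by rw [recenter_comp, mul_inv_cancel, recenter_one])

theorem recenterEquiv_mul (f g : WithConv (HPlus K S →ₐ[K] K)) :
    recenterEquiv K S f * recenterEquiv K S g = recenterEquiv K S (g * f) :=
  LinearEquiv.toLinearMap_injective (recenter_comp f g)

variable (K S) in
/-- The recentering group. -/
def recenteringGroup : Subgroup (T K S ≃ₗ[K] T K S) where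
  carrier := Set.range (recenterEquiv K S)
  one_mem' := ⟨1, LinearEquiv.toLinearMap_injective recenter_one⟩
  mul_mem' := by
    rintro _ _ ⟨f, rfl⟩ ⟨g, rfl⟩
    -- The assignment of operators to characters reverses products, but its range is still closed
    -- under composition.
    exact ⟨g * f, (recenterEquiv_mul f g).symm⟩
  inv_mem' := by
    rintro _ ⟨f, rfl⟩
    refine ⟨f⁻¹, eq_inv_of_mul_eq_one_left ?_⟩
    rw [recenterEquiv_mul, mul_inv_cancel]
    exact LinearEquiv.toLinearMap_injective recenter_one

theorem mem_recenteringGroup (φ : T K S →ₗ[K] T K S) :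
    (∃ u ∈ recenteringGroup K S, u.toLinearMap = φ) ↔
      ∃ g, IsCharacter (shuffle K S) (one K S) g ∧ φ = Gam (coact K S) g := by
  constructor
  · rintro ⟨_, ⟨f, rfl⟩, rfl⟩
    exact ⟨ofAlgHom K S f, isCharacter_ofAlgHom f, rfl⟩
  · rintro ⟨g, hg, rfl⟩
    obtain ⟨f, rfl⟩ := exists_ofAlgHom hg
    exact ⟨recenterEquiv K S f, ⟨f, rfl⟩, rfl⟩

end Characters

/-! ### The bracket relations and the multiplicativity of the deshuffle coproduct -/

section Bracket

theorem bracket_X_X (i j : Fin S.d) : bracket (X K i) (X K j) = 0 :=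
  sub_eq_zero.2 (Alg.X_mul_X (K := K) i j)

theorem bracket_planted_X (p : Planted S) (i : Fin S.d) : bracket (planted K p) (X K i) =
    if 0 < p.a i then planted K (p.lower (MI.unit i)) else 0 :=
  sub_eq_iff_eq_add'.2 (Alg.pl_mul_X (K := K) p i)

theorem deshuffle_of_mem_V {v : TPlus K S} (hv : v ∈ V K S) :
    deshuffle K S v = v ⊗ₜ[K] one K S + one K S ⊗ₜ[K] v :=
  (LinearMap.congr_fun (Alg.comul_eq (K := K) (S := S)) v).symm.trans (Alg.comul_of_mem_lieV hv)

theorem deshuffle_dot (x y : TPlus K S) : deshuffle K S (dot K S x y) =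
    TensorProduct.map₂ (dot K S) (dot K S) (deshuffle K S x) (deshuffle K S y) := by
  have h := Bialgebra.comul_mul (R := K) (A := Alg K S) x y
  rw [← map₂_mul, Alg.comul_eq] at h
  exact h

end Bracket

end

end PlanarRS

end

theorem mainTheorem6 (K : Type*) [Field K] [CharZero K] (S : PlanarRS.TreeData) :
    -- `𝔗⁺` is the enveloping algebra of the Lie algebra `V`, with its prescribed bracket
    PlanarRS.IsEnvelopingAlgebra (PlanarRS.dot K S) (PlanarRS.one K S) (PlanarRS.V K S) ∧
    (∀ i j : Fin S.d, PlanarRS.bracket (PlanarRS.X K i) (PlanarRS.X K j) = 0) ∧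
    (∀ (p : PlanarRS.Planted S) (i : Fin S.d),
      PlanarRS.bracket (PlanarRS.planted K p) (PlanarRS.X K i) =
        if 0 < p.a i then PlanarRS.planted K (p.lower (PlanarRS.MI.unit i)) else 0) ∧
    -- the deshuffle coproduct: `V` is primitive, and it is a morphism for the associative product
    (∀ v ∈ PlanarRS.V K S, PlanarRS.deshuffle K S v =
      v ⊗ₜ[K] PlanarRS.one K S + PlanarRS.one K S ⊗ₜ[K] v) ∧
    (∀ x y : PlanarRS.TPlus K S, PlanarRS.deshuffle K S (PlanarRS.dot K S x y) =
      TensorProduct.map₂ (PlanarRS.dot K S) (PlanarRS.dot K S)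
        (PlanarRS.deshuffle K S x) (PlanarRS.deshuffle K S y)) ∧
    -- the post-Lie product of `V` and its Guin--Oudom extension exist and are unique
    ∃ tri : PlanarRS.TPlus K S →ₗ[K] Module.End K (PlanarRS.TPlus K S),
      PlanarRS.IsDeformedPostLie tri ∧ PlanarRS.IsGuinOudom tri ∧
      (∀ tri', PlanarRS.IsDeformedPostLie tri' → PlanarRS.IsGuinOudom tri' → tri' = tri) ∧
      -- the Hopf algebra `(𝔗⁺, ∗₊, Δ_⧢)`
      PlanarRS.IsHopfAlgebra (PlanarRS.grossmanLarson (PlanarRS.dot K S) tri) (PlanarRS.one K S)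
        (PlanarRS.deshuffle K S) (PlanarRS.eps K S) ∧
      -- the dual Hopf algebra `H⁺ = (𝔗⁺, ⧢, Δ⁺)`
      ∃ cop : PlanarRS.TPlus K S →ₗ[K] PlanarRS.TPlus K S ⊗[K] PlanarRS.TPlus K S,
        PlanarRS.IsDualTo cop (PlanarRS.grossmanLarson (PlanarRS.dot K S) tri) ∧
        PlanarRS.IsDualTo (PlanarRS.deshuffle K S) (PlanarRS.shuffle K S) ∧
        PlanarRS.IsHopfAlgebra (PlanarRS.shuffle K S) (PlanarRS.one K S) cop
          (PlanarRS.eps K S) ∧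
        -- the action of `𝔗⁺` on `𝔗`, the dual coaction, and the recentering group
        ∃ triT : PlanarRS.TPlus K S →ₗ[K] Module.End K (PlanarRS.T K S),
          PlanarRS.IsExtendedGrafting tri triT ∧
          (∀ triT', PlanarRS.IsExtendedGrafting tri triT' → triT' = triT) ∧
          PlanarRS.grossmanLarson (PlanarRS.dotT K S) triT (PlanarRS.one K S) = 1 ∧
          (∀ x y, PlanarRS.grossmanLarson (PlanarRS.dotT K S) triT
              (PlanarRS.grossmanLarson (PlanarRS.dot K S) tri x y) =
            PlanarRS.grossmanLarson (PlanarRS.dotT K S) triT x *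
              PlanarRS.grossmanLarson (PlanarRS.dotT K S) triT y) ∧
          ∃ coact : PlanarRS.T K S →ₗ[K] PlanarRS.TPlus K S ⊗[K] PlanarRS.T K S,
            PlanarRS.IsDualTo coact (PlanarRS.grossmanLarson (PlanarRS.dotT K S) triT) ∧
            -- the characters of `H⁺` form a group under convolution
            PlanarRS.IsCharacter (PlanarRS.shuffle K S) (PlanarRS.one K S)
              (PlanarRS.eps K S) ∧
            (∀ g h, PlanarRS.IsCharacter (PlanarRS.shuffle K S) (PlanarRS.one K S) g →
              PlanarRS.IsCharacter (PlanarRS.shuffle K S) (PlanarRS.one K S) h →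
              PlanarRS.IsCharacter (PlanarRS.shuffle K S) (PlanarRS.one K S)
                (PlanarRS.conv cop g h) ∧
              PlanarRS.Gam coact g ∘ₗ PlanarRS.Gam coact h =
                PlanarRS.Gam coact (PlanarRS.conv cop h g)) ∧
            (∀ g, PlanarRS.IsCharacter (PlanarRS.shuffle K S) (PlanarRS.one K S) g →
              ∃ h, PlanarRS.IsCharacter (PlanarRS.shuffle K S) (PlanarRS.one K S) h ∧
                PlanarRS.conv cop g h = PlanarRS.eps K S ∧
                PlanarRS.conv cop h g = PlanarRS.eps K S) ∧
            -- the operators `Γ_g`, `g` a character of `H⁺`, form a group acting on `𝔗`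
            ∃ G : Subgroup (PlanarRS.T K S ≃ₗ[K] PlanarRS.T K S),
              ∀ φ : PlanarRS.T K S →ₗ[K] PlanarRS.T K S,
                (∃ u ∈ G, u.toLinearMap = φ) ↔
                  ∃ g, PlanarRS.IsCharacter (PlanarRS.shuffle K S) (PlanarRS.one K S) g ∧
                    φ = PlanarRS.Gam coact g := by
  refine ⟨PlanarRS.isEnvelopingAlgebra, PlanarRS.bracket_X_X, PlanarRS.bracket_planted_X,
    fun v hv => PlanarRS.deshuffle_of_mem_V hv, PlanarRS.deshuffle_dot, PlanarRS.tri K S,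
    PlanarRS.isDeformedPostLie, PlanarRS.isGuinOudom,
    fun τ h h' => PlanarRS.postLie_unique h h', ?_, PlanarRS.cop K S, ?_,
    PlanarRS.isDualTo_deshuffle_shuffle, PlanarRS.isHopfAlgebra_cop, PlanarRS.act K S,
    PlanarRS.isExtendedGrafting, fun τ h => PlanarRS.extendedGrafting_unique h, ?_, ?_,
    PlanarRS.coact K S, ?_, PlanarRS.isCharacter_ofAlgHom 1, ?_, ?_,
    PlanarRS.recenteringGroup K S, PlanarRS.mem_recenteringGroup⟩
  · rw [PlanarRS.grossmanLarson_tri]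
    exact PlanarRS.isHopfAlgebra_gl
  · rw [PlanarRS.grossmanLarson_tri]
    exact PlanarRS.isDualTo_cop
  · rw [PlanarRS.grossmanLarson_act]
    exact PlanarRS.star_one
  · rw [PlanarRS.grossmanLarson_act, PlanarRS.grossmanLarson_tri]
    exact PlanarRS.star_gl
  · rw [PlanarRS.grossmanLarson_act]
    exact PlanarRS.isDualTo_coact
  · intro g h hg hh
    refine ⟨?_, PlanarRS.Gam_comp_Gam g h⟩
    obtain ⟨g, rfl⟩ := PlanarRS.exists_ofAlgHom hg
    obtain ⟨h, rfl⟩ := PlanarRS.exists_ofAlgHom hh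
    rw [← PlanarRS.ofAlgHom_mul]
    exact PlanarRS.isCharacter_ofAlgHom _
  · intro g hg
    obtain ⟨g, rfl⟩ := PlanarRS.exists_ofAlgHom hg
    refine ⟨PlanarRS.ofAlgHom K S g⁻¹, PlanarRS.isCharacter_ofAlgHom _, ?_, ?_⟩
    · rw [← PlanarRS.ofAlgHom_mul, mul_inv_cancel, PlanarRS.ofAlgHom_one]
    · rw [← PlanarRS.ofAlgHom_mul, inv_mul_cancel, PlanarRS.ofAlgHom_one]
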